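/- Let $\mathbb{K}$ be a commutative ring. A dg-module is a non-negatively graded chain complex of $\mathbb{K}$-modules (with differential of degree $-1$). A dg-$\Sigma_*$-module $M$ is a sequence of dg-modules $M(r)$, $r\in\mathbb{N}$, with an action of the symmetric group $\Sigma_r$ on $M(r)$ by morphisms of dg-modules (equivalently, a functor $I\mapsto M(I)$ from finite sets and bijections to dg-modules). Quasi-isomorphisms and $\mathbb{K}$-projectivity of dg-$\Sigma_*$-modules are understood arity by arity. The composition product of $M$ and $N$ is $$(M\circ N)(n)=\bigoplus_{r\ge 0}\Bigl(\bigoplus_{J_1\amalg\cdots\amalg J_r=\{1,\dots,n\}}M(r)\otimes N(J_1)\otimes\cdots\otimes N(J_r)\Bigr)_{\Sigma_r}.$$ A dg-operad $P$ is connected if $P(0)=0$ and $P(1)=\mathbb{K}\,1$, a free module on the unit. A quasi-free right $P$-module is a dg right $P$-module $L$ which, as a graded right $P$-module, is a free module $L=M\circ P$ on a dg-$\Sigma_*$-module $M$, and whose differential is $\delta_\theta=\delta+d_\theta$, where $\delta$ is the canonical differential of $M\circ P$, where $d_\theta$ is homogeneous of degree $-1$ with $d_\theta(x(q_1,\dots,q_r))=d_\theta(x)(q_1,\dots,q_r)$,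 and where the composite of $d_\theta$ with the projection $M\circ P\to M$ vanishes. The indecomposable quotient $\bar L=L\circ_P I$ of a right module $L$ over a connected operad $P$ is the quotient of $L$ by the composites $x\circ_i q$ with $x\in L$ and $q\in P(n)$, $n\ge 2$, with the induced differential; for $L$ quasi-free as above it is identified with $M$, so that $L=\bar L\circ P$. **Theorem.** Let $\psi:P\to P'$ be a morphism of connected dg-operads. Let $L$ be a quasi-free right $P$-module, let $L'$ be a quasi-free right $P'$-module, and let $\phi:L\to L'$ be a morphism of right $P$-modules, where $L'$ is regarded as a right $P$-module by restriction of structure along $\psi$. If $\mathbb{K}$ is not a field, assume in addition that $P$, $P'$, $\bar L$ and $\bar L'$ are projective as $\mathbb{K}$-modules. Let $\bar\phi:\bar L\to\bar L'$ be the morphism of dg-$\Sigma_*$-modules induced by $\phi$ on the indecomposable quotients of the right $P$-module $L$ and of the right $P'$-module $L'$. (a) If $\psi$ and $\bar\phi$ are quasi-isomorphisms, then so is $\phi$. (b) If $\psi$ and $\phi$ are quasi-isomorphisms, then so is $\bar\phi$. (c) Assume in addition that $\bar L(0)=\bar L'(0)=0$ and $\bar L(1)=\bar L'(1)=\mathbb{K}$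 (concentrated in degree $0$). If $\phi$ and $\bar\phi$ are quasi-isomorphisms, then so is $\psi$. -/

import Mathlib

open scoped TensorProduct DirectSum

universe u v

noncomputable section

namespace OperadComparison

/-! ## Differential graded modules -/

/-- A dg-module over `K`: an `ℕ`-graded `K`-module `V = ⨁ V_d` with a differential
`δ : V_d → V_{d-1}` (so `δ = 0` on `V_0`) such that `δ² = 0`. -/
structure DGModule (K : Type u) [CommRing K] where
  carrier : Type v
  [addCommGroup : AddCommGroup carrier]
  [module : Module K carrier]
  /-- The homogeneous component of degree `d`. -/
  gr : ℕ → Submodule K carrier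
  isInternal : DirectSum.IsInternal gr
  /-- The differential. -/
  δ : carrier →ₗ[K] carrier
  δ_mem : ∀ (d : ℕ) (x : carrier), x ∈ gr (d + 1) → δ x ∈ gr d
  δ_zero : ∀ x : carrier, x ∈ gr 0 → δ x = 0
  δ_δ : ∀ x : carrier, δ (δ x) = 0

namespace DGModule

variable {K : Type u} [CommRing K]

instance : CoeSort (DGModule.{u, v} K) (Type v) := ⟨DGModule.carrier⟩

instance (V : DGModule.{u, v} K) : AddCommGroup V := V.addCommGroup

instance (V : DGModule.{u, v} K) : Module K V := V.module

/-- A morphism of dg-modules: linear, homogeneous of degree `0`, commuting with differentials. -/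
structure Hom (V W : DGModule.{u, v} K) where
  toFun : V →ₗ[K] W
  map_gr : ∀ (d : ℕ) (x : V), x ∈ V.gr d → toFun x ∈ W.gr d
  map_δ : ∀ x : V, toFun (V.δ x) = W.δ (toFun x)

instance (V W : DGModule.{u, v} K) : CoeFun (Hom V W) (fun _ => V → W) := ⟨fun f => f.toFun⟩

/-- The cycles `ker δ`. -/
def cycles (V : DGModule.{u, v} K) : Submodule K V := LinearMap.ker V.δ

/-- The homology `H_*(V) = ker δ / im δ`. -/
abbrev homology (V : DGModule.{u, v} K) : Type v :=
  V.cycles ⧸ (LinearMap.range V.δ).submoduleOf V.cycles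

/-- The restriction to cycles of a morphism of dg-modules. -/
def Hom.cyclesMap {V W : DGModule.{u, v} K} (f : Hom V W) : V.cycles →ₗ[K] W.cycles :=
  f.toFun.restrict (by
    intro x hx
    have hx' : V.δ x = 0 := hx
    change W.δ (f.toFun x) = 0
    rw [← f.map_δ, hx', map_zero])

/-- The map induced in homology by a morphism of dg-modules. -/
def Hom.homologyMap {V W : DGModule.{u, v} K} (f : Hom V W) : V.homology →ₗ[K] W.homology :=
  Submodule.mapQ _ _ f.cyclesMap (by
    rintro ⟨x, hx⟩ ⟨y, hy⟩
    exact ⟨f.toFun y, by rw [← f.map_δ, hy]; rfl⟩)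

/-- A quasi-isomorphism: a morphism of dg-modules which induces an isomorphism in homology. -/
def Hom.QuasiIso {V W : DGModule.{u, v} K} (f : Hom V W) : Prop :=
  Function.Bijective f.homologyMap

/-- `V ≅ K` as a dg-module, with `K` concentrated in degree `0`. -/
def IsGroundRing (V : DGModule.{u, v} K) : Prop :=
  ∃ u ∈ V.gr 0, Function.Bijective (fun k : K => k • u)

theorem iSup_gr (V : DGModule.{u, v} K) : ⨆ d, V.gr d = ⊤ := V.isInternal.submodule_iSup_eq_top

theorem homogeneous_induction (V : DGModule.{u, v} K) {p : V → Prop} (x : V)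
    (hom : ∀ d, ∀ y ∈ V.gr d, p y) (zero : p 0) (add : ∀ y z, p y → p z → p (y + z)) : p x :=
  Submodule.iSup_induction V.gr (motive := p) (x := x) (by rw [V.iSup_gr]; trivial) hom zero add

/-- The projection of `V` onto its component of degree `d`, as an endomorphism of `V`. -/
def component (V : DGModule.{u, v} K) (d : ℕ) : V →ₗ[K] V :=
  (V.gr d).subtype ∘ₗ DirectSum.component K ℕ (fun d => V.gr d) d ∘ₗ
    (LinearEquiv.ofBijective (DirectSum.coeLinearMap V.gr) V.isInternal).symm.toLinearMap

theorem component_same (V : DGModule.{u, v} K) (d : ℕ) (x : V) (hx : x ∈ V.gr d) :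
    V.component d x = x := by
  exact congrArg Subtype.val (V.isInternal.ofBijective_coeLinearMap_of_mem hx)

theorem component_ne (V : DGModule.{u, v} K) (d e : ℕ) (h : e ≠ d) (x : V) (hx : x ∈ V.gr e) :
    V.component d x = 0 := by
  exact congrArg Subtype.val (V.isInternal.ofBijective_coeLinearMap_of_mem_ne h hx)

/-- The quotient of a dg-module by a submodule which is generated by homogeneous elements and
stable under the differential, with the induced grading and differential. -/
def quotient (V : DGModule.{u, v} K) (S : Set V) (hS : ∀ x ∈ S, ∃ d, x ∈ V.gr d)
    (hδ : ∀ x ∈ S, V.δ x ∈ Submodule.span K S) : DGModule.{u, v} K where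
  carrier := V ⧸ Submodule.span K S
  gr d := (V.gr d).map (Submodule.span K S).mkQ
  isInternal := by
    have hcomp : ∀ d, Submodule.span K S ≤ (Submodule.span K S).comap (V.component d) := by
      intro d
      refine Submodule.span_le.2 fun x hx => ?_
      obtain ⟨e, he⟩ := hS x hx
      change V.component d x ∈ Submodule.span K S
      by_cases h : e = d
      · subst h; rw [V.component_same e x he]; exact Submodule.subset_span hx
      · rw [V.component_ne d e h x he]; exact Submodule.zero_mem _
    refine (DirectSum.isInternal_submodule_iff_iSupIndep_and_iSup_eq_top _).2 ⟨?_, ?_⟩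
    · intro d
      rw [Submodule.disjoint_def]
      rintro _ ⟨x, hx, rfl⟩ h2
      have hker : (⨆ e, ⨆ (_ : e ≠ d), (V.gr e).map (Submodule.span K S).mkQ) ≤
          LinearMap.ker (Submodule.mapQ _ _ (V.component d) (hcomp d)) := by
        refine iSup₂_le fun e he => ?_
        rintro _ ⟨y, hy, rfl⟩
        change Submodule.mapQ _ _ (V.component d) (hcomp d) (Submodule.Quotient.mk y) = 0
        rw [Submodule.mapQ_apply, V.component_ne d e he y hy]; rfl
      have h3 : Submodule.mapQ _ _ (V.component d) (hcomp d) (Submodule.Quotient.mk x) = 0 :=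
        hker h2
      rw [Submodule.mapQ_apply, V.component_same d x hx] at h3
      exact h3
    · rw [← Submodule.map_iSup, V.iSup_gr, Submodule.map_top, Submodule.range_mkQ]
  δ := Submodule.mapQ _ _ V.δ (Submodule.span_le.2 hδ)
  δ_mem := by
    rintro d _ ⟨x, hx, rfl⟩
    exact ⟨V.δ x, V.δ_mem d x hx, rfl⟩
  δ_zero := by
    rintro _ ⟨x, hx, rfl⟩
    change Submodule.mapQ _ _ V.δ _ (Submodule.Quotient.mk x) = 0
    rw [Submodule.mapQ_apply, V.δ_zero x hx]; rfl
  δ_δ := by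
    intro x
    obtain ⟨x, rfl⟩ := Submodule.Quotient.mk_surjective _ x
    rw [Submodule.mapQ_apply, Submodule.mapQ_apply, V.δ_δ]; rfl

/-- The morphism induced on quotients. -/
def quotientMap {V W : DGModule.{u, v} K} (f : Hom V W) {S : Set V} {T : Set W}
    (hS : ∀ x ∈ S, ∃ d, x ∈ V.gr d) (hδS : ∀ x ∈ S, V.δ x ∈ Submodule.span K S)
    (hT : ∀ x ∈ T, ∃ d, x ∈ W.gr d) (hδT : ∀ x ∈ T, W.δ x ∈ Submodule.span K T)
    (hf : ∀ x ∈ S, f x ∈ Submodule.span K T) :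
    Hom (V.quotient S hS hδS) (W.quotient T hT hδT) where
  toFun := Submodule.mapQ (Submodule.span K S) (Submodule.span K T) f.toFun
    (Submodule.span_le.2 hf)
  map_gr := by
    rintro d _ ⟨x, hx, rfl⟩
    exact ⟨f x, f.map_gr d x hx, rfl⟩
  map_δ := by
    intro x
    obtain ⟨x, rfl⟩ := Submodule.Quotient.mk_surjective _ x
    exact congrArg Submodule.Quotient.mk (f.map_δ x)

end DGModule

/-! ## dg-`Σ_*`-modules -/

/-- A dg-`Σ_*`-module, indexed by finite sets: a functor `I ↦ M(I)` from finite sets and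
bijections to dg-modules.  Its arity `r` component is `M(r) = M({1, …, r})`, on which the
symmetric group `Σ_r` acts by `w ↦ map w`; the datum of the representations `M(r)`, `r ∈ ℕ`, is
equivalent to the datum of the functor. -/
structure SigmaModule (K : Type u) [CommRing K] where
  obj : (I : Type) → [Finite I] → DGModule.{u, v} K
  map : ∀ {I J : Type} [Finite I] [Finite J], I ≃ J → (obj I).Hom (obj J)
  map_refl : ∀ {I : Type} [Finite I] (x : obj I), map (Equiv.refl I) x = x
  map_trans : ∀ {I J A : Type} [Finite I] [Finite J] [Finite A] (e : I ≃ J) (e' : J ≃ A)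
    (x : obj I), map (e.trans e') x = map e' (map e x)

namespace SigmaModule

variable {K : Type u} [CommRing K]

/-- A morphism of dg-`Σ_*`-modules. -/
structure Hom (M N : SigmaModule.{u, v} K) where
  app : ∀ (I : Type) [Finite I], (M.obj I).Hom (N.obj I)
  naturality : ∀ {I J : Type} [Finite I] [Finite J] (e : I ≃ J) (x : M.obj I),
    app J (M.map e x) = N.map e (app I x)

/-- A quasi-isomorphism of dg-`Σ_*`-modules: a quasi-isomorphism in every arity. -/
def Hom.QuasiIso {M N : SigmaModule.{u, v} K} (f : Hom M N) : Prop :=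
  ∀ (I : Type) [Finite I], (f.app I).QuasiIso

/-- `M` is projective as a `K`-module, that is, in every arity. -/
def IsKProjective (M : SigmaModule.{u, v} K) : Prop :=
  ∀ (I : Type) [Finite I], Module.Projective K (M.obj I)

/-- `M(0) = 0`. -/
def ZeroInArityZero (M : SigmaModule.{u, v} K) : Prop := Subsingleton (M.obj Empty)

/-- `M(1) = K`, concentrated in degree `0`. -/
def GroundRingInArityOne (M : SigmaModule.{u, v} K) : Prop := (M.obj Unit).IsGroundRing

end SigmaModule

/-! ## Grafting of finite sets -/

/-- The set `(I ∖ {i}) ⊔ J`, in which the element `i` of `I` is replaced by the set `J`. -/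
abbrev Graft {I : Type} (i : I) (J : Type) : Type := {x : I // x ≠ i} ⊕ J

/-- Bijections `I ≃ I'` and `J ≃ J'` induce `(I ∖ {i}) ⊔ J ≃ (I' ∖ {u i}) ⊔ J'`. -/
def graftCongr {I I' J J' : Type} (u : I ≃ I') (v : J ≃ J') (i : I) :
    Graft i J ≃ Graft (u i) J' :=
  Equiv.sumCongr (u.subtypeEquiv fun _ => (u.injective.ne_iff).symm) v

/-- Substituting `J` for `i` and then `A` for `j ∈ J` is substituting for `i` the result of the
substitution of `A` for `j`. -/
def graftAssoc {I J : Type} (i : I) (j : J) (A : Type) :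
    Graft (Sum.inr j : Graft i J) A ≃ Graft i (Graft j A) where
  toFun
    | Sum.inl ⟨Sum.inl x, _⟩ => Sum.inl x
    | Sum.inl ⟨Sum.inr y, h⟩ => Sum.inr (Sum.inl ⟨y, fun e => h (congrArg Sum.inr e)⟩)
    | Sum.inr a => Sum.inr (Sum.inr a)
  invFun
    | Sum.inl x => Sum.inl ⟨Sum.inl x, Sum.inl_ne_inr⟩
    | Sum.inr (Sum.inl y) => Sum.inl ⟨Sum.inr y.1, fun e => y.2 (Sum.inr_injective e)⟩
    | Sum.inr (Sum.inr a) => Sum.inr a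
  left_inv := by rintro (⟨_ | _, _⟩ | _) <;> rfl
  right_inv := by rintro (_ | _ | _) <;> rfl

/-- Substitutions at two different elements commute. -/
def graftComm {I : Type} {i i' : I} (h : i ≠ i') (J J' : Type) :
    Graft (Sum.inl ⟨i', h.symm⟩ : Graft i J) J' ≃ Graft (Sum.inl ⟨i, h⟩ : Graft i' J') J where
  toFun
    | Sum.inl ⟨Sum.inl x, hx⟩ => Sum.inl ⟨Sum.inl ⟨x.1, fun e => hx (congrArg Sum.inl
        (Subtype.ext e))⟩, fun e => x.2 (congrArg Subtype.val (Sum.inl_injective e))⟩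
    | Sum.inl ⟨Sum.inr y, _⟩ => Sum.inr y
    | Sum.inr y => Sum.inl ⟨Sum.inr y, Sum.inr_ne_inl⟩
  invFun
    | Sum.inl ⟨Sum.inl x, hx⟩ => Sum.inl ⟨Sum.inl ⟨x.1, fun e => hx (congrArg Sum.inl
        (Subtype.ext e))⟩, fun e => x.2 (congrArg Subtype.val (Sum.inl_injective e))⟩
    | Sum.inl ⟨Sum.inr y, _⟩ => Sum.inr y
    | Sum.inr y => Sum.inl ⟨Sum.inr y, Sum.inr_ne_inl⟩
  left_inv := by rintro (⟨_ | _, _⟩ | _) <;> rfl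
  right_inv := by rintro (⟨_ | _, _⟩ | _) <;> rfl

/-- Substituting a one-element set for `i` gives back `I`. -/
def graftUnit {I : Type} (i : I) : Graft i Unit ≃ I :=
  Equiv.ofBijective (Sum.elim Subtype.val fun _ => i) (by
    constructor
    · rintro (⟨x, hx⟩ | ⟨⟩) (⟨y, hy⟩ | ⟨⟩) h
      · exact congrArg Sum.inl (Subtype.ext h)
      · exact (hx h).elim
      · exact (hy h.symm).elim
      · rfl
    · intro x
      by_cases h : x = i
      · exact ⟨Sum.inr (), h.symm⟩
      · exact ⟨Sum.inl ⟨x, h⟩, rfl⟩)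

/-- Substituting `J` for the element of a one-element set gives `J`. -/
def unitGraft (J : Type) : Graft () J ≃ J where
  toFun
    | Sum.inl x => (x.2 rfl).elim
    | Sum.inr y => y
  invFun := Sum.inr
  left_inv := by
    rintro (x | y)
    · exact (x.2 rfl).elim
    · rfl
  right_inv _ := rfl

/-! ## dg-operads and right modules -/

/-- A dg-operad: a dg-`Σ_*`-module `P` with a unit `1 ∈ P(1)` and partial composition products
`∘_i : P(I) ⊗ P(J) → P((I ∖ {i}) ⊔ J)`, which are morphisms of dg-modules (homogeneous of degree
`0` and satisfying the derivation relation), natural with respect to bijections, unital and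
associative; the commutation of composites at two different entries involves the Koszul sign. -/
structure DGOperad (K : Type u) [CommRing K] extends SigmaModule.{u, v} K where
  one : obj Unit
  comp : ∀ {I J : Type} [Finite I] [Finite J] (i : I),
    obj I →ₗ[K] obj J →ₗ[K] obj (Graft i J)
  one_mem : one ∈ (obj Unit).gr 0
  comp_mem : ∀ {I J : Type} [Finite I] [Finite J] (i : I) (a b : ℕ) (p : obj I) (q : obj J),
    p ∈ (obj I).gr a → q ∈ (obj J).gr b → comp i p q ∈ (obj (Graft i J)).gr (a + b)
  δ_comp : ∀ {I J : Type} [Finite I] [Finite J] (i : I) (a : ℕ) (p : obj I) (q : obj J),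
    p ∈ (obj I).gr a →
      (obj (Graft i J)).δ (comp i p q) =
        comp i ((obj I).δ p) q + (-1 : K) ^ a • comp i p ((obj J).δ q)
  comp_map : ∀ {I I' J J' : Type} [Finite I] [Finite I'] [Finite J] [Finite J']
    (u : I ≃ I') (v : J ≃ J') (i : I) (p : obj I) (q : obj J),
    comp (u i) (map u p) (map v q) = map (graftCongr u v i) (comp i p q)
  comp_one : ∀ {I : Type} [Finite I] (i : I) (p : obj I),
    map (graftUnit i) (comp i p one) = p
  one_comp : ∀ {J : Type} [Finite J] (q : obj J), map (unitGraft J) (comp () one q) = q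
  comp_assoc : ∀ {I J A : Type} [Finite I] [Finite J] [Finite A] (i : I) (j : J)
    (p : obj I) (q : obj J) (s : obj A),
    map (graftAssoc i j A) (comp (Sum.inr j : Graft i J) (comp i p q) s) =
      comp i p (comp j q s)
  comp_comm : ∀ {I J J' : Type} [Finite I] [Finite J] [Finite J'] {i i' : I} (h : i ≠ i')
    (a b : ℕ) (p : obj I) (q : obj J) (q' : obj J'),
    q ∈ (obj J).gr a → q' ∈ (obj J').gr b →
      map (graftComm h J J') (comp (Sum.inl ⟨i', h.symm⟩ : Graft i J) (comp i p q) q') =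
        (-1 : K) ^ (a * b) • comp (Sum.inl ⟨i, h⟩ : Graft i' J') (comp i' p q') q

namespace DGOperad

variable {K : Type u} [CommRing K]

/-- An operad is connected if `P(0) = 0` and `P(1) = K 1`. -/
structure IsConnected (P : DGOperad.{u, v} K) : Prop where
  zero : P.ZeroInArityZero
  one : Function.Bijective (fun k : K => k • P.one)

/-- A morphism of dg-operads. -/
structure Hom (P P' : DGOperad.{u, v} K) extends
    SigmaModule.Hom P.toSigmaModule P'.toSigmaModule where
  map_one : app Unit P.one = P'.one
  map_comp : ∀ {I J : Type} [Finite I] [Finite J] (i : I) (p : P.obj I) (q : P.obj J),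
    app (Graft i J) (P.comp i p q) = P'.comp i (app I p) (app J q)

end DGOperad

/-- A (dg-)right module over a dg-operad `P`: a dg-`Σ_*`-module `L` with partial composition
products `∘_i : L(I) ⊗ P(J) → L((I ∖ {i}) ⊔ J)`, subject to the same relations as the partial
composition products of an operad. -/
structure RightModule {K : Type u} [CommRing K] (P : DGOperad.{u, v} K) extends
    SigmaModule.{u, v} K where
  comp : ∀ {I J : Type} [Finite I] [Finite J] (i : I),
    obj I →ₗ[K] P.obj J →ₗ[K] obj (Graft i J)
  comp_mem : ∀ {I J : Type} [Finite I] [Finite J] (i : I) (a b : ℕ) (x : obj I) (q : P.obj J),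
    x ∈ (obj I).gr a → q ∈ (P.obj J).gr b → comp i x q ∈ (obj (Graft i J)).gr (a + b)
  δ_comp : ∀ {I J : Type} [Finite I] [Finite J] (i : I) (a : ℕ) (x : obj I) (q : P.obj J),
    x ∈ (obj I).gr a →
      (obj (Graft i J)).δ (comp i x q) =
        comp i ((obj I).δ x) q + (-1 : K) ^ a • comp i x ((P.obj J).δ q)
  comp_map : ∀ {I I' J J' : Type} [Finite I] [Finite I'] [Finite J] [Finite J']
    (u : I ≃ I') (v : J ≃ J') (i : I) (x : obj I) (q : P.obj J),
    comp (u i) (map u x) (P.map v q) = map (graftCongr u v i) (comp i x q)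
  comp_one : ∀ {I : Type} [Finite I] (i : I) (x : obj I),
    map (graftUnit i) (comp i x P.one) = x
  comp_assoc : ∀ {I J A : Type} [Finite I] [Finite J] [Finite A] (i : I) (j : J)
    (x : obj I) (q : P.obj J) (s : P.obj A),
    map (graftAssoc i j A) (comp (Sum.inr j : Graft i J) (comp i x q) s) =
      comp i x (P.comp j q s)
  comp_comm : ∀ {I J J' : Type} [Finite I] [Finite J] [Finite J'] {i i' : I} (h : i ≠ i')
    (a b : ℕ) (x : obj I) (q : P.obj J) (q' : P.obj J'),
    q ∈ (P.obj J).gr a → q' ∈ (P.obj J').gr b →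
      map (graftComm h J J') (comp (Sum.inl ⟨i', h.symm⟩ : Graft i J) (comp i x q) q') =
        (-1 : K) ^ (a * b) • comp (Sum.inl ⟨i, h⟩ : Graft i' J') (comp i' x q') q

/-! ## The composition product of `Σ_*`-modules -/

section CompositionProduct

variable {K : Type u} [CommRing K]

/-- The fibre `J_k = f⁻¹(k)` of a map `f : I → {1, …, r}`.  Such maps correspond to the ordered
decompositions `I = J_1 ⊔ ⋯ ⊔ J_r`. -/
abbrev Block {I : Type} {r : ℕ} (f : I → Fin r) (k : Fin r) : Type := {a : I // f a = k}

/-- The block `J_{w(k)}` of `I = J_1 ⊔ ⋯ ⊔ J_r` is the `k`-th block of the permuted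
decomposition `I = J_{w(1)} ⊔ ⋯ ⊔ J_{w(r)}`. -/
def blockPerm {I : Type} {r : ℕ} (f : I → Fin r) (w : Equiv.Perm (Fin r)) (k : Fin r) :
    Block f (w k) ≃ Block (fun a => w.symm (f a)) k :=
  Equiv.subtypeEquivRight fun _ => (Equiv.symm_apply_eq w).symm

/-- The Koszul sign of `y_1 ⊗ ⋯ ⊗ y_r ↦ y_{w(1)} ⊗ ⋯ ⊗ y_{w(r)}`, where `y_k` has degree `d k`. -/
def koszulSign (K : Type u) [CommRing K] {r : ℕ} (w : Equiv.Perm (Fin r)) (d : Fin r → ℕ) : K :=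
  ∏ k : Fin r, ∏ l : Fin r, if k < l ∧ w l < w k then (-1 : K) ^ (d (w k) * d (w l)) else 1

/-- `⨁_r ⨁_{J_1 ⊔ ⋯ ⊔ J_r = I} M(r) ⊗ N(J_1) ⊗ ⋯ ⊗ N(J_r)`. -/
abbrev PreComposite (M N : SigmaModule.{u, v} K) (I : Type) [Finite I] : Type (max u v) :=
  ⨁ s : (Σ r : ℕ, (I → Fin r)), M.obj (Fin s.1) ⊗[K] (⨂[K] k : Fin s.1, N.obj (Block s.2 k))

/-- The tensor `x ⊗ y_1 ⊗ ⋯ ⊗ y_r` in the summand of `I = J_1 ⊔ ⋯ ⊔ J_r`. -/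
def preCompositeMk (M N : SigmaModule.{u, v} K) {I : Type} [Finite I] {r : ℕ} (f : I → Fin r)
    (x : M.obj (Fin r)) (y : ∀ k, N.obj (Block f k)) : PreComposite M N I := by
  classical
  exact DirectSum.lof K (Σ r : ℕ, (I → Fin r))
    (fun s => M.obj (Fin s.1) ⊗[K] (⨂[K] k : Fin s.1, N.obj (Block s.2 k))) ⟨r, f⟩
    (x ⊗ₜ[K] PiTensorProduct.tprod K y)

/-- The relations `w_* x ⊗ (y_1 ⊗ ⋯ ⊗ y_r) ≡ ± x ⊗ (y_{w(1)} ⊗ ⋯ ⊗ y_{w(r)})` of the modules of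
`Σ_r`-coinvariants. -/
def coinvariantRelations (M N : SigmaModule.{u, v} K) (I : Type) [Finite I] :
    Submodule K (PreComposite M N I) :=
  Submodule.span K {t | ∃ (r : ℕ) (f : I → Fin r) (w : Equiv.Perm (Fin r)) (d : Fin r → ℕ)
    (x : M.obj (Fin r)) (y : ∀ k, N.obj (Block f k)),
    (∀ k, y k ∈ (N.obj (Block f k)).gr (d k)) ∧
    t = preCompositeMk M N f (M.map w x) y -
      koszulSign K w d •
        preCompositeMk M N (fun a => w.symm (f a)) x (fun k => N.map (blockPerm f w k) (y (w k)))}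

/-- The composition product
`(M ∘ N)(I) = ⨁_r {⨁_{J_1 ⊔ ⋯ ⊔ J_r = I} M(r) ⊗ N(J_1) ⊗ ⋯ ⊗ N(J_r)}_{Σ_r}` (as a module). -/
abbrev Composite (M N : SigmaModule.{u, v} K) (I : Type) [Finite I] : Type (max u v) :=
  PreComposite M N I ⧸ coinvariantRelations M N I

/-- The composite element `x(y_1, …, y_r)` of `(M ∘ N)(I)`. -/
def compositeMk (M N : SigmaModule.{u, v} K) {I : Type} [Finite I] {r : ℕ} (f : I → Fin r)
    (x : M.obj (Fin r)) (y : ∀ k, N.obj (Block f k)) : Composite M N I :=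
  Submodule.Quotient.mk (preCompositeMk M N f x y)

end CompositionProduct

/-! ## Composite elements in a right module -/

/-- The set obtained from `{1, …, r}` by substituting the blocks of `f : I → {1, …, r}` for the
first `k` elements. -/
abbrev Stage {I : Type} {r : ℕ} (f : I → Fin r) (k : ℕ) : Type :=
  {a : I // (f a : ℕ) < k} ⊕ {j : Fin r // k ≤ (j : ℕ)}

/-- Nothing has been substituted at the beginning. -/
def stageZero {I : Type} {r : ℕ} (f : I → Fin r) : Fin r ≃ Stage f 0 where
  toFun j := Sum.inr ⟨j, Nat.zero_le _⟩
  invFun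
    | Sum.inl a => (Nat.not_lt_zero _ a.2).elim
    | Sum.inr j => j.1
  left_inv _ := rfl
  right_inv := by
    rintro (a | j)
    · exact (Nat.not_lt_zero _ a.2).elim
    · rfl

/-- The next set is obtained by the substitution of the next block. -/
def stageSucc {I : Type} {r : ℕ} (f : I → Fin r) (k : ℕ) (h : k < r) :
    Graft (Sum.inr ⟨⟨k, h⟩, le_rfl⟩ : Stage f k) (Block f ⟨k, h⟩) ≃ Stage f (k + 1) :=
  Equiv.ofBijective
    (fun s => match s with
      | Sum.inl ⟨Sum.inl a, _⟩ => Sum.inl ⟨a.1, Nat.lt_succ_of_lt a.2⟩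
      | Sum.inl ⟨Sum.inr j, hj⟩ => Sum.inr ⟨j.1, Nat.lt_of_le_of_ne j.2 (fun e => hj
          (congrArg Sum.inr (Subtype.ext (Fin.ext e.symm))))⟩
      | Sum.inr a => Sum.inl ⟨a.1, by rw [a.2]; exact Nat.lt_succ_self k⟩)
    (by
      constructor
      · rintro (⟨⟨a, ha⟩ | ⟨j, hj⟩, h1⟩ | ⟨a, ha⟩) (⟨⟨a', ha'⟩ | ⟨j', hj'⟩, h1'⟩ | ⟨a', ha'⟩) e <;>
          simp at e
        · subst e; rfl
        · subst e; rw [ha'] at ha; exact (lt_irrefl _ ha).elim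
        · subst e; rfl
        · subst e; rw [ha] at ha'; exact (lt_irrefl _ ha').elim
        · subst e; rfl
      · rintro (⟨a, ha⟩ | ⟨j, hj⟩)
        · by_cases hk : (f a : ℕ) = k
          · exact ⟨Sum.inr ⟨a, Fin.ext hk⟩, rfl⟩
          · exact ⟨Sum.inl ⟨Sum.inl ⟨a, by omega⟩, by simp⟩, rfl⟩
        · refine ⟨Sum.inl ⟨Sum.inr ⟨j, by omega⟩, ?_⟩, rfl⟩
          intro e
          have e1 : j = ⟨k, h⟩ := congrArg Subtype.val (Sum.inr_injective e)
          subst e1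
          simp at hj)

/-- Everything has been substituted at the end. -/
def stageEnd {I : Type} {r : ℕ} (f : I → Fin r) : Stage f r ≃ I where
  toFun
    | Sum.inl a => a.1
    | Sum.inr j => (Nat.not_le_of_lt j.1.2 j.2).elim
  invFun a := Sum.inl ⟨a, (f a).2⟩
  left_inv := by
    rintro (a | j)
    · rfl
    · exact (Nat.not_le_of_lt j.1.2 j.2).elim
  right_inv _ := rfl

namespace RightModule

variable {K : Type u} [CommRing K] {P : DGOperad.{u, v} K}

/-- The partially composed element `x(q_1, …, q_k, 1, …, 1)`. -/
def partialComposite (L : RightModule P) {I : Type} [Finite I] {r : ℕ} (f : I → Fin r)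
    (x : L.obj (Fin r)) (q : ∀ k, P.obj (Block f k)) : (k : ℕ) → k ≤ r → L.obj (Stage f k)
  | 0, _ => L.map (stageZero f) x
  | k + 1, h => L.map (stageSucc f k h)
      (L.comp (Sum.inr ⟨⟨k, h⟩, le_rfl⟩ : Stage f k)
        (L.partialComposite f x q k (Nat.le_of_succ_le h)) (q ⟨k, h⟩))

/-- The composite element `x(q_1, …, q_r) ∈ L(I)` of `x ∈ L(r)` with
`q_1 ∈ P(J_1), …, q_r ∈ P(J_r)`, where `I = J_1 ⊔ ⋯ ⊔ J_r`:
it is `(⋯((x ∘_1 q_1) ∘_2 q_2)⋯) ∘_r q_r`. -/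
def composite (L : RightModule P) {I : Type} [Finite I] {r : ℕ} (f : I → Fin r)
    (x : L.obj (Fin r)) (q : ∀ k, P.obj (Block f k)) : L.obj I :=
  L.map (stageEnd f) (L.partialComposite f x q r le_rfl)

/-- A morphism of right `P`-modules. -/
structure Hom (L L' : RightModule P) extends
    SigmaModule.Hom L.toSigmaModule L'.toSigmaModule where
  map_comp : ∀ {I J : Type} [Finite I] [Finite J] (i : I) (x : L.obj I) (q : P.obj J),
    app (Graft i J) (L.comp i x q) = L'.comp i (app I x) q

/-- The restriction of structure of a right `P'`-module along a morphism of operads `P → P'`. -/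
def restrict {P' : DGOperad.{u, v} K} (ψ : P.Hom P') (L' : RightModule P') : RightModule P where
  toSigmaModule := L'.toSigmaModule
  comp {_ J} _ _ i := (L'.comp i).compl₂ (ψ.app J).toFun
  comp_mem i a b x q hx hq := L'.comp_mem i a b x _ hx ((ψ.app _).map_gr b q hq)
  δ_comp i a x q hx := by
    simp only [LinearMap.compl₂_apply, (ψ.app _).map_δ]
    exact L'.δ_comp i a x _ hx
  comp_map u v i x q := by
    simp only [LinearMap.compl₂_apply]
    rw [ψ.naturality v q]
    exact L'.comp_map u v i x _
  comp_one i x := by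
    simp only [LinearMap.compl₂_apply]
    rw [ψ.map_one]
    exact L'.comp_one i x
  comp_assoc i j x q s := by
    simp only [LinearMap.compl₂_apply]
    rw [ψ.map_comp j q s]
    exact L'.comp_assoc i j x _ _
  comp_comm h a b x q q' hq hq' := by
    simp only [LinearMap.compl₂_apply]
    exact L'.comp_comm h a b x _ _ ((ψ.app _).map_gr a q hq) ((ψ.app _).map_gr b q' hq')

/-! ## Indecomposable quotients -/

/-- The decomposable elements `x ∘_i q`, where `q` runs over the augmentation ideal of `P`
(which, as `P` is connected, is `P(J)` if `J` has at least two elements and `0` otherwise).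
The elements `x` and `q` are taken homogeneous, which does not change the generated submodule. -/
def decomposables (L : RightModule P) (A : Type) [Finite A] : Set (L.obj A) :=
  {y | ∃ (I J : Type) (_ : Finite I) (_ : Finite J) (_ : Nontrivial J) (i : I)
    (e : Graft i J ≃ A) (a b : ℕ) (x : L.obj I) (q : P.obj J),
    x ∈ (L.obj I).gr a ∧ q ∈ (P.obj J).gr b ∧ y = L.map e (L.comp i x q)}

/-- All composites `x ∘_i q`, homogeneous or not, lie in the span of the decomposables. -/
theorem comp_mem_span_decomposables (L : RightModule P) {A I J : Type} [Finite A] [Finite I]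
    [Finite J] [Nontrivial J] (i : I) (e : Graft i J ≃ A) (x : L.obj I) (q : P.obj J) :
    L.map e (L.comp i x q) ∈ Submodule.span K (L.decomposables A) := by
  refine (L.obj I).homogeneous_induction
    (p := fun x => (L.map e).toFun (L.comp i x q) ∈ Submodule.span K (L.decomposables A)) x
    (fun a x hx => ?_) ?_ ?_
  · refine (P.obj J).homogeneous_induction
      (p := fun q => (L.map e).toFun (L.comp i x q) ∈ Submodule.span K (L.decomposables A)) q
      (fun b q hq => ?_) ?_ ?_
    · exact Submodule.subset_span ⟨I, J, ‹_›, ‹_›, ‹_›, i, e, a, b, x, q, hx, hq, rfl⟩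
    · simp
    · intro y z hy hz
      rw [map_add, map_add]
      exact Submodule.add_mem _ hy hz
  · simp
  · intro y z hy hz
    rw [map_add, LinearMap.add_apply, map_add]
    exact Submodule.add_mem _ hy hz

theorem decomposables_homogeneous (L : RightModule P) (A : Type) [Finite A] :
    ∀ y ∈ L.decomposables A, ∃ d, y ∈ (L.obj A).gr d := by
  rintro _ ⟨I, J, _, _, _, i, e, a, b, x, q, hx, hq, rfl⟩
  exact ⟨a + b, (L.map e).map_gr _ _ (L.comp_mem i a b x q hx hq)⟩

theorem δ_decomposables (L : RightModule P) (A : Type) [Finite A] :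
    ∀ y ∈ L.decomposables A, (L.obj A).δ y ∈ Submodule.span K (L.decomposables A) := by
  rintro _ ⟨I, J, _, _, _, i, e, a, b, x, q, hx, hq, rfl⟩
  rw [← (L.map e).map_δ, L.δ_comp i a x q hx, map_add, map_smul]
  exact Submodule.add_mem _ (L.comp_mem_span_decomposables i e _ _)
    (Submodule.smul_mem _ _ (L.comp_mem_span_decomposables i e _ _))

theorem map_decomposables (L : RightModule P) {A B : Type} [Finite A] [Finite B] (u : A ≃ B) :
    ∀ y ∈ L.decomposables A, L.map u y ∈ Submodule.span K (L.decomposables B) := by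
  rintro _ ⟨I, J, _, _, _, i, e, a, b, x, q, hx, hq, rfl⟩
  rw [← L.map_trans]
  exact L.comp_mem_span_decomposables i _ _ _

/-- The indecomposable quotient `L̄` of a right module `L` over a connected operad, with its natural
differential: the cokernel of the action of the augmentation ideal. -/
def indecomposables (L : RightModule P) : SigmaModule.{u, v} K where
  obj A _ := (L.obj A).quotient (L.decomposables A) (L.decomposables_homogeneous A)
    (L.δ_decomposables A)
  map u := DGModule.quotientMap (L.map u) _ _ _ _ (L.map_decomposables u)
  map_refl x := by
    obtain ⟨x, rfl⟩ := Submodule.Quotient.mk_surjective _ x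
    exact congrArg Submodule.Quotient.mk (L.map_refl x)
  map_trans e e' x := by
    obtain ⟨x, rfl⟩ := Submodule.Quotient.mk_surjective _ x
    exact congrArg Submodule.Quotient.mk (L.map_trans e e' x)

theorem Hom.app_decomposables {P' : DGOperad.{u, v} K} {ψ : P.Hom P'} {L : RightModule P}
    {L' : RightModule P'} (φ : L.Hom (L'.restrict ψ)) (A : Type) [Finite A] :
    ∀ y ∈ L.decomposables A, φ.app A y ∈ Submodule.span K (L'.decomposables A) := by
  rintro _ ⟨I, J, _, _, _, i, e, a, b, x, q, hx, hq, rfl⟩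
  rw [φ.naturality e, φ.map_comp]
  exact L'.comp_mem_span_decomposables i e _ _

/-- The morphism `φ̄ : L̄ → L̄'` induced by a morphism of right `P`-modules `φ : L → L'`, where `L'` is
a right `P'`-module regarded as a right `P`-module by restriction of structure, and where `L̄'` is
the indecomposable quotient of the right `P'`-module `L'`. -/
def Hom.indecomposables {P' : DGOperad.{u, v} K} {ψ : P.Hom P'} {L : RightModule P}
    {L' : RightModule P'} (φ : L.Hom (L'.restrict ψ)) :
    SigmaModule.Hom L.indecomposables L'.indecomposables where
  app A _ := DGModule.quotientMap (W := L'.obj A) (φ.app A)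
    (L.decomposables_homogeneous A) (L.δ_decomposables A)
    (L'.decomposables_homogeneous A) (L'.δ_decomposables A) (φ.app_decomposables A)
  naturality e x := by
    obtain ⟨x, rfl⟩ := Submodule.Quotient.mk_surjective _ x
    exact congrArg Submodule.Quotient.mk (φ.naturality e x)

/-! ## Quasi-free right modules -/

/-- `L = M ∘ P` is a quasi-free right `P`-module on the dg-`Σ_*`-module `M`: there is a morphism
`ι : M → L` of graded `Σ_*`-modules (not of dg-modules in general) such that
`x(q_1, …, q_r) ↦ ι(x)(q_1, …, q_r)` defines an isomorphism from the composition product `M ∘ P`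
onto `L`.  The differential `δ` of `L` (a derivation with respect to the action of `P`) may differ
from the canonical differential of `M ∘ P` by `d_θ`, determined by `d_θ(x) = δ(ι x) - ι(δ x)` on the
generators `x ∈ M`; the composite `M ∘ P → M ∘ P → M` of `d_θ` with the projection is required to
vanish, so that `M` is identified with the indecomposable quotient of `L`. -/
structure IsQuasiFreeOn (L : RightModule P) (M : SigmaModule.{u, v} K)
    (ι : ∀ (I : Type) [Finite I], M.obj I →ₗ[K] L.obj I) : Prop where
  map_gr : ∀ (I : Type) [Finite I] (d : ℕ) (x : M.obj I),
    x ∈ (M.obj I).gr d → ι I x ∈ (L.obj I).gr d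
  naturality : ∀ {I J : Type} [Finite I] [Finite J] (e : I ≃ J) (x : M.obj I),
    ι J (M.map e x) = L.map e (ι I x)
  free : ∀ (I : Type) [Finite I], ∃ E : Composite M P.toSigmaModule I ≃ₗ[K] L.obj I,
    ∀ (r : ℕ) (f : I → Fin r) (x : M.obj (Fin r)) (q : ∀ k, P.obj (Block f k)),
      E (compositeMk M P.toSigmaModule f x q) = L.composite f (ι (Fin r) x) q
  twist : ∀ (I : Type) [Finite I] (x : M.obj I),
    (L.obj I).δ (ι I x) - ι I ((M.obj I).δ x) ∈ Submodule.span K (L.decomposables I)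

/-- `L` is a quasi-free right `P`-module. -/
def IsQuasiFree (L : RightModule P) : Prop :=
  ∃ (M : SigmaModule.{u, v} K) (ι : ∀ (I : Type) [Finite I], M.obj I →ₗ[K] L.obj I),
    L.IsQuasiFreeOn M ι

end RightModule

end OperadComparison

end

/-!
The mapping cone of `φ` is filtered by the number of blocks: writing `L = M ∘ P`, step `s` of the
filtration of `L(A)` is spanned by the composites `x(q_1, …, q_r)` with `r < s`, and the twisting
part of the differential lowers `r` because `P` is connected. Choosing an ordering of the blocks of
each set partition removes the coinvariants, so the `r`-th graded piece of the cone splits into the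
cones of `M(r) ⊗ P(J_1) ⊗ ⋯ ⊗ P(J_r) → M'(r) ⊗ P'(J_1) ⊗ ⋯ ⊗ P'(J_r)`, one for each partition of
`A` into `r` blocks. A quasi-isomorphism of bounded below complexes of projective modules is a
homotopy equivalence, and homotopy equivalences are stable under tensor products; so such a piece
is acyclic as soon as `ψ` is a quasi-isomorphism on the blocks and `φ̄` is one in arity `r`.

For (a), all pieces are acyclic, hence so is the cone. For (b), by induction on `|A|` all pieces
with fewer than `|A|` blocks are acyclic, hence so is the top one, which is the cone of `φ̄(A)`. For
(c), by induction on `|A|` all pieces with at least two blocks are acyclic, hence so is the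
one-block piece, which is the cone of `ψ(A)` because `M(1)` and `M'(1)` are the ground ring.
-/

noncomputable section

namespace OperadComparison

/-! ## Acyclic subquotients and mapping cones -/

section RelAcyclic

variable {R C : Type*} [Ring R] [AddCommGroup C] [Module R C]

/-- The subquotient `N₂ / N₁` of `C`, with the differential induced by `D`, is acyclic. It is
phrased without quotients, and without assuming that `D` preserves `N₁` and `N₂`. -/
def RelAcyclic (D : Module.End R C) (N₁ N₂ : Submodule R C) : Prop :=
  ∀ x ∈ N₂, D x ∈ N₁ → ∃ y ∈ N₂, x - D y ∈ N₁

namespace RelAcyclic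

variable {D : Module.End R C} {N₁ N₂ N₃ : Submodule R C}

theorem refl (D : Module.End R C) (N : Submodule R C) : RelAcyclic D N N :=
  fun x hx _ => ⟨0, N.zero_mem, by simpa using hx⟩

theorem trans (hD : ∀ x, D (D x) = 0) (h₁₂ : N₁ ≤ N₂) (h₂₃ : N₂ ≤ N₃)
    (lower : RelAcyclic D N₁ N₂) (upper : RelAcyclic D N₂ N₃) : RelAcyclic D N₁ N₃ := by
  intro x hx hDx
  obtain ⟨y, hy, hxy⟩ := upper x hx (h₁₂ hDx)
  obtain ⟨z, hz, hxyz⟩ := lower _ hxy (by simpa [hD] using hDx)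
  exact ⟨y + z, N₃.add_mem hy (h₂₃ hz), by rwa [map_add, ← sub_sub]⟩

theorem upper (hD : ∀ x, D (D x) = 0) (h₁₂ : N₁ ≤ N₂) (h₂₃ : N₂ ≤ N₃)
    (lower : RelAcyclic D N₁ N₂) (total : RelAcyclic D N₁ N₃) : RelAcyclic D N₂ N₃ := by
  intro x hx hDx
  obtain ⟨y, hy, hxy⟩ := lower (D x) hDx (by simp [hD])
  obtain ⟨z, hz, hxyz⟩ := total (x - y) (N₃.sub_mem hx (h₂₃ hy)) (by simpa using hxy)
  refine ⟨z, hz, ?_⟩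
  rw [show x - D z = x - y - D z + y by abel]
  exact N₂.add_mem (h₁₂ hxyz) hy

theorem lower (hD : ∀ x, D (D x) = 0) (h₁₂ : N₁ ≤ N₂) (h₂₃ : N₂ ≤ N₃)
    (upper : RelAcyclic D N₂ N₃) (total : RelAcyclic D N₁ N₃) : RelAcyclic D N₁ N₂ := by
  intro x hx hDx
  obtain ⟨y, hy, hxy⟩ := total x (h₂₃ hx) hDx
  have hDy : D y ∈ N₂ := by simpa using N₂.sub_mem hx (h₁₂ hxy)
  obtain ⟨z, -, hyz⟩ := upper y hy hDy
  exact ⟨y - D z, hyz, by simpa [hD] using hxy⟩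

theorem of_steps (hD : ∀ x, D (D x) = 0) {F : ℕ → Submodule R C} (hF : Monotone F) {m n : ℕ}
    (hmn : m ≤ n) (h : ∀ s, m ≤ s → s < n → RelAcyclic D (F s) (F (s + 1))) :
    RelAcyclic D (F m) (F n) := by
  induction n, hmn using Nat.le_induction with
  | base => exact refl D _
  | succ n hmn ih =>
    exact trans hD (hF hmn) (hF n.le_succ) (ih fun s hs hsn => h s hs (hsn.trans n.lt_succ_self))
      (h n hmn n.lt_succ_self)

theorem of_injective {C' : Type*} [AddCommGroup C'] [Module R C'] {D' : Module.End R C'}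
    {N : Submodule R C'} {j : C →ₗ[R] C'} (hj : Function.Injective j)
    (hD : ∀ x, j (D x) = D' (j x)) (hN : N = LinearMap.range j) (h : RelAcyclic D' ⊥ N) :
    RelAcyclic D ⊥ ⊤ := by
  subst hN
  intro x _ hDx
  obtain ⟨_, ⟨y, rfl⟩, hy⟩ := h (j x) ⟨x, rfl⟩ (by
    rw [← hD, (Submodule.mem_bot R).1 hDx, map_zero]; exact Submodule.zero_mem _)
  refine ⟨y, trivial, (Submodule.mem_bot R).2 (hj ?_)⟩
  rw [map_sub, hD, map_zero]
  exact (Submodule.mem_bot R).1 hy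

end RelAcyclic

variable {V W : Type*} [AddCommGroup V] [Module R V] [AddCommGroup W] [Module R W]

/-- The differential of the mapping cone `W ⊕ V[1]` of `f : V → W`. -/
def coneDiff (δ : Module.End R V) (δ' : Module.End R W) (f : V →ₗ[R] W) : Module.End R (W × V) :=
  (δ'.coprod f).prod (-(δ ∘ₗ LinearMap.snd R W V))

variable {δ : Module.End R V} {δ' : Module.End R W} {f : V →ₗ[R] W}

@[simp]
theorem coneDiff_apply (x : W × V) : coneDiff δ δ' f x = (δ' x.1 + f x.2, -δ x.2) := rfl

theorem coneDiff_coneDiff (hδ : ∀ x, δ (δ x) = 0) (hδ' : ∀ x, δ' (δ' x) = 0)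
    (hf : ∀ x, f (δ x) = δ' (f x)) (x : W × V) :
    coneDiff δ δ' f (coneDiff δ δ' f x) = 0 := by
  simp [hδ, hδ', hf]

/-- The mapping cone of `f` is acyclic. -/
def ConeAcyclic (δ : Module.End R V) (δ' : Module.End R W) (f : V →ₗ[R] W) : Prop :=
  RelAcyclic (coneDiff δ δ' f) ⊥ ⊤

theorem coneAcyclic_iff :
    ConeAcyclic δ δ' f ↔ ∀ x, coneDiff δ δ' f x = 0 → ∃ y, coneDiff δ δ' f y = x := by
  simp only [ConeAcyclic, RelAcyclic, Submodule.mem_top, Submodule.mem_bot, true_and,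
    forall_const, sub_eq_zero, @eq_comm _ _ (coneDiff δ δ' f _)]

theorem coneAcyclic_iff_injective_and_surjective (hf : ∀ x, f (δ x) = δ' (f x)) :
    ConeAcyclic δ δ' f ↔
      (∀ v, δ v = 0 → (∃ w, δ' w = f v) → ∃ u, δ u = v) ∧
      (∀ w, δ' w = 0 → ∃ v, δ v = 0 ∧ ∃ y, δ' y = f v - w) := by
  simp only [coneAcyclic_iff, coneDiff_apply, Prod.forall, Prod.exists, Prod.mk.injEq,
    Prod.mk_eq_zero, neg_eq_zero, and_imp]
  constructor
  · refine fun h => ⟨?_, fun w hw => ?_⟩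
    · rintro v hv ⟨w, hw⟩
      obtain ⟨_, z, -, hz⟩ := h (-w) v (by simp [hw]) hv
      exact ⟨-z, by simpa using hz⟩
    · obtain ⟨y, z, hyz, hz⟩ := h w 0 (by simp [hw]) (map_zero δ)
      exact ⟨z, by simpa using hz, -y, by rw [map_neg, ← hyz]; abel⟩
  · rintro ⟨hinj, hsurj⟩ w v hwv hv
    obtain ⟨z, hz⟩ := hinj v hv ⟨-w, by rw [map_neg]; exact (eq_neg_of_add_eq_zero_right hwv).symm⟩
    obtain ⟨u, hu, y, hy⟩ := hsurj (w + f z) (by rw [map_add, ← hf, hz, hwv])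
    refine ⟨-y, u - z, ?_, by simp [hu, hz]⟩
    rw [map_neg, hy, map_sub]
    abel

end RelAcyclic

/-! ## Homotopy equivalences compatible with a parity -/

section OddEnd

variable {K : Type*} [CommRing K] {V W X : Type*} [AddCommGroup V] [Module K V]
  [AddCommGroup W] [Module K W] [AddCommGroup X] [Module K X]

/-- An odd endomorphism `δ` of a module whose `ℤ/2`-grading is recorded by its grading involution
`τ`. The Koszul signs of the differential of a tensor product become applications of `τ`. -/
structure OddEnd (K V : Type*) [CommRing K] [AddCommGroup V] [Module K V] where
  δ : Module.End K V
  τ : Module.End K V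
  τ_mul_τ : τ * τ = 1
  δ_mul_τ : δ * τ = -(τ * δ)

namespace OddEnd

/-- A linear map commuting with the odd endomorphisms and with the grading involutions. -/
structure IsHom (A : OddEnd K V) (B : OddEnd K W) (f : V →ₗ[K] W) : Prop where
  comp_δ : f ∘ₗ A.δ = B.δ ∘ₗ f
  comp_τ : f ∘ₗ A.τ = B.τ ∘ₗ f

/-- The endomorphism `p` is homotopic to the identity, by an odd homotopy. -/
def HomotopicToOne (A : OddEnd K V) (p : Module.End K V) : Prop :=
  ∃ h : Module.End K V, h * A.τ = -(A.τ * h) ∧ A.δ * h + h * A.δ = 1 - p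

/-- `f` has an inverse up to odd homotopies. -/
structure IsHomotopyEquiv (A : OddEnd K V) (B : OddEnd K W) (f : V →ₗ[K] W) : Prop
    extends A.IsHom B f where
  exists_inverse : ∃ g : W →ₗ[K] V, B.IsHom A g ∧
    A.HomotopicToOne (g ∘ₗ f) ∧ B.HomotopicToOne (f ∘ₗ g)

variable {A : OddEnd K V} {B : OddEnd K W} {C : OddEnd K X} {f : V →ₗ[K] W}

theorem IsHom.comp {g : W →ₗ[K] X} (hg : B.IsHom C g) (hf : A.IsHom B f) :
    A.IsHom C (g ∘ₗ f) where
  comp_δ := by rw [LinearMap.comp_assoc, hf.comp_δ, ← LinearMap.comp_assoc, hg.comp_δ]; rfl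
  comp_τ := by rw [LinearMap.comp_assoc, hf.comp_τ, ← LinearMap.comp_assoc, hg.comp_τ]; rfl

theorem IsHom.symm {e : V ≃ₗ[K] W} (he : A.IsHom B e) : B.IsHom A e.symm where
  comp_δ := by
    rw [LinearEquiv.toLinearMap_symm_comp_eq, ← LinearMap.comp_assoc, he.comp_δ,
      LinearMap.comp_assoc, LinearEquiv.comp_symm, LinearMap.comp_id]
  comp_τ := by
    rw [LinearEquiv.toLinearMap_symm_comp_eq, ← LinearMap.comp_assoc, he.comp_τ,
      LinearMap.comp_assoc, LinearEquiv.comp_symm, LinearMap.comp_id]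

theorem homotopicToOne_id (A : OddEnd K V) : A.HomotopicToOne LinearMap.id :=
  ⟨0, by simp, by rw [mul_zero, zero_mul, add_zero]; exact (sub_self _).symm⟩

theorem HomotopicToOne.comp {g : W →ₗ[K] V} {p : Module.End K W} (hp : B.HomotopicToOne p)
    (hf : A.IsHom B f) (hg : B.IsHom A g) (hgf : A.HomotopicToOne (g ∘ₗ f)) :
    A.HomotopicToOne (g ∘ₗ p ∘ₗ f) := by
  obtain ⟨h, hτ, hδ⟩ := hgf
  obtain ⟨k, kτ, kδ⟩ := hp
  simp only [LinearMap.ext_iff, Module.End.mul_apply, LinearMap.add_apply, LinearMap.sub_apply,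
    LinearMap.neg_apply, Module.End.one_apply, LinearMap.comp_apply] at hτ hδ kτ kδ
  have fδ := LinearMap.congr_fun hf.comp_δ
  have fτ := LinearMap.congr_fun hf.comp_τ
  have gδ := LinearMap.congr_fun hg.comp_δ
  have gτ := LinearMap.congr_fun hg.comp_τ
  simp only [LinearMap.comp_apply] at fδ fτ gδ gτ
  refine ⟨h + g ∘ₗ k ∘ₗ f, LinearMap.ext fun x => ?_, LinearMap.ext fun x => ?_⟩
  · simp [hτ, fτ, kτ, gτ, add_comm]
  · have hgk : g (B.δ (k (f x))) + g (k (B.δ (f x))) = g (f x) - g (p (f x)) := by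
      rw [← map_add, kδ, map_sub]
    simp only [Module.End.mul_apply, LinearMap.add_apply, LinearMap.sub_apply,
      Module.End.one_apply, LinearMap.comp_apply, map_add, fδ, ← gδ]
    rw [add_add_add_comm, hδ, hgk]
    abel

theorem IsHomotopyEquiv.comp {g : W →ₗ[K] X} (hg : B.IsHomotopyEquiv C g)
    (hf : A.IsHomotopyEquiv B f) : A.IsHomotopyEquiv C (g ∘ₗ f) := by
  obtain ⟨f', hf', hf'f, hff'⟩ := hf.exists_inverse
  obtain ⟨g', hg', hg'g, hgg'⟩ := hg.exists_inverse
  exact ⟨hg.toIsHom.comp hf.toIsHom, f' ∘ₗ g', hf'.comp hg',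
    hg'g.comp hf.toIsHom hf' hf'f, hff'.comp hg' hg.toIsHom hgg'⟩

theorem IsHom.isHomotopyEquiv {e : V ≃ₗ[K] W} (he : A.IsHom B e) : A.IsHomotopyEquiv B e where
  toIsHom := he
  exists_inverse := ⟨e.symm, he.symm, by simpa using A.homotopicToOne_id,
    by simpa using B.homotopicToOne_id⟩

theorem IsHomotopyEquiv.coneAcyclic (hf : A.IsHomotopyEquiv B f) : ConeAcyclic A.δ B.δ f := by
  obtain ⟨g, hg, ⟨a, -, ha⟩, b, -, hb⟩ := hf.exists_inverse
  have gδ := LinearMap.congr_fun hg.comp_δ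
  simp only [LinearMap.ext_iff, Module.End.mul_apply, LinearMap.add_apply, LinearMap.sub_apply,
    Module.End.one_apply, LinearMap.comp_apply] at ha hb gδ
  refine (coneAcyclic_iff_injective_and_surjective (LinearMap.congr_fun hf.comp_δ)).2 ⟨?_, ?_⟩
  · rintro v hv ⟨w, hw⟩
    have hav : A.δ (a v) = v - g (f v) := by rw [← ha, hv, map_zero, add_zero]
    exact ⟨a v + g w, by rw [map_add, hav, ← gδ, hw, sub_add_cancel]⟩
  · intro w hw
    have hbw : B.δ (b w) = w - f (g w) := by rw [← hb, hw, map_zero, add_zero]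
    exact ⟨g w, by rw [← gδ, hw, map_zero], -b w, by rw [map_neg, hbw, neg_sub]⟩

/-- The mapping cone `W ⊕ V[1]`; the parity of the summand `V` is reversed. -/
def cone (hf : A.IsHom B f) : OddEnd K (W × V) where
  δ := coneDiff A.δ B.δ f
  τ := LinearMap.prodMap B.τ (-A.τ)
  τ_mul_τ := by
    have hA := LinearMap.congr_fun A.τ_mul_τ
    have hB := LinearMap.congr_fun B.τ_mul_τ
    simp only [Module.End.mul_apply, Module.End.one_apply] at hA hB
    exact LinearMap.ext fun x => by simp [hA, hB]
  δ_mul_τ := by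
    have hA := LinearMap.congr_fun A.δ_mul_τ
    have hB := LinearMap.congr_fun B.δ_mul_τ
    have fτ := LinearMap.congr_fun hf.comp_τ
    simp only [Module.End.mul_apply, LinearMap.neg_apply, LinearMap.comp_apply] at hA hB fτ
    refine LinearMap.ext fun x => Prod.ext ?_ ?_
    · simp [hB, fτ]; abel
    · simp [hA]

theorem isHomotopyEquiv_of_cone (hf : A.IsHom B f) (h : (cone hf).HomotopicToOne 0) :
    A.IsHomotopyEquiv B f := by
  obtain ⟨s, hsτ, hsδ⟩ := h
  have s_add : ∀ w v, s (w, v) = s (w, 0) + s (0, v) := fun w v => by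
    simp [← map_add]
  have s_neg : ∀ v, s (0, -v) = -s (0, v) := fun v => by
    rw [← map_neg, Prod.neg_mk, neg_zero]
  have oddW := fun w => LinearMap.congr_fun hsτ (w, 0)
  have oddV := fun v => LinearMap.congr_fun hsτ (0, v)
  have homotopyW := fun w => LinearMap.congr_fun hsδ (w, 0)
  have homotopyV := fun v => LinearMap.congr_fun hsδ (0, v)
  simp only [cone, Module.End.mul_apply, LinearMap.neg_apply, LinearMap.add_apply,
    LinearMap.prodMap_apply, coneDiff_apply, map_zero, neg_zero, add_zero, zero_add, s_neg,
    sub_zero, Module.End.one_apply, Prod.ext_iff, Prod.fst_add, Prod.snd_add, Prod.fst_neg,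
    Prod.snd_neg, neg_neg, neg_inj] at oddW oddV homotopyW homotopyV
  have hg : B.IsHom A (LinearMap.snd K W V ∘ₗ s ∘ₗ LinearMap.inl K W V) :=
    ⟨LinearMap.ext fun w => (neg_add_eq_zero.1 (homotopyW w).2).symm,
      LinearMap.ext fun w => (oddW w).2⟩
  refine ⟨hf, _, hg, ⟨-(LinearMap.snd K W V ∘ₗ s ∘ₗ LinearMap.inr K W V), ?_, ?_⟩,
    ⟨LinearMap.fst K W V ∘ₗ s ∘ₗ LinearMap.inl K W V, ?_, ?_⟩⟩
  · exact LinearMap.ext fun v => by simpa using neg_eq_iff_eq_neg.2 (oddV v).2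
  · refine LinearMap.ext fun v => eq_sub_iff_add_eq.2 ?_
    have := (homotopyV v).2
    rw [s_add (f v), s_neg] at this
    simp only [Prod.snd_add, Prod.snd_neg] at this
    refine Eq.trans ?_ this
    simp only [Module.End.mul_apply, LinearMap.neg_apply, LinearMap.comp_apply, LinearMap.add_apply,
      LinearMap.inr_apply, LinearMap.inl_apply, LinearMap.snd_apply, map_neg]
    abel
  · exact LinearMap.ext fun w => (oddW w).1
  · refine LinearMap.ext fun w => eq_sub_iff_add_eq.2 ?_
    refine Eq.trans ?_ (homotopyW w).1
    simp only [Module.End.mul_apply, LinearMap.comp_apply, LinearMap.add_apply,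
      LinearMap.inl_apply, LinearMap.fst_apply, LinearMap.snd_apply]
    abel

end OddEnd

end OddEnd

/-! ## Tensor products -/

section Tensor

variable {K : Type*} [CommRing K] {V W X Y : Type*} [AddCommGroup V] [Module K V]
  [AddCommGroup W] [Module K W] [AddCommGroup X] [Module K X] [AddCommGroup Y] [Module K Y]

theorem tensorMap_neg_left (f : V →ₗ[K] X) (g : W →ₗ[K] Y) :
    TensorProduct.map (-f) g = -TensorProduct.map f g :=
  LinearMap.map_neg₂ (TensorProduct.mapBilinear (RingHom.id K) V W X Y) f g

theorem tensorMap_neg_right (f : V →ₗ[K] X) (g : W →ₗ[K] Y) :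
    TensorProduct.map f (-g) = -TensorProduct.map f g :=
  map_neg (TensorProduct.mapBilinear (RingHom.id K) V W X Y f) g

theorem tensorMap_sub_left (f f' : V →ₗ[K] X) (g : W →ₗ[K] Y) :
    TensorProduct.map (f - f') g = TensorProduct.map f g - TensorProduct.map f' g :=
  LinearMap.map_sub₂ (TensorProduct.mapBilinear (RingHom.id K) V W X Y) f f' g

theorem tensorMap_sub_right (f : V →ₗ[K] X) (g g' : W →ₗ[K] Y) :
    TensorProduct.map f (g - g') = TensorProduct.map f g - TensorProduct.map f g' :=
  map_sub (TensorProduct.mapBilinear (RingHom.id K) V W X Y f) g g'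

namespace OddEnd

/-- The tensor product, with the odd endomorphism `x ⊗ y ↦ δ x ⊗ y ± x ⊗ δ y`. -/
def tensor (A : OddEnd K V) (B : OddEnd K W) : OddEnd K (V ⊗[K] W) where
  δ := TensorProduct.map A.δ 1 + TensorProduct.map A.τ B.δ
  τ := TensorProduct.map A.τ B.τ
  τ_mul_τ := by rw [← TensorProduct.map_mul, A.τ_mul_τ, B.τ_mul_τ, TensorProduct.map_one]
  δ_mul_τ := by
    rw [add_mul, mul_add, ← TensorProduct.map_mul, ← TensorProduct.map_mul, ← TensorProduct.map_mul,
      ← TensorProduct.map_mul, A.δ_mul_τ, B.δ_mul_τ, tensorMap_neg_left, tensorMap_neg_right,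
      one_mul, mul_one, neg_add]

variable {A : OddEnd K V} {B : OddEnd K W} {C : OddEnd K X} {D : OddEnd K Y}
  {f : V →ₗ[K] X} {g : W →ₗ[K] Y}

theorem IsHom.tensor (hf : A.IsHom C f) (hg : B.IsHom D g) :
    (A.tensor B).IsHom (C.tensor D) (TensorProduct.map f g) where
  comp_δ := by
    simp only [OddEnd.tensor, LinearMap.comp_add, LinearMap.add_comp, ← TensorProduct.map_comp,
      hf.comp_δ, hf.comp_τ, hg.comp_δ, Module.End.one_eq_id, LinearMap.id_comp, LinearMap.comp_id]
  comp_τ := by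
    simp only [OddEnd.tensor, ← TensorProduct.map_comp, hf.comp_τ, hg.comp_τ]

theorem HomotopicToOne.tensor {p : Module.End K V} {q : Module.End K W} (hq : B.IsHom B q)
    (hA : A.HomotopicToOne p) (hB : B.HomotopicToOne q) :
    (A.tensor B).HomotopicToOne (TensorProduct.map p q) := by
  obtain ⟨h, hτ, hδ⟩ := hA
  obtain ⟨k, kτ, kδ⟩ := hB
  have qδ : q * B.δ = B.δ * q := hq.comp_δ
  have qτ : q * B.τ = B.τ * q := hq.comp_τ
  refine ⟨TensorProduct.map h q + TensorProduct.map A.τ k, ?_, ?_⟩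
  · simp only [OddEnd.tensor, add_mul, mul_add, ← TensorProduct.map_mul, hτ, kτ, qτ,
      tensorMap_neg_left, tensorMap_neg_right, neg_add]
  · have hleft : TensorProduct.map (A.δ * h) q + TensorProduct.map (h * A.δ) q =
        TensorProduct.map 1 q - TensorProduct.map p q := by
      rw [← TensorProduct.map_add_left, hδ, tensorMap_sub_left]
    have hright : TensorProduct.map (1 : Module.End K V) (B.δ * k) +
        TensorProduct.map 1 (k * B.δ) = 1 - TensorProduct.map 1 q := by
      rw [← TensorProduct.map_add_right, kδ, tensorMap_sub_right, TensorProduct.map_one]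
    rw [← sub_add_sub_cancel 1 (TensorProduct.map 1 q), ← hleft, ← hright]
    simp only [OddEnd.tensor, add_mul, mul_add, ← TensorProduct.map_mul, one_mul, mul_one,
      A.τ_mul_τ, A.δ_mul_τ, hτ, qδ, tensorMap_neg_left]
    abel

theorem IsHomotopyEquiv.tensor (hf : A.IsHomotopyEquiv C f) (hg : B.IsHomotopyEquiv D g) :
    (A.tensor B).IsHomotopyEquiv (C.tensor D) (TensorProduct.map f g) := by
  obtain ⟨f', hf', hf'f, hff'⟩ := hf.exists_inverse
  obtain ⟨g', hg', hg'g, hgg'⟩ := hg.exists_inverse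
  refine ⟨hf.toIsHom.tensor hg.toIsHom, TensorProduct.map f' g', hf'.tensor hg', ?_, ?_⟩
  · rw [← TensorProduct.map_comp]
    exact hf'f.tensor (hg'.comp hg.toIsHom) hg'g
  · rw [← TensorProduct.map_comp]
    exact hff'.tensor (hg.toIsHom.comp hg') hgg'

end OddEnd

end Tensor

section PiTensor

variable {ι : Type*} [LinearOrder ι]

/-- The family with value `a i` for `i < k`, `b k` at `k` and `c i` for `i > k`: the shape of the
summands of a differential on an iterated tensor product. -/
def slot {α : ι → Sort*} (k : ι) (a b c : ∀ i, α i) : ∀ i, α i :=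
  fun i => if i < k then a i else if i = k then b i else c i

variable {K : Type*} [CommRing K] {V W : ι → Type*} [∀ i, AddCommGroup (V i)]
  [∀ i, Module K (V i)] [∀ i, AddCommGroup (W i)] [∀ i, Module K (W i)]

theorem piMap_slot_mul (k : ι) (a b c a' b' c' : ∀ i, Module.End K (V i)) :
    PiTensorProduct.map (slot k a b c) * PiTensorProduct.map (slot k a' b' c') =
      PiTensorProduct.map (slot k (a * a') (b * b') (c * c')) := by
  rw [← PiTensorProduct.map_mul]
  congr 1
  funext i
  simp only [slot, Pi.mul_apply]
  split_ifs <;> rfl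

theorem piMap_slot_add (k : ι) (a b b' c : ∀ i, Module.End K (V i)) :
    PiTensorProduct.map (slot k a (b + b') c) =
      PiTensorProduct.map (slot k a b c) + PiTensorProduct.map (slot k a b' c) := by
  have update_slot : ∀ b, Function.update (slot k a 0 c) k (b k) = slot k a b c := fun b => by
    funext i
    by_cases hi : i = k
    · subst hi; simp [slot]
    · simp [slot, hi]
  rw [← update_slot b, ← update_slot b', ← update_slot (b + b')]
  exact (PiTensorProduct.mapMultilinear K V V).map_update_add (slot k a 0 c) k (b k) (b' k)

theorem piMap_eq_neg (k : ι) {f g : ∀ i, V i →ₗ[K] W i} (h : ∀ i, i ≠ k → f i = g i)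
    (hk : f k = -g k) : PiTensorProduct.map f = -PiTensorProduct.map g := by
  have hf : f = Function.update g k (-g k) := by
    funext i
    by_cases hi : i = k
    · subst hi; simp [hk]
    · simp [hi, h i hi]
  have := (PiTensorProduct.mapMultilinear K V W).map_update_neg g k (g k)
  rw [Function.update_eq_self] at this
  rw [hf]
  exact this

theorem piMap_mul_piMap_eq_neg (k : ι) {f g : ∀ i, Module.End K (V i)}
    (h : ∀ i, i ≠ k → f i * g i = g i * f i) (hk : f k * g k = -(g k * f k)) :
    PiTensorProduct.map f * PiTensorProduct.map g =
      -(PiTensorProduct.map g * PiTensorProduct.map f) := by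
  rw [← PiTensorProduct.map_mul, ← PiTensorProduct.map_mul]
  exact piMap_eq_neg k h hk

theorem piMap_slot_homotopy_mul_eq_neg {A : ∀ i, OddEnd K (V i)}
    {p h : ∀ i, Module.End K (V i)}
    (hp : ∀ i, (A i).IsHom (A i) (p i))
    (hh : ∀ i, h i * (A i).τ = -((A i).τ * h i)) {k l : ι} (hkl : k ≠ l) :
    PiTensorProduct.map (slot k (fun i => (A i).τ) h p) *
        PiTensorProduct.map (slot l (fun i => (A i).τ) (fun i => (A i).δ) 1) =
      -(PiTensorProduct.map (slot l (fun i => (A i).τ) (fun i => (A i).δ) 1) *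
        PiTensorProduct.map (slot k (fun i => (A i).τ) h p)) := by
  have pτ : ∀ i, p i * (A i).τ = (A i).τ * p i := fun i => (hp i).comp_τ
  have pδ : ∀ i, p i * (A i).δ = (A i).δ * p i := fun i => (hp i).comp_δ
  rcases lt_or_gt_of_ne hkl with hkl | hkl
  · refine piMap_mul_piMap_eq_neg k (fun i hi => ?_) (by simp [slot, hkl, hh])
    simp only [slot, if_neg hi, Pi.one_apply]
    split_ifs <;> first | simp [pτ, pδ] | (exfalso; order)
  · refine piMap_mul_piMap_eq_neg l (fun i hi => ?_) (by simp [slot, hkl, (A l).δ_mul_τ])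
    simp only [slot, if_neg hi, Pi.one_apply]
    split_ifs <;> first | simp | (exfalso; order)

namespace OddEnd

/-- The family `τ y_i` for `i < k`, `δ y_k`, `y_i` for `i > k`: the `k`-th term of the Leibniz
rule. -/
def leibnizTerm (A : ∀ i, OddEnd K (V i)) (y : ∀ i, V i) (k : ι) : ∀ i, V i :=
  slot k (fun i => (A i).τ (y i)) (fun i => (A i).δ (y i)) y

theorem leibnizTerm_of_lt (A : ∀ i, OddEnd K (V i)) (y : ∀ i, V i) {i k : ι} (h : i < k) :
    leibnizTerm A y k i = (A i).τ (y i) :=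
  if_pos h

theorem leibnizTerm_self (A : ∀ i, OddEnd K (V i)) (y : ∀ i, V i) (k : ι) :
    leibnizTerm A y k k = (A k).δ (y k) := by
  simp [leibnizTerm, slot]

theorem leibnizTerm_of_gt (A : ∀ i, OddEnd K (V i)) (y : ∀ i, V i) {i k : ι} (h : k < i) :
    leibnizTerm A y k i = y i := by
  simp [leibnizTerm, slot, h.not_gt, h.ne']

end OddEnd

variable [Fintype ι]

theorem sum_piMap_slot_one_sub (p : ∀ i, Module.End K (V i)) :
    ∑ k, PiTensorProduct.map (slot k 1 (1 - p) p) = 1 - PiTensorProduct.map p := by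
  have := (PiTensorProduct.mapMultilinear K V V).map_piecewise_sub_map_piecewise 1 p 0 Finset.univ
  simp only [Finset.piecewise_univ, Finset.mem_univ, if_true] at this
  exact this.symm.trans (congrArg (· - PiTensorProduct.map p) PiTensorProduct.map_one)

namespace OddEnd

/-- The tensor product of a family, with the odd endomorphism
`⨂ y_i ↦ ∑ k, ± y_1 ⊗ ⋯ ⊗ δ y_k ⊗ ⋯ ⊗ y_r`. -/
def piTensor (A : ∀ i, OddEnd K (V i)) : OddEnd K (⨂[K] i, V i) where
  δ := ∑ k, PiTensorProduct.map (slot k (fun i => (A i).τ) (fun i => (A i).δ) 1)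
  τ := PiTensorProduct.map fun i => (A i).τ
  τ_mul_τ := by
    rw [← PiTensorProduct.map_mul]
    simp only [(A _).τ_mul_τ]
    exact PiTensorProduct.map_one
  δ_mul_τ := by
    rw [Finset.sum_mul, Finset.mul_sum, ← Finset.sum_neg_distrib]
    refine Finset.sum_congr rfl fun k _ => piMap_mul_piMap_eq_neg k (fun i hi => ?_) ?_
    · simp only [slot, if_neg hi]
      split_ifs
      · rfl
      · exact (Commute.one_left _).eq
    · simpa [slot] using (A k).δ_mul_τ

theorem piTensor_δ_tprod (A : ∀ i, OddEnd K (V i)) (y : ∀ i, V i) :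
    (OddEnd.piTensor A).δ (PiTensorProduct.tprod K y) =
      ∑ k, PiTensorProduct.tprod K (leibnizTerm A y k) := by
  rw [OddEnd.piTensor, LinearMap.sum_apply]
  refine Finset.sum_congr rfl fun k _ => ?_
  rw [PiTensorProduct.map_tprod]
  refine congrArg _ (funext fun i => ?_)
  simp only [leibnizTerm, slot]
  split_ifs <;> rfl

variable {A : ∀ i, OddEnd K (V i)} {B : ∀ i, OddEnd K (W i)} {f : ∀ i, V i →ₗ[K] W i}

theorem IsHom.piTensor (hf : ∀ i, (A i).IsHom (B i) (f i)) :
    (OddEnd.piTensor A).IsHom (OddEnd.piTensor B) (PiTensorProduct.map f) where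
  comp_δ := by
    refine LinearMap.ext fun x => ?_
    simp only [OddEnd.piTensor, LinearMap.comp_apply, LinearMap.sum_apply, map_sum]
    refine Finset.sum_congr rfl fun k _ => ?_
    rw [← LinearMap.comp_apply, ← LinearMap.comp_apply, ← PiTensorProduct.map_comp,
      ← PiTensorProduct.map_comp]
    refine LinearMap.congr_fun (congrArg _ (funext fun i => ?_)) x
    simp only [slot]
    split_ifs
    · exact (hf i).comp_τ
    · exact (hf i).comp_δ
    · rfl
  comp_τ := by
    simp only [OddEnd.piTensor, ← PiTensorProduct.map_comp, (hf _).comp_τ]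

theorem HomotopicToOne.piTensor {p : ∀ i, Module.End K (V i)}
    (hp : ∀ i, (A i).IsHom (A i) (p i)) (hA : ∀ i, (A i).HomotopicToOne (p i)) :
    (OddEnd.piTensor A).HomotopicToOne (PiTensorProduct.map p) := by
  choose h hτ hδ using hA
  have τ_mul_τ : (fun i => (A i).τ) * (fun i => (A i).τ) = 1 := funext fun i => (A i).τ_mul_τ
  refine ⟨∑ k, PiTensorProduct.map (slot k (fun i => (A i).τ) h p), ?_, ?_⟩
  · rw [Finset.sum_mul, OddEnd.piTensor, Finset.mul_sum, ← Finset.sum_neg_distrib]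
    refine Finset.sum_congr rfl fun k _ => piMap_mul_piMap_eq_neg k (fun i hi => ?_) ?_
    · simp only [slot, if_neg hi]
      split_ifs
      · rfl
      · exact (hp i).comp_τ
    · simpa [slot] using hτ k
  · rw [OddEnd.piTensor, Finset.sum_mul_sum, Finset.sum_mul_sum, Finset.sum_comm,
      ← Finset.sum_add_distrib, ← sum_piMap_slot_one_sub]
    refine Finset.sum_congr rfl fun k _ => ?_
    rw [← Finset.sum_add_distrib, Finset.sum_eq_single k]
    · have hδ' : 1 - p = (fun i => (A i).δ) * h + h * fun i => (A i).δ :=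
        funext fun i => (hδ i).symm
      rw [piMap_slot_mul, piMap_slot_mul, hδ', piMap_slot_add, τ_mul_τ, one_mul, mul_one, add_comm]
    · intro l _ hl
      rw [piMap_slot_homotopy_mul_eq_neg hp hτ hl.symm, add_neg_cancel]
    · simp

theorem IsHomotopyEquiv.piTensor (hf : ∀ i, (A i).IsHomotopyEquiv (B i) (f i)) :
    (OddEnd.piTensor A).IsHomotopyEquiv (OddEnd.piTensor B) (PiTensorProduct.map f) := by
  choose g hg hgf hfg using fun i => (hf i).exists_inverse
  have hf' := fun i => (hf i).toIsHom
  refine ⟨IsHom.piTensor hf', PiTensorProduct.map g, IsHom.piTensor hg, ?_, ?_⟩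
  · rw [← PiTensorProduct.map_comp]
    exact HomotopicToOne.piTensor (fun i => (hg i).comp (hf' i)) hgf
  · rw [← PiTensorProduct.map_comp]
    exact HomotopicToOne.piTensor (fun i => (hf' i).comp (hg i)) hfg

end OddEnd

end PiTensor

/-! ## Contractions and quasi-isomorphisms of dg-modules -/

theorem exists_comp_eq_of_range_le {R P X Y : Type*} [Ring R] [AddCommGroup P] [Module R P]
    [Module.Projective R P] [AddCommGroup X] [Module R X] [AddCommGroup Y] [Module R Y]
    (f : P →ₗ[R] Y) (g : X →ₗ[R] Y) (h : LinearMap.range f ≤ LinearMap.range g) :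
    ∃ l : P →ₗ[R] X, g ∘ₗ l = f := by
  obtain ⟨l, hl⟩ := Module.projective_lifting_property g.rangeRestrict
    (f.codRestrict _ fun x => h ⟨x, rfl⟩) g.surjective_rangeRestrict
  exact ⟨l, LinearMap.ext fun x => congrArg Subtype.val (LinearMap.congr_fun hl x)⟩

section Internal

variable {R X Y : Type*} [Ring R] [AddCommGroup X] [Module R X] [AddCommGroup Y] [Module R Y]

theorem isInternal_prod {ι : Type*} [DecidableEq ι] {A : ι → Submodule R X}
    {B : ι → Submodule R Y} (hA : DirectSum.IsInternal A) (hB : DirectSum.IsInternal B) :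
    DirectSum.IsInternal fun i => (A i).prod (B i) := by
  rw [DirectSum.isInternal_submodule_iff_iSupIndep_and_iSup_eq_top] at hA hB ⊢
  refine ⟨fun i => ?_, ?_⟩
  · have hle : ⨆ j, ⨆ (_ : j ≠ i), (A j).prod (B j) ≤
        (⨆ j, ⨆ (_ : j ≠ i), A j).prod (⨆ j, ⨆ (_ : j ≠ i), B j) :=
      iSup₂_le fun j hj => Submodule.prod_mono (le_iSup₂_of_le j hj le_rfl)
        (le_iSup₂_of_le j hj le_rfl)
    refine Disjoint.mono_right hle (Submodule.disjoint_def.2 fun x hx hx' => Prod.ext ?_ ?_)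
    · exact Submodule.disjoint_def.1 (hA.1 i) _ hx.1 hx'.1
    · exact Submodule.disjoint_def.1 (hB.1 i) _ hx.2 hx'.2
  · simp only [LinearMap.prod_eq_sup_map, iSup_sup_eq, ← Submodule.map_iSup, hA.2, hB.2]
    rw [← LinearMap.prod_eq_sup_map, Submodule.prod_top]

/-- The grading of the suspension of a graded module with components `A d`. -/
def suspend (A : ℕ → Submodule R X) : ℕ → Submodule R X
  | 0 => ⊥
  | d + 1 => A d

theorem isInternal_suspend {A : ℕ → Submodule R X} (hA : DirectSum.IsInternal A) :
    DirectSum.IsInternal (suspend A) := by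
  rw [DirectSum.isInternal_submodule_iff_iSupIndep_and_iSup_eq_top] at hA ⊢
  refine ⟨?_, ?_⟩
  · rintro (_ | d)
    · exact disjoint_bot_left
    · refine (hA.1 d).mono_right (iSup₂_le ?_)
      rintro (_ | e) he
      · exact bot_le
      · exact le_iSup₂_of_le e (fun h => he (congrArg _ h)) le_rfl
  · rw [← sup_iSup_nat_succ]
    exact bot_sup_eq _ |>.trans hA.2

end Internal

namespace DGModule

variable {K : Type u} [CommRing K] {V W : DGModule.{u, v} K}

/-- The linear map with prescribed restrictions to the homogeneous components. -/
def lift (V : DGModule.{u, v} K) {X : Type*} [AddCommGroup X] [Module K X]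
    (φ : ∀ d, V.gr d →ₗ[K] X) : V →ₗ[K] X :=
  DirectSum.toModule K ℕ X φ ∘ₗ
    (LinearEquiv.ofBijective (DirectSum.coeLinearMap V.gr) V.isInternal).symm.toLinearMap

theorem lift_of_mem (V : DGModule.{u, v} K) {X : Type*} [AddCommGroup X] [Module K X]
    (φ : ∀ d, V.gr d →ₗ[K] X) {d : ℕ} {x : V} (hx : x ∈ V.gr d) : V.lift φ x = φ d ⟨x, hx⟩ := by
  have : (LinearEquiv.ofBijective (DirectSum.coeLinearMap V.gr) V.isInternal).symm x =
      DirectSum.lof K ℕ (fun d => V.gr d) d ⟨x, hx⟩ := by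
    rw [LinearEquiv.symm_apply_eq]
    exact (DirectSum.coeLinearMap_lof V.gr d ⟨x, hx⟩).symm
  change DirectSum.toModule K ℕ X φ
    ((LinearEquiv.ofBijective (DirectSum.coeLinearMap V.gr) V.isInternal).symm x) = _
  rw [this, DirectSum.toModule_lof]

theorem hom_ext (V : DGModule.{u, v} K) {X : Type*} [AddCommGroup X] [Module K X]
    {f g : V →ₗ[K] X} (h : ∀ d, ∀ x ∈ V.gr d, f x = g x) : f = g :=
  LinearMap.ext fun x => V.homogeneous_induction (p := fun x => f x = g x) x h (by simp)
    fun y z hy hz => by rw [map_add, map_add, hy, hz]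

theorem component_mem (V : DGModule.{u, v} K) (d : ℕ) (x : V) : V.component d x ∈ V.gr d :=
  Subtype.property _

/-- The grading involution: multiplication by `(-1) ^ d` in degree `d`. -/
def τ (V : DGModule.{u, v} K) : Module.End K V := V.lift fun d => (-1 : K) ^ d • (V.gr d).subtype

theorem τ_of_mem (V : DGModule.{u, v} K) {d : ℕ} {x : V} (hx : x ∈ V.gr d) :
    V.τ x = (-1 : K) ^ d • x := by
  rw [τ, lift_of_mem V _ hx]; rfl

theorem τ_mul_τ (V : DGModule.{u, v} K) : V.τ * V.τ = 1 := by
  refine V.hom_ext fun d x hx => ?_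
  rw [Module.End.mul_apply, V.τ_of_mem hx, map_smul, V.τ_of_mem hx, smul_smul, ← mul_pow]
  simp

theorem δ_mul_τ (V : DGModule.{u, v} K) : (V.δ : Module.End K V) * V.τ = -(V.τ * V.δ) := by
  refine V.hom_ext fun d x hx => ?_
  rw [LinearMap.neg_apply, Module.End.mul_apply, Module.End.mul_apply, V.τ_of_mem hx, map_smul]
  cases d with
  | zero => simp [V.δ_zero x hx]
  | succ d =>
    rw [V.τ_of_mem (V.δ_mem d x hx), pow_succ]
    simp

theorem Hom.map_τ (f : Hom V W) (x : V) : f (V.τ x) = W.τ (f x) := by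
  have : f.toFun ∘ₗ V.τ = W.τ ∘ₗ f.toFun := by
    refine V.hom_ext fun d x hx => ?_
    rw [LinearMap.comp_apply, LinearMap.comp_apply, V.τ_of_mem hx, map_smul,
      W.τ_of_mem (f.map_gr d x hx)]
  exact LinearMap.congr_fun this x

/-- The projection onto the part of even or odd degree. -/
def parity (V : DGModule.{u, v} K) (b : Fin 2) : Module.End K V :=
  V.lift fun d => if d % 2 = b then (V.gr d).subtype else 0

theorem parity_of_mem (V : DGModule.{u, v} K) (b : Fin 2) {d : ℕ} {x : V} (hx : x ∈ V.gr d) :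
    V.parity b x = if d % 2 = b then x else 0 := by
  rw [parity, lift_of_mem V _ hx]; split_ifs <;> rfl

/-- The differential and the grading involution of a dg-module. -/
def oddEnd (V : DGModule.{u, v} K) : OddEnd K V where
  δ := V.δ
  τ := V.τ
  τ_mul_τ := V.τ_mul_τ
  δ_mul_τ := V.δ_mul_τ

theorem Hom.isHom (f : Hom V W) : V.oddEnd.IsHom W.oddEnd f.toFun where
  comp_δ := LinearMap.ext f.map_δ
  comp_τ := LinearMap.ext f.map_τ

/-- The mapping cone of a morphism of dg-modules. -/
def cone (f : Hom V W) : DGModule.{u, v} K where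
  carrier := W × V
  gr d := (W.gr d).prod (suspend V.gr d)
  isInternal := isInternal_prod W.isInternal (isInternal_suspend V.isInternal)
  δ := coneDiff V.δ W.δ f.toFun
  δ_mem := by
    rintro (_ | d) ⟨w, v⟩ ⟨hw, hv⟩
    · exact ⟨Submodule.add_mem _ (W.δ_mem _ _ hw) (f.map_gr _ _ hv),
        neg_eq_zero.2 (V.δ_zero _ hv)⟩
    · exact ⟨Submodule.add_mem _ (W.δ_mem _ _ hw) (f.map_gr _ _ hv),
        Submodule.neg_mem _ (V.δ_mem _ _ hv)⟩
  δ_zero := by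
    rintro ⟨w, v⟩ ⟨hw, rfl : v = 0⟩
    simp [W.δ_zero w hw]
  δ_δ := coneDiff_coneDiff V.δ_δ W.δ_δ f.map_δ

theorem cone_τ (f : Hom V W) : (cone f).τ = LinearMap.prodMap W.τ (-V.τ) := by
  refine (cone f).hom_ext ?_
  rintro (_ | d) ⟨w, v⟩ hx
  · rw [(cone f).τ_of_mem hx]
    obtain ⟨hw, rfl : v = 0⟩ := hx
    refine Prod.ext (W.τ_of_mem hw).symm ?_
    exact (smul_zero ((-1 : K) ^ 0)).trans (map_zero (-V.τ)).symm
  · rw [(cone f).τ_of_mem hx]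
    obtain ⟨hw, hv⟩ := hx
    refine Prod.ext (W.τ_of_mem hw).symm ?_
    change (-1 : K) ^ (d + 1) • v = -V.τ v
    rw [V.τ_of_mem hv, pow_succ, mul_neg_one, neg_smul]

theorem cone_oddEnd (f : Hom V W) : (cone f).oddEnd = OddEnd.cone f.isHom := by
  simp only [oddEnd, OddEnd.cone, cone_τ]
  rfl

theorem component_δ (V : DGModule.{u, v} K) (d : ℕ) (x : V) :
    V.component d (V.δ x) = V.δ (V.component (d + 1) x) := by
  have : V.component d ∘ₗ V.δ = V.δ ∘ₗ V.component (d + 1) := by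
    refine V.hom_ext fun e x hx => ?_
    simp only [LinearMap.comp_apply]
    rcases e with _ | e
    · rw [V.δ_zero x hx, V.component_ne _ _ (by omega) x hx, map_zero, map_zero]
    · by_cases h : e = d
      · subst h
        rw [V.component_same _ _ (V.δ_mem e x hx), V.component_same _ _ hx]
      · rw [V.component_ne _ _ h _ (V.δ_mem e x hx),
          V.component_ne _ _ (fun h' => h (Nat.succ_injective h')) _ hx, map_zero]
  exact LinearMap.congr_fun this x

/-- Indexing: `s (d + 1)` is the contraction in degree `d`. -/
theorem exists_partial_contractions (V : DGModule.{u, v} K) [Module.Projective K V]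
    (hV : ∀ x, V.δ x = 0 → ∃ y, V.δ y = x) :
    ∃ s : ℕ → Module.End K V, ∀ d, ∀ x ∈ V.gr d, V.δ (s (d + 1) x) = x - s d (V.δ x) := by
  let P (d : ℕ) (s : Module.End K V) : Prop := ∀ x ∈ V.gr d, V.δ (s (V.δ x)) = V.δ x
  have extend (d : ℕ) (s : Module.End K V) (hs : P d s) :
      ∃ t : Module.End K V, ∀ x ∈ V.gr d, V.δ (t x) = x - s (V.δ x) := by
    obtain ⟨t, ht⟩ := exists_comp_eq_of_range_le ((1 - s * V.δ) ∘ₗ V.component d) V.δ (by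
      rintro _ ⟨x, rfl⟩
      refine hV _ ?_
      simp [hs _ (V.component_mem d x)])
    refine ⟨t, fun x hx => ?_⟩
    simpa [V.component_same d x hx] using LinearMap.congr_fun ht x
  choose next hnext using extend
  have step (d : ℕ) (s : Module.End K V) (hs : P d s) : P (d + 1) (next d s hs) := fun x hx => by
    rw [hnext d s hs _ (V.δ_mem d x hx), V.δ_δ, map_zero, sub_zero]
  let s (d : ℕ) : {s : Module.End K V // P d s} :=
    Nat.rec ⟨0, fun x hx => by simp [V.δ_zero x hx]⟩ (fun d s => ⟨next d s.1 s.2, step d _ _⟩) d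
  exact ⟨fun d => (s d).1, fun d x hx => hnext d (s d).1 (s d).2 x hx⟩

theorem homotopicToOne_zero (V : DGModule.{u, v} K) [Module.Projective K V]
    (hV : ∀ x, V.δ x = 0 → ∃ y, V.δ y = x) : V.oddEnd.HomotopicToOne 0 := by
  obtain ⟨s, hs⟩ := V.exists_partial_contractions hV
  let h : Module.End K V := V.lift fun d => V.component (d + 1) ∘ₗ s (d + 1) ∘ₗ (V.gr d).subtype
  have h_apply (d : ℕ) (x : V) (hx : x ∈ V.gr d) : h x = V.component (d + 1) (s (d + 1) x) :=
    V.lift_of_mem _ hx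
  refine ⟨h, V.hom_ext fun d x hx => ?_, V.hom_ext fun d x hx => ?_⟩
  · have hhx : h x ∈ V.gr (d + 1) := by rw [h_apply d x hx]; exact V.component_mem _ _
    change h (V.τ x) = -V.τ (h x)
    rw [V.τ_of_mem hx, map_smul, V.τ_of_mem hhx, pow_succ, mul_neg_one, neg_smul, neg_neg]
  · change V.δ (h x) + h (V.δ x) = x - 0
    rw [h_apply d x hx, ← component_δ, hs d x hx, map_sub, V.component_same d x hx, sub_zero]
    rcases d with _ | d
    · simp [V.δ_zero x hx]
    · rw [h_apply d _ (V.δ_mem d x hx), sub_add_cancel]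

theorem Hom.quasiIso_iff (f : Hom V W) :
    f.QuasiIso ↔ ConeAcyclic V.δ W.δ f.toFun := by
  rw [coneAcyclic_iff_injective_and_surjective f.map_δ, Hom.QuasiIso, Function.Bijective]
  refine and_congr ?_ ?_
  · rw [injective_iff_map_eq_zero]
    constructor
    · rintro h v hv ⟨w, hw⟩
      have := h (Submodule.Quotient.mk ⟨v, hv⟩) (by
        refine (Submodule.Quotient.mk_eq_zero _).2 ?_
        exact ⟨w, hw⟩)
      exact (Submodule.Quotient.mk_eq_zero _).1 this
    · intro h x hx
      obtain ⟨⟨v, hv⟩, rfl⟩ := Submodule.Quotient.mk_surjective _ x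
      obtain ⟨w, hw⟩ := (Submodule.Quotient.mk_eq_zero _).1 hx
      exact (Submodule.Quotient.mk_eq_zero _).2 (h v hv ⟨w, hw⟩)
  · constructor
    · intro h w hw
      obtain ⟨x, hx⟩ := h (Submodule.Quotient.mk ⟨w, hw⟩)
      obtain ⟨⟨v, hv⟩, rfl⟩ := Submodule.Quotient.mk_surjective _ x
      obtain ⟨y, hy⟩ := (Submodule.Quotient.eq _).1 hx
      exact ⟨v, hv, y, hy⟩
    · intro h x
      obtain ⟨⟨w, hw⟩, rfl⟩ := Submodule.Quotient.mk_surjective _ x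
      obtain ⟨v, hv, y, hy⟩ := h w hw
      exact ⟨Submodule.Quotient.mk ⟨v, hv⟩, (Submodule.Quotient.eq _).2 ⟨y, hy⟩⟩

theorem Hom.QuasiIso.isHomotopyEquiv [Module.Projective K V] [Module.Projective K W]
    {f : Hom V W} (hf : f.QuasiIso) : V.oddEnd.IsHomotopyEquiv W.oddEnd f.toFun := by
  have : Module.Projective K (cone f) := inferInstanceAs (Module.Projective K (W × V))
  refine OddEnd.isHomotopyEquiv_of_cone f.isHom (cone_oddEnd f ▸ (cone f).homotopicToOne_zero ?_)
  exact coneAcyclic_iff.1 (f.quasiIso_iff.1 hf)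

end DGModule

/-! ## The summands of the composition product -/

section Sign

variable (K : Type u) [CommRing K]

/-- The Koszul sign of `y_1 ⊗ ⋯ ⊗ y_r ↦ y_{v(1)} ⊗ ⋯ ⊗ y_{v(s)}`, where `y_k` has degree `d k`. The
number of factors is written in two ways because the bijections of interest relate the blocks of two
maps `I → Fin r` and `I → Fin s`; for `s = r` this is `koszulSign`. -/
def equivSign {r s : ℕ} (v : Fin s ≃ Fin r) (d : Fin r → ℕ) : K :=
  ∏ k : Fin s, ∏ l : Fin s, if k < l ∧ v l < v k then (-1 : K) ^ (d (v k) * d (v l)) else 1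

theorem equivSign_refl {r : ℕ} (d : Fin r → ℕ) : equivSign K (Equiv.refl (Fin r)) d = 1 :=
  Finset.prod_eq_one fun _ _ => Finset.prod_eq_one fun _ _ => if_neg fun h => lt_asymm h.1 h.2

theorem equivSign_mod_two {r s : ℕ} (v : Fin s ≃ Fin r) (d : Fin r → ℕ) :
    equivSign K v (fun k => d k % 2) = equivSign K v d := by
  refine Finset.prod_congr rfl fun k _ => Finset.prod_congr rfl fun l _ => ?_
  split_ifs
  · rw [neg_one_pow_eq_pow_mod_two, ← Nat.mul_mod, ← neg_one_pow_eq_pow_mod_two]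
  · rfl

theorem prod_prod_eq_prod_prod_lt {r : ℕ} (F : Fin r → Fin r → K) (hF : ∀ k, F k k = 1) :
    ∏ k, ∏ l, F k l = ∏ k, ∏ l, if k < l then F k l * F l k else 1 := by
  have h : ∀ k l, F k l = (if k < l then F k l else 1) * (if l < k then F k l else 1) := by
    intro k l
    rcases lt_trichotomy k l with h | h | h
    · simp [h, h.not_gt]
    · simp [h, hF]
    · simp [h, h.not_gt]
  have h' : ∀ k l, (if k < l then F k l * F l k else 1) =
      (if k < l then F k l else 1) * (if k < l then F l k else 1) := by
    intro k l; split_ifs <;> simp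
  simp only [h']
  conv_lhs => enter [2, k, 2, l]; rw [h]
  simp only [Finset.prod_mul_distrib]
  congr 1
  exact Finset.prod_comm

theorem equivSign_trans {r s t : ℕ} (v : Fin t ≃ Fin s) (w : Fin s ≃ Fin r) (d : Fin r → ℕ) :
    equivSign K (v.trans w) d = equivSign K w d * equivSign K v (d ∘ w) := by
  have e : equivSign K w d = ∏ k : Fin t, ∏ l : Fin t,
      if v k < v l ∧ w (v l) < w (v k) then (-1 : K) ^ (d (w (v k)) * d (w (v l))) else 1 := by
    rw [equivSign, ← v.prod_comp]
    exact Finset.prod_congr rfl fun k _ => (v.prod_comp _).symm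
  rw [e, prod_prod_eq_prod_prod_lt K _ fun k => if_neg fun h => lt_irrefl _ h.1]
  simp only [equivSign, ← Finset.prod_mul_distrib]
  refine Finset.prod_congr rfl fun k _ => Finset.prod_congr rfl fun l _ => ?_
  by_cases hkl : k < l
  · simp only [hkl, true_and, if_true, Function.comp_apply, Equiv.trans_apply]
    rw [mul_comm (d (w (v l)))]
    have hne : v k ≠ v l := v.injective.ne hkl.ne
    have hne' : w (v k) ≠ w (v l) := w.injective.ne hne
    have hsq : (-1 : K) ^ (d (w (v k)) * d (w (v l))) * (-1) ^ (d (w (v k)) * d (w (v l))) = 1 := by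
      rw [← mul_pow]; simp
    rcases lt_or_gt_of_ne hne with h1 | h1 <;> rcases lt_or_gt_of_ne hne' with h2 | h2 <;>
      simp [h1, h2, h1.not_gt, h2.not_gt, hsq]
  · simp [hkl]

end Sign

section Multilinear

variable {K : Type u} [CommRing K]

theorem multilinearMap_ext_homogeneous {ι : Type*} [Finite ι] {V : ι → DGModule.{u, v} K}
    {X : Type*} [AddCommGroup X] [Module K X] {f g : MultilinearMap K (fun i => V i) X}
    (h : ∀ (d : ι → ℕ) (y : ∀ i, V i), (∀ i, y i ∈ (V i).gr (d i)) → f y = g y) : f = g := by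
  classical
  have := Fintype.ofFinite ι
  have key : ∀ (S : Finset ι) (y : ∀ i, V i), (∀ i ∉ S, ∃ d, y i ∈ (V i).gr d) → f y = g y := by
    intro S
    induction S using Finset.induction with
    | empty =>
      intro y hy
      choose d hd using fun i => hy i (Finset.notMem_empty i)
      exact h d y hd
    | insert k S hk ih =>
      intro y hy
      have := (V k).homogeneous_induction
        (p := fun z => f (Function.update y k z) = g (Function.update y k z)) (y k) ?_ ?_ ?_
      · simpa using this
      · intro d z hz
        refine ih _ fun i hi => ?_
        by_cases hik : i = k
        · subst hik; exact ⟨d, by simpa using hz⟩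
        · simpa [hik] using hy i (by simp [hik, hi])
      · rw [f.map_update_zero, g.map_update_zero]
      · intro a b ha hb
        rw [f.map_update_add, g.map_update_add, ha, hb]
  exact MultilinearMap.ext fun y => key Finset.univ y fun i hi => (hi (Finset.mem_univ i)).elim

end Multilinear

section Summand

variable {K : Type u} [CommRing K] (M N : SigmaModule.{u, v} K)

/-- The summand `M(r) ⊗ N(J_1) ⊗ ⋯ ⊗ N(J_r)` of the composition product. -/
abbrev BlockTensor {I : Type} [Finite I] {r : ℕ} (f : I → Fin r) : Type (max u v) :=
  M.obj (Fin r) ⊗[K] (⨂[K] k : Fin r, N.obj (Block f k))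

variable {M N} in
theorem blockTensor_ext {I : Type} [Finite I] {r : ℕ} {f : I → Fin r} {X : Type*} [AddCommGroup X]
    [Module K X] {α β : BlockTensor M N f →ₗ[K] X}
    (h : ∀ (x : M.obj (Fin r)) (d : Fin r → ℕ) (y : ∀ k, N.obj (Block f k)),
      (∀ k, y k ∈ (N.obj (Block f k)).gr (d k)) →
      α (x ⊗ₜ PiTensorProduct.tprod K y) = β (x ⊗ₜ PiTensorProduct.tprod K y)) : α = β := by
  refine TensorProduct.ext (LinearMap.ext fun x => PiTensorProduct.ext ?_)
  exact multilinearMap_ext_homogeneous (V := fun k => N.obj (Block f k)) fun d y hy => h x d y hy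

/-- The canonical map from a summand to the composition product. -/
def toComposite {I : Type} [Finite I] {r : ℕ} (f : I → Fin r) :
    BlockTensor M N f →ₗ[K] Composite M N I := by
  classical
  exact (coinvariantRelations M N I).mkQ ∘ₗ DirectSum.lof K (Σ r : ℕ, (I → Fin r))
    (fun s => M.obj (Fin s.1) ⊗[K] (⨂[K] k : Fin s.1, N.obj (Block s.2 k))) ⟨r, f⟩

theorem toComposite_tmul {I : Type} [Finite I] {r : ℕ} (f : I → Fin r)
    (x : M.obj (Fin r)) (y : ∀ k, N.obj (Block f k)) :
    toComposite M N f (x ⊗ₜ PiTensorProduct.tprod K y) = compositeMk M N f x y := rfl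

/-- If `f = v ∘ g`, the block of `f` over `v k` is the block of `g` over `k`. -/
def blockEquiv {I : Type} {r s : ℕ} {f : I → Fin r} {g : I → Fin s} (v : Fin s ≃ Fin r)
    (h : ∀ a, f a = v (g a)) (k : Fin s) : Block f (v k) ≃ Block g k :=
  Equiv.subtypeEquivRight fun a => by rw [h]; exact v.injective.eq_iff

/-- The signed permutation of the factors `N(J_k)`. As the Koszul sign depends only on the parities
of the degrees, it is implemented by the sum over all parities `p` of the projections onto the
tensors whose `k`-th factor has degree congruent to `p k` modulo `2`. -/
def permuteFactors {I : Type} [Finite I] {r s : ℕ} {f : I → Fin r} {g : I → Fin s}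
    (v : Fin s ≃ Fin r) (h : ∀ a, f a = v (g a)) :
    (⨂[K] k, N.obj (Block f k)) →ₗ[K] ⨂[K] k, N.obj (Block g k) :=
  PiTensorProduct.map (s := fun k => N.obj (Block f (v k)))
      (fun k => (N.map (blockEquiv v h k)).toFun) ∘ₗ
    (PiTensorProduct.reindex K (fun k => N.obj (Block f k)) v.symm).toLinearMap ∘ₗ
    ∑ p : Fin r → Fin 2, equivSign K v (fun k => p k) •
      PiTensorProduct.map fun k => (N.obj (Block f k)).parity (p k)

theorem permuteFactors_tprod {I : Type} [Finite I] {r s : ℕ} {f : I → Fin r} {g : I → Fin s}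
    (v : Fin s ≃ Fin r) (h : ∀ a, f a = v (g a)) (d : Fin r → ℕ) (y : ∀ k, N.obj (Block f k))
    (hy : ∀ k, y k ∈ (N.obj (Block f k)).gr (d k)) :
    permuteFactors N v h (PiTensorProduct.tprod K y) = equivSign K v d •
      PiTensorProduct.tprod K fun k => N.map (blockEquiv v h k) (y (v k)) := by
  have h1 : (∑ p : Fin r → Fin 2, equivSign K v (fun k => p k) •
      PiTensorProduct.map fun k => (N.obj (Block f k)).parity (p k)) (PiTensorProduct.tprod K y) =
      equivSign K v d • PiTensorProduct.tprod K y := by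
    rw [LinearMap.sum_apply, Finset.sum_eq_single fun k => ⟨d k % 2, Nat.mod_lt _ two_pos⟩]
    · rw [LinearMap.smul_apply, PiTensorProduct.map_tprod, equivSign_mod_two K v d]
      congr 2
      funext k
      rw [DGModule.parity_of_mem _ _ (hy k), if_pos rfl]
    · intro p _ hp
      obtain ⟨k, hk⟩ := Function.ne_iff.1 hp
      rw [LinearMap.smul_apply, PiTensorProduct.map_tprod,
        MultilinearMap.map_coord_zero _ k, smul_zero]
      rw [DGModule.parity_of_mem _ _ (hy k), if_neg]
      exact fun e => hk (Fin.ext e.symm)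
    · simp
  rw [permuteFactors, LinearMap.comp_apply, LinearMap.comp_apply, h1, map_smul, map_smul]
  congr 1
  rw [LinearEquiv.coe_coe, PiTensorProduct.reindex_tprod]
  exact PiTensorProduct.map_tprod _ _

/-- The signed permutation of the factors of a summand of the composition product. -/
def permuteSummand {I : Type} [Finite I] {r s : ℕ} {f : I → Fin r} {g : I → Fin s}
    (v : Fin s ≃ Fin r) (h : ∀ a, f a = v (g a)) :
    BlockTensor M N f →ₗ[K] BlockTensor M N g :=
  TensorProduct.map (M.map v.symm).toFun (permuteFactors N v h)

theorem permuteSummand_tmul {I : Type} [Finite I] {r s : ℕ} {f : I → Fin r} {g : I → Fin s}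
    (v : Fin s ≃ Fin r) (h : ∀ a, f a = v (g a)) (d : Fin r → ℕ) (x : M.obj (Fin r))
    (y : ∀ k, N.obj (Block f k)) (hy : ∀ k, y k ∈ (N.obj (Block f k)).gr (d k)) :
    permuteSummand M N v h (x ⊗ₜ PiTensorProduct.tprod K y) = equivSign K v d •
      (M.map v.symm x ⊗ₜ PiTensorProduct.tprod K fun k =>
        N.map (blockEquiv v h k) (y (v k))) := by
  rw [permuteSummand, TensorProduct.map_tmul, permuteFactors_tprod N v h d y hy,
    TensorProduct.tmul_smul]

theorem permuteSummand_refl {I : Type} [Finite I] {r : ℕ} {f : I → Fin r}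
    (t : BlockTensor M N f) :
    permuteSummand M N (Equiv.refl (Fin r)) (fun _ => rfl) t = t := by
  have : permuteSummand M N (Equiv.refl (Fin r)) (fun _ => rfl) =
      (LinearMap.id : BlockTensor M N f →ₗ[K] BlockTensor M N f) := by
    refine blockTensor_ext fun x d y hy => ?_
    rw [permuteSummand_tmul M N _ _ d x y hy, equivSign_refl, one_smul]
    change M.map (Equiv.refl _) x ⊗ₜ _ = _
    rw [M.map_refl]
    congr 2
    funext k
    exact N.map_refl (y k)
  rw [this]; rfl

theorem map_apply_congr {I B : Type} [Finite I] [Finite B] {r : ℕ} {f : I → Fin r}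
    (y : ∀ k, N.obj (Block f k)) {k k' : Fin r} (hk : k = k') (e : Block f k ≃ B)
    (e' : Block f k' ≃ B) (he : ∀ a ha ha', e ⟨a, ha⟩ = e' ⟨a, ha'⟩) :
    N.map e (y k) = N.map e' (y k') := by
  subst hk
  exact congrArg (fun e => N.map e (y k)) (Equiv.ext fun a => he a.1 a.2 a.2)

theorem toComposite_permuteSummand {I : Type} [Finite I] {r s : ℕ} {f : I → Fin r} {g : I → Fin s}
    (v : Fin s ≃ Fin r) (h : ∀ a, f a = v (g a)) (t : BlockTensor M N f) :
    toComposite M N g (permuteSummand M N v h t) = toComposite M N f t := by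
  obtain rfl : s = r := by simpa using Fintype.card_congr v
  have hg : g = fun a => v.symm (f a) := funext fun a => by rw [h, v.symm_apply_apply]
  subst hg
  have : toComposite M N _ ∘ₗ permuteSummand M N v h = toComposite M N f := by
    refine blockTensor_ext fun x d y hy => ?_
    rw [LinearMap.comp_apply, permuteSummand_tmul M N v h d x y hy, map_smul, toComposite_tmul,
      toComposite_tmul]
    have hx : M.map v (M.map v.symm x) = x := by
      rw [← M.map_trans, Equiv.symm_trans_self, M.map_refl]
    have := (Submodule.Quotient.eq (coinvariantRelations M N I)).2
      (Submodule.subset_span ⟨s, f, v, d, M.map v.symm x, y, hy, rfl⟩)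
    rw [hx] at this
    exact this.symm
  exact LinearMap.congr_fun this t

open Classical in
/-- The map from the direct sum over all `f` to the summand of `g` which permutes the factors of the
summands in the orbit of `g` and vanishes on the other ones. -/
def preProjection {I : Type} [Finite I] {s : ℕ} (g : I → Fin s) :
    PreComposite M N I →ₗ[K] BlockTensor M N g :=
  DirectSum.toModule K (Σ r : ℕ, (I → Fin r)) _ fun f =>
    if h : ∃ v : Fin s ≃ Fin f.1, ∀ a, f.2 a = v (g a)
    then permuteSummand M N h.choose h.choose_spec else 0

theorem preProjection_mk {I : Type} [Finite I] {r s : ℕ} {f : I → Fin r} {g : I → Fin s}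
    (hg : Function.Surjective g) (v : Fin s ≃ Fin r) (h : ∀ a, f a = v (g a)) (d : Fin r → ℕ)
    (x : M.obj (Fin r)) (y : ∀ k, N.obj (Block f k))
    (hy : ∀ k, y k ∈ (N.obj (Block f k)).gr (d k)) :
    preProjection M N g (preCompositeMk M N f x y) = equivSign K v d •
      (M.map v.symm x ⊗ₜ PiTensorProduct.tprod K fun k =>
        N.map (blockEquiv v h k) (y (v k))) := by
  classical
  have hex : ∃ v : Fin s ≃ Fin r, ∀ a, f a = v (g a) := ⟨v, h⟩
  have hv : hex.choose = v := Equiv.ext fun k => by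
    obtain ⟨a, rfl⟩ := hg k
    rw [← h, ← hex.choose_spec]
  have key : ∀ {w : Fin s ≃ Fin r} (_ : w = v) (hw : ∀ a, f a = w (g a)) (t : BlockTensor M N f),
      permuteSummand M N w hw t = permuteSummand M N v h t := by
    rintro _ rfl _ _; rfl
  rw [← permuteSummand_tmul M N v h d x y hy, preProjection, preCompositeMk]
  refine (DirectSum.toModule_lof K _ _).trans ?_
  rw [dif_pos hex]
  exact key hv _ _

theorem preProjection_mk_of_not {I : Type} [Finite I] {r s : ℕ} {f : I → Fin r} {g : I → Fin s}
    (h : ¬ ∃ v : Fin s ≃ Fin r, ∀ a, f a = v (g a))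
    (x : M.obj (Fin r)) (y : ∀ k, N.obj (Block f k)) :
    preProjection M N g (preCompositeMk M N f x y) = 0 := by
  classical
  rw [preProjection, preCompositeMk]
  refine (DirectSum.toModule_lof K _ _).trans ?_
  rw [dif_neg h]; rfl

theorem coinvariantRelations_le_ker_preProjection {I : Type} [Finite I] {s : ℕ} {g : I → Fin s}
    (hg : Function.Surjective g) :
    coinvariantRelations M N I ≤ LinearMap.ker (preProjection M N g) := by
  refine Submodule.span_le.2 ?_
  rintro _ ⟨r, f, w, d, x, y, hy, rfl⟩
  refine LinearMap.mem_ker.2 ?_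
  rw [map_sub, map_smul, sub_eq_zero]
  by_cases h : ∃ v : Fin s ≃ Fin r, ∀ a, f a = v (g a)
  · obtain ⟨v, hv⟩ := h
    rw [preProjection_mk M N hg v hv d _ y hy,
      preProjection_mk M N hg (v.trans w.symm) (fun a => by simp [hv]) (d ∘ w) x _
        (fun k => (N.map (blockPerm f w k)).map_gr _ _ (hy (w k))), smul_smul]
    have hsign : equivSign K v d = koszulSign K w d * equivSign K (v.trans w.symm) (d ∘ w) := by
      have := equivSign_trans K (v.trans w.symm) w d
      rwa [Equiv.trans_assoc, Equiv.symm_trans_self, Equiv.trans_refl] at this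
    rw [hsign, ← M.map_trans]
    congr 3
    funext k
    rw [← N.map_trans]
    exact map_apply_congr N y (by simp) _ _ fun a _ _ => rfl
  · rw [preProjection_mk_of_not M N h, preProjection_mk_of_not M N, smul_zero]
    rintro ⟨v, hv⟩
    exact h ⟨v.trans w, fun a => by rw [Equiv.trans_apply, ← hv, w.apply_symm_apply]⟩

/-- The projection of the composition product onto the summand of a surjection `g`. -/
def projection {I : Type} [Finite I] {s : ℕ} (g : I → Fin s) (hg : Function.Surjective g) :
    Composite M N I →ₗ[K] BlockTensor M N g :=
  (coinvariantRelations M N I).liftQ (preProjection M N g)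
    (coinvariantRelations_le_ker_preProjection M N hg)

theorem projection_toComposite {I : Type} [Finite I] {r : ℕ} (g : I → Fin r)
    (hg : Function.Surjective g) (t : BlockTensor M N g) :
    projection M N g hg (toComposite M N g t) = t := by
  have : projection M N g hg ∘ₗ toComposite M N g = LinearMap.id := by
    refine blockTensor_ext fun x d y hy => ?_
    rw [LinearMap.comp_apply, toComposite_tmul]
    refine (preProjection_mk M N hg (Equiv.refl _) (fun _ => rfl) d x y hy).trans ?_
    exact (permuteSummand_tmul M N (Equiv.refl _) (fun _ => rfl) d x y hy).symm.trans
      (permuteSummand_refl M N _)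
  exact LinearMap.congr_fun this t

theorem projection_toComposite_of_not {I : Type} [Finite I] {r s : ℕ} {f : I → Fin r}
    {g : I → Fin s} (hg : Function.Surjective g)
    (h : ¬ ∃ v : Fin s ≃ Fin r, ∀ a, f a = v (g a)) (t : BlockTensor M N f) :
    projection M N g hg (toComposite M N f t) = 0 := by
  have : projection M N g hg ∘ₗ toComposite M N f = 0 := by
    refine blockTensor_ext fun x _ y _ => ?_
    exact preProjection_mk_of_not M N h x y
  exact LinearMap.congr_fun this t

theorem composite_induction {I : Type} [Finite I] {S : Submodule K (Composite M N I)}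
    (h : ∀ (r : ℕ) (f : I → Fin r) (t : BlockTensor M N f), toComposite M N f t ∈ S)
    (z : Composite M N I) : z ∈ S := by
  classical
  obtain ⟨z, rfl⟩ := Submodule.Quotient.mk_surjective _ z
  induction z using DirectSum.induction_on with
  | zero => exact S.zero_mem
  | of s t => exact h s.1 s.2 t
  | add a b ha hb => exact S.add_mem ha hb

variable {N} in
theorem SigmaModule.ZeroInArityZero.subsingleton (hN : N.ZeroInArityZero)
    (J : Type) [Finite J] [IsEmpty J] : Subsingleton (N.obj J) := by
  have hN : Subsingleton (N.obj Empty) := hN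
  have e : J ≃ Empty := Equiv.equivEmpty J
  have hzero (x : N.obj J) : x = 0 := by
    rw [← N.map_refl x, ← Equiv.self_trans_symm e, N.map_trans, Subsingleton.elim (N.map e x) 0]
    exact map_zero _
  exact ⟨fun x y => (hzero x).trans (hzero y).symm⟩

theorem blockTensor_eq_zero (hN : N.ZeroInArityZero) {I : Type} [Finite I] {r : ℕ} {f : I → Fin r}
    (hf : ¬ Function.Surjective f) (t : BlockTensor M N f) : t = 0 := by
  have : (LinearMap.id : BlockTensor M N f →ₗ[K] BlockTensor M N f) = 0 := by
    refine blockTensor_ext fun x _ y _ => ?_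
    simp only [Function.Surjective, not_forall, not_exists] at hf
    obtain ⟨k, hk⟩ := hf
    have : IsEmpty (Block f k) := ⟨fun a => hk a.1 a.2⟩
    have := hN.subsingleton (Block f k)
    rw [LinearMap.id_apply, MultilinearMap.map_coord_zero _ k (Subsingleton.elim _ _),
      TensorProduct.tmul_zero]
    rfl
  exact LinearMap.congr_fun this t

end Summand

section Partition

variable {I : Type}

/-- The number of classes of a partition. -/
def blockCount (π : Setoid I) : ℕ := Nat.card (Quotient π)

/-- The surjection onto `{1, …, r}` whose blocks are the classes of a partition. -/
def blockMap [Finite I] (π : Setoid I) (a : I) : Fin (blockCount π) :=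
  Finite.equivFin (Quotient π) (Quotient.mk π a)

theorem blockMap_surjective [Finite I] (π : Setoid I) :
    Function.Surjective (blockMap π) :=
  (Finite.equivFin (Quotient π)).surjective.comp Quotient.mk_surjective

theorem blockMap_eq_iff [Finite I] (π : Setoid I) (a b : I) :
    blockMap π a = blockMap π b ↔ π a b :=
  (Finite.equivFin (Quotient π)).injective.eq_iff.trans Quotient.eq

theorem exists_equiv_blockMap [Finite I] {r : ℕ} {f : I → Fin r}
    (hf : Function.Surjective f) :
    ∃ v : Fin (blockCount (Setoid.ker f)) ≃ Fin r, ∀ a, f a = v (blockMap (Setoid.ker f) a) :=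
  ⟨(Finite.equivFin _).symm.trans (Setoid.quotientKerEquivOfSurjective f hf), fun a =>
    congrArg (Setoid.quotientKerEquivOfSurjective f hf)
      ((Finite.equivFin (Quotient (Setoid.ker f))).symm_apply_apply (Quotient.mk _ a)).symm⟩

theorem eq_ker_of_equiv [Finite I] {r : ℕ} {f : I → Fin r} {π : Setoid I}
    (v : Fin (blockCount π) ≃ Fin r) (hv : ∀ a, f a = v (blockMap π a)) : π = Setoid.ker f := by
  ext a b
  rw [← blockMap_eq_iff, Setoid.ker_def, hv, hv, v.injective.eq_iff]

instance [Finite I] : Fintype (Setoid I) :=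
  have : Finite (Setoid I) :=
    Finite.of_injective (fun (π : Setoid I) a b => π a b) fun _ _ h =>
      Setoid.ext fun a b => iff_of_eq (congrFun (congrFun h a) b)
  Fintype.ofFinite _

theorem blockCount_le [Finite I] (π : Setoid I) : blockCount π ≤ Nat.card I :=
  Nat.card_le_card_of_surjective _ (Quotient.mk_surjective (s := π))

theorem blockCount_eq_card_iff [Finite I] (π : Setoid I) :
    blockCount π = Nat.card I ↔ π = ⊥ := by
  constructor
  · intro h
    have hb : Function.Bijective (Quotient.mk π) :=
      (Nat.bijective_iff_surjective_and_card _).2 ⟨Quotient.mk_surjective, h.symm⟩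
    ext a b
    constructor
    · intro hab
      exact hb.1 (Quotient.sound hab)
    · intro hab
      have hab : a = b := hab
      rw [hab]
  · rintro rfl
    exact (Nat.card_congr (Equiv.ofBijective (Quotient.mk (⊥ : Setoid I))
      ⟨fun a b h => Quotient.exact h, Quotient.mk_surjective⟩)).symm

end Partition

/-! ## Iterated partial composites -/

theorem DGModule.bilinear_mem_of_homogeneous {K : Type u} [CommRing K] {V W : DGModule.{u, v} K}
    {X : Type*} [AddCommGroup X] [Module K X] (β : V →ₗ[K] W →ₗ[K] X) (S : Submodule K X)
    (h : ∀ (a b : ℕ), ∀ x ∈ V.gr a, ∀ y ∈ W.gr b, β x y ∈ S) (x : V) (y : W) : β x y ∈ S := by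
  refine V.homogeneous_induction (p := fun x => β x y ∈ S) x (fun a x hx => ?_) (by simp)
    fun x x' hx hx' => by simpa using S.add_mem hx hx'
  exact W.homogeneous_induction (p := fun y => β x y ∈ S) y (fun b y hy => h a b x hx y hy)
    (by simp) fun y y' hy hy' => by simpa using S.add_mem hy hy'

section Graft

/-- The extension of `g` to the substitution of `J` for `u`, which is constant on `J`. -/
def graftMap {I X : Type} (g : I → X) (u : I) {J : Type} : Graft u J → X :=
  Sum.elim (fun a => g a.1) fun _ => g u

theorem exists_eq_sumCongr {A B A' B' : Type} (e : A ⊕ B ≃ A' ⊕ B')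
    (hl : ∀ a, ∃ a', e (Sum.inl a) = Sum.inl a') (hr : ∀ b, ∃ b', e (Sum.inr b) = Sum.inr b') :
    ∃ (u : A ≃ A') (v : B ≃ B'), e = Equiv.sumCongr u v := by
  have hl' (a' : A') : ∃ a, e.symm (Sum.inl a') = Sum.inl a := by
    rcases h : e.symm (Sum.inl a') with a | b
    · exact ⟨a, rfl⟩
    · obtain ⟨b', hb'⟩ := hr b
      rw [← h, e.apply_symm_apply] at hb'
      exact (Sum.inl_ne_inr hb').elim
  have hr' (b' : B') : ∃ b, e.symm (Sum.inr b') = Sum.inr b := by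
    rcases h : e.symm (Sum.inr b') with a | b
    · obtain ⟨a', ha'⟩ := hl a
      rw [← h, e.apply_symm_apply] at ha'
      exact (Sum.inr_ne_inl ha').elim
    · exact ⟨b, rfl⟩
  choose u hu using hl
  choose v hv using hr
  choose u' hu' using hl'
  choose v' hv' using hr'
  exact ⟨⟨u, u', fun a => Sum.inl_injective (by rw [← hu', ← hu, e.symm_apply_apply]),
      fun a => Sum.inl_injective (by rw [← hu, ← hu', e.apply_symm_apply])⟩,
    ⟨v, v', fun b => Sum.inr_injective (by rw [← hv', ← hv, e.symm_apply_apply]),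
      fun b => Sum.inr_injective (by rw [← hv, ← hv', e.apply_symm_apply])⟩,
    Equiv.ext (Sum.rec hu hv)⟩

theorem exists_equiv_of_subtype_ne {I I' : Type} {i : I} {i' : I'}
    (w : {x : I // x ≠ i} ≃ {x : I' // x ≠ i'}) :
    ∃ U : I ≃ I', U i = i' ∧ ∀ x : {x : I // x ≠ i}, U x.1 = (w x).1 := by
  classical
  refine ⟨(Equiv.optionSubtypeNe i).symm.trans
    ((Equiv.optionCongr w).trans (Equiv.optionSubtypeNe i')), by simp, fun x => ?_⟩
  simp [Equiv.optionSubtypeNe_symm_of_ne x.2]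

theorem exists_map_eq_of_graftMap_eq {A A' J J' X : Type} {g : A → X} {g' : A' → X} {u : A} {i : A'}
    (hu : ∀ a, g a = g u → a = u) (hi : ∀ a, g' a = g' i → a = i) (hui : g' i = g u)
    (Θ : Graft u J ≃ Graft i J') (hΘ : ∀ s, graftMap g' i (Θ s) = graftMap g u s) :
    ∃ (U : A ≃ A') (v : J ≃ J'), U u = i ∧ (∀ a, g' (U a) = g a) ∧
      ∀ s, (Θ s).map Subtype.val id = s.map (fun a => U a.1) v := by
  obtain ⟨w, v, rfl⟩ := exists_eq_sumCongr Θ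
    (fun a => by
      rcases hs : Θ (Sum.inl a) with s | s
      · exact ⟨s, rfl⟩
      · have := hΘ (Sum.inl a)
        rw [hs] at this
        exact (a.2 (hu _ (this.symm.trans hui))).elim)
    (fun b => by
      rcases hs : Θ (Sum.inr b) with s | s
      · have := hΘ (Sum.inr b)
        rw [hs] at this
        exact (s.2 (hi _ (Eq.trans this hui.symm))).elim
      · exact ⟨s, rfl⟩)
  obtain ⟨U, hU, hw⟩ := exists_equiv_of_subtype_ne w
  refine ⟨U, v, hU, fun a => ?_, ?_⟩
  · by_cases ha : a = u
    · rw [ha, hU, hui]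
    · rw [hw ⟨a, ha⟩]
      exact hΘ (Sum.inl ⟨a, ha⟩)
  · rintro (a | b)
    · exact congrArg Sum.inl (hw a).symm
    · rfl

/-- The entry of `{1, …, r}` from which an element of a stage comes. -/
def stageMap {I : Type} {r : ℕ} (f : I → Fin r) (k : ℕ) : Stage f k → Fin r :=
  Sum.elim (fun a => f a.1) fun j => j.1

theorem stageMap_stageSucc {I : Type} {r : ℕ} (f : I → Fin r) (k : ℕ) (hk : k < r)
    (s : Graft (Sum.inr ⟨⟨k, hk⟩, le_rfl⟩ : Stage f k) (Block f ⟨k, hk⟩)) :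
    stageMap f (k + 1) (stageSucc f k hk s) = graftMap (stageMap f k) _ s := by
  rcases s with ⟨s | s, _⟩ | s
  · rfl
  · rfl
  · exact s.2

end Graft

namespace RightModule

variable {K : Type u} [CommRing K] {P : DGOperad.{u, v} K}

section Comp

variable (L : RightModule P) {A B J J' : Type} [Finite A] [Finite B] [Finite J] [Finite J']

theorem comp_map_left (e : A ≃ B) (i : A) (S : L.obj A) (q : P.obj J) :
    L.comp (e i) (L.map e S) q = L.map (graftCongr e (Equiv.refl J) i) (L.comp i S q) := by
  rw [← L.comp_map]
  exact congrArg _ (P.map_refl q).symm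

theorem comp_inr_comp (i : A) (j : J) (S : L.obj A) (p : P.obj J) (q : P.obj J') :
    L.comp (Sum.inr j : Graft i J) (L.comp i S p) q =
      L.map (graftAssoc i j J').symm (L.comp i S (P.comp j p q)) := by
  rw [← L.comp_assoc, ← L.map_trans, Equiv.self_trans_symm, L.map_refl]

theorem comp_inl_comp_mem {i i' : A} (h : i ≠ i') (S : L.obj A)
    {W : Submodule K (L.obj (Graft (Sum.inl ⟨i', h.symm⟩ : Graft i J) J'))}
    (hW : ∀ (p : P.obj J) (q : P.obj J'), L.map (graftComm h J J').symm
      (L.comp (Sum.inl ⟨i, h⟩ : Graft i' J') (L.comp i' S q) p) ∈ W)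
    (p : P.obj J) (q : P.obj J') :
    L.comp (Sum.inl ⟨i', h.symm⟩ : Graft i J) (L.comp i S p) q ∈ W := by
  refine DGModule.bilinear_mem_of_homogeneous (L.comp _ ∘ₗ L.comp i S) W
    (fun a b p hp q hq => ?_) p q
  have hcomm : L.comp (Sum.inl ⟨i', h.symm⟩ : Graft i J) (L.comp i S p) q =
      (-1 : K) ^ (a * b) • L.map (graftComm h J J').symm
        (L.comp (Sum.inl ⟨i, h⟩ : Graft i' J') (L.comp i' S q) p) := by
    rw [← map_smul, ← L.comp_comm h a b S p q hp hq, ← L.map_trans, Equiv.self_trans_symm,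
      L.map_refl]
  rw [LinearMap.comp_apply, hcomm]
  exact W.smul_mem _ (hW p q)

theorem map_comp_of_map_eq {u : A} {i : B} (U : A ≃ B) (v : J ≃ J') (hU : U u = i)
    (e : Graft u J ≃ Graft i J')
    (he : ∀ s, (e s).map Subtype.val id = s.map (fun a => U a.1) v)
    (S : L.obj A) (p : P.obj J) :
    L.map e (L.comp u S p) = L.comp i (L.map U S) (P.map v p) := by
  subst hU
  rw [L.comp_map]
  refine congrArg (fun e => L.map e (L.comp u S p)) (Equiv.ext fun s => ?_)
  refine Sum.map_injective.2 ⟨Subtype.val_injective, Function.injective_id⟩ ((he s).trans ?_)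
  rcases s with _ | _ <;> rfl

end Comp

/-- `IsPartialComposite x k A g S`: the element `S ∈ L(A)` is obtained from `x ∈ L(r)` by
substituting elements of `P` for the first `k` entries; `g` sends an element of `A` to the entry
of `x` that it comes from. Unlike `partialComposite`, it leaves the names of the elements of `A`
free, which makes it stable under bijections. -/
inductive IsPartialComposite (L : RightModule P) {r : ℕ} (x : L.obj (Fin r)) :
    ℕ → ∀ (A : Type) [Finite A], (A → Fin r) → L.obj A → Prop
  | zero {A : Type} [Finite A] (e : Fin r ≃ A) (g : A → Fin r) (hg : ∀ j, g (e j) = j) :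
      IsPartialComposite L x 0 A g (L.map e x)
  | succ {k : ℕ} {A J B : Type} [Finite A] [Finite J] [Finite B] {g : A → Fin r} {S : L.obj A}
      (h : IsPartialComposite L x k A g S) (u : A) (hu : (g u : ℕ) = k) (p : P.obj J)
      (e : Graft u J ≃ B) (g' : B → Fin r) (hg' : ∀ s, g' (e s) = graftMap g u s) :
      IsPartialComposite L x (k + 1) B g' (L.map e (L.comp u S p))

section PartialComposite

variable {L : RightModule P} {r : ℕ} {x : L.obj (Fin r)}

theorem isPartialComposite_partialComposite {I : Type} [Finite I] (f : I → Fin r)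
    (q : ∀ k, P.obj (Block f k)) (k : ℕ) (hk : k ≤ r) :
    IsPartialComposite L x k (Stage f k) (stageMap f k) (L.partialComposite f x q k hk) := by
  induction k with
  | zero => exact .zero _ _ fun j => rfl
  | succ k ih => exact .succ (ih _) _ rfl _ _ _ (stageMap_stageSucc f k hk)

theorem partialComposite_congr {I : Type} [Finite I] (f : I → Fin r)
    {q q' : ∀ k, P.obj (Block f k)} (k : ℕ) (hk : k ≤ r)
    (h : ∀ j : Fin r, (j : ℕ) < k → q j = q' j) :
    L.partialComposite f x q k hk = L.partialComposite f x q' k hk := by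
  induction k with
  | zero => rfl
  | succ k ih =>
    rw [partialComposite, partialComposite, ih _ fun j hj => h j (hj.trans k.lt_succ_self),
      h ⟨k, hk⟩ k.lt_succ_self]

namespace IsPartialComposite

variable {k : ℕ} {A B J : Type} [Finite A] [Finite B] [Finite J] {g : A → Fin r} {S : L.obj A}

theorem eq_of_le (h : IsPartialComposite L x k A g S) : ∀ a b, g a = g b → k ≤ g a → a = b := by
  induction h with
  | zero e g hg =>
    intro a b hab _
    obtain ⟨a, rfl⟩ := e.surjective a
    obtain ⟨b, rfl⟩ := e.surjective b
    rw [hg, hg] at hab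
    rw [hab]
  | succ _ u hu _ e g' hg' ih =>
    intro a b hab hk
    obtain ⟨a, rfl⟩ := e.surjective a
    obtain ⟨b, rfl⟩ := e.surjective b
    rw [hg'] at hab hk
    rw [hg'] at hab
    rcases a with a | a
    · rcases b with b | b
      · have := ih a.1 b.1 hab (Nat.le_of_succ_le hk)
        rw [Subtype.ext this]
      · have hab : _ = _ := congrArg Fin.val hab
        simp only [graftMap, Sum.elim_inl, Sum.elim_inr] at hab hk
        omega
    · simp only [graftMap, Sum.elim_inr] at hk
      omega

theorem map (h : IsPartialComposite L x k A g S) (e : A ≃ B) (g' : B → Fin r)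
    (hg' : ∀ a, g' (e a) = g a) : IsPartialComposite L x k B g' (L.map e S) := by
  cases h with
  | zero e₀ _ hg =>
    rw [← L.map_trans]
    exact .zero _ _ fun j => by rw [Equiv.trans_apply, hg', hg]
  | succ h u hu p e₀ _ hg =>
    rw [← L.map_trans]
    exact .succ h u hu p _ _ fun s => by rw [Equiv.trans_apply, hg', hg]

theorem map_comp_mem_span {T : L.obj A}
    (hT : T ∈ Submodule.span K {S | IsPartialComposite L x k A g S}) (u : A) (hu : (g u : ℕ) = k)
    (p : P.obj J) (e : Graft u J ≃ B) (g' : B → Fin r) (hg' : ∀ s, g' (e s) = graftMap g u s) :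
    L.map e (L.comp u T p) ∈ Submodule.span K {S | IsPartialComposite L x (k + 1) B g' S} := by
  have hle : Submodule.span K {S | IsPartialComposite L x k A g S} ≤
      (Submodule.span K {S | IsPartialComposite L x (k + 1) B g' S}).comap
        ((L.map e).toFun ∘ₗ (L.comp u).flip p) :=
    Submodule.span_le.2 fun S hS => Submodule.subset_span (.succ hS u hu p e g' hg')
  exact hle hT

theorem comp_mem_span (h : IsPartialComposite L x k A g S) :
    ∀ (i : A), (g i : ℕ) < k → ∀ {J : Type} [Finite J] (q : P.obj J), L.comp i S q ∈
      Submodule.span K {S' | IsPartialComposite L x k (Graft i J) (graftMap g i) S'} := by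
  induction h with
  | zero _ _ _ => intro i hi; exact (Nat.not_lt_zero _ hi).elim
  | @succ k A J₀ B _ _ _ g S h u hu p e g' hg' ih =>
    intro i hi J _ q
    obtain ⟨i, rfl⟩ := e.surjective i
    rw [L.comp_map_left]
    rcases i with ⟨i, hiu⟩ | j
    · have hik : (g i : ℕ) < k := by
        have hi : (g i : ℕ) < k + 1 := by rwa [hg'] at hi
        have hne : (g i : ℕ) ≠ k := fun h' =>
          hiu (h.eq_of_le i u (Fin.ext (h'.trans hu.symm)) h'.ge)
        omega
      refine Submodule.mem_comap.1 (L.comp_inl_comp_mem (Ne.symm hiu) S (fun p q => ?_) p q)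
      rw [Submodule.mem_comap, ← L.map_trans]
      refine map_comp_mem_span (ih i hik q) (Sum.inl ⟨u, Ne.symm hiu⟩) hu p _ _ ?_
      rintro (⟨_ | _, _⟩ | _) <;> exact hg' _
    · rw [L.comp_inr_comp, ← L.map_trans]
      refine Submodule.subset_span (.succ h u hu _ _ _ ?_)
      rintro (_ | _ | _) <;> exact hg' _

theorem exists_eq_partialComposite (h : IsPartialComposite L x k A g S) (hk : k ≤ r)
    {I : Type} [Finite I] (f : I → Fin r) : ∀ (e : A ≃ Stage f k)
    (_ : ∀ a, stageMap f k (e a) = g a), ∃ q, L.map e S = L.partialComposite f x q k hk := by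
  induction h with
  | zero e₀ g hg =>
    intro e he
    refine ⟨fun _ => 0, ?_⟩
    rw [← L.map_trans, partialComposite]
    refine congrArg (fun e => L.map e x) (Equiv.ext fun j => ?_)
    refine (isPartialComposite_partialComposite (x := x) f (fun _ => 0) 0 hk).eq_of_le _ _ ?_
      (Nat.zero_le _)
    rw [Equiv.trans_apply, he, hg]
    rfl
  | @succ k A J B _ _ _ g S h u hu p e₀ g' hg' ih =>
    intro e he
    set Θ := (e₀.trans e).trans (stageSucc f k hk).symm with hΘ_def
    have hΘ s : graftMap (stageMap f k) (Sum.inr ⟨⟨k, hk⟩, le_rfl⟩) (Θ s) = graftMap g u s := by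
      rw [← stageMap_stageSucc, ← hg', ← he]
      simp [hΘ_def]
    obtain ⟨U, v, hU, hUg, hUv⟩ := exists_map_eq_of_graftMap_eq
      (fun a ha => h.eq_of_le a u ha (by rw [ha, hu]))
      (fun a ha => (isPartialComposite_partialComposite (x := x) f (fun _ => 0) k
        (Nat.le_of_succ_le hk)).eq_of_le a _ ha (by rw [ha]; exact le_rfl))
      (Fin.ext hu.symm : stageMap f k (Sum.inr ⟨⟨k, hk⟩, le_rfl⟩) = g u) Θ hΘ
    obtain ⟨q, hq⟩ := ih (Nat.le_of_succ_le hk) U hUg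
    refine ⟨Function.update q ⟨k, hk⟩ (P.map v p), ?_⟩
    rw [partialComposite, Function.update_self, partialComposite_congr (q' := q), ← hq,
      ← L.map_comp_of_map_eq U v hU Θ hUv, ← L.map_trans, ← L.map_trans]
    · refine congrArg (fun e => L.map e (L.comp u S p)) (Equiv.ext fun s => ?_)
      simp [hΘ_def]
    · exact fun j hj => Function.update_of_ne (fun h' => hj.ne (congrArg Fin.val h')) _ _

theorem exists_eq_composite (h : IsPartialComposite L x r A g S) :
    ∃ q, S = L.composite g x q := by
  obtain ⟨q, hq⟩ := h.exists_eq_partialComposite le_rfl g (stageEnd g).symm fun a => rfl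
  refine ⟨q, ?_⟩
  rw [composite, ← hq, ← L.map_trans, Equiv.symm_trans_self, L.map_refl]

end IsPartialComposite

theorem isPartialComposite_composite {I : Type} [Finite I] (f : I → Fin r)
    (q : ∀ k, P.obj (Block f k)) : IsPartialComposite L x r I f (L.composite f x q) := by
  refine (isPartialComposite_partialComposite f q r le_rfl).map _ _ ?_
  rintro (a | j)
  · rfl
  · exact (Nat.not_le_of_lt j.1.2 j.2).elim

end PartialComposite

end RightModule

namespace RightModule

variable {K : Type u} [CommRing K] {P : DGOperad.{u, v} K}

/-! ## Composites, decomposable elements and the filtration by the number of blocks -/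

section Composite

variable (L : RightModule P) {I : Type} [Finite I] {r : ℕ} (f : I → Fin r)

theorem partialComposite_add (x y : L.obj (Fin r)) (q : ∀ k, P.obj (Block f k)) (k : ℕ)
    (hk : k ≤ r) : L.partialComposite f (x + y) q k hk =
      L.partialComposite f x q k hk + L.partialComposite f y q k hk := by
  induction k with
  | zero => exact map_add _ _ _
  | succ k ih =>
    rw [partialComposite, ih, map_add, LinearMap.add_apply, map_add]; rfl

theorem partialComposite_smul (c : K) (x : L.obj (Fin r)) (q : ∀ k, P.obj (Block f k)) (k : ℕ)
    (hk : k ≤ r) : L.partialComposite f (c • x) q k hk = c • L.partialComposite f x q k hk := by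
  induction k with
  | zero => exact map_smul _ _ _
  | succ k ih =>
    rw [partialComposite, ih, map_smul, LinearMap.smul_apply, map_smul]; rfl

/-- The composite `x(q_1, …, q_r)` as a linear function of `x`. -/
def compositeLinear (q : ∀ k, P.obj (Block f k)) : L.obj (Fin r) →ₗ[K] L.obj I where
  toFun x := L.composite f x q
  map_add' x y := by rw [composite, partialComposite_add, map_add]; rfl
  map_smul' c x := by rw [composite, partialComposite_smul, map_smul]; rfl

theorem compositeLinear_apply (q : ∀ k, P.obj (Block f k)) (x : L.obj (Fin r)) :
    L.compositeLinear f q x = L.composite f x q := rfl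

theorem τ_comp {J : Type} [Finite J] (i : I) (x : L.obj I) (q : P.obj J) :
    (L.obj (Graft i J)).τ (L.comp i x q) = L.comp i ((L.obj I).τ x) ((P.obj J).τ q) := by
  have : (L.comp i).compr₂ (L.obj (Graft i J)).τ =
      (L.comp (J := J) i).compl₁₂ (L.obj I).τ (P.obj J).τ := by
    refine (L.obj I).hom_ext fun a x hx => (P.obj J).hom_ext fun b q hq => ?_
    rw [LinearMap.compr₂_apply, LinearMap.compl₁₂_apply,
      DGModule.τ_of_mem _ (L.comp_mem i a b x q hx hq), DGModule.τ_of_mem _ hx,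
      DGModule.τ_of_mem _ hq, map_smul, map_smul, LinearMap.smul_apply, smul_smul, pow_add,
      mul_comm]
  exact LinearMap.congr_fun₂ this x q

theorem δ_comp_τ {J : Type} [Finite J] (i : I) (x : L.obj I) (q : P.obj J) :
    (L.obj (Graft i J)).δ (L.comp i x q) =
      L.comp i ((L.obj I).δ x) q + L.comp i ((L.obj I).τ x) ((P.obj J).δ q) := by
  have : (L.comp i).compr₂ (L.obj (Graft i J)).δ =
      (L.comp (J := J) i) ∘ₗ (L.obj I).δ +
        (L.comp (J := J) i).compl₁₂ (L.obj I).τ (P.obj J).δ := by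
    refine (L.obj I).hom_ext fun a x hx => LinearMap.ext fun q => ?_
    rw [LinearMap.compr₂_apply, LinearMap.add_apply, LinearMap.add_apply,
      LinearMap.compl₁₂_apply, LinearMap.comp_apply,
      L.δ_comp i a x q hx, DGModule.τ_of_mem _ hx, map_smul, LinearMap.smul_apply]
  exact LinearMap.congr_fun₂ this x q

theorem τ_partialComposite (x : L.obj (Fin r)) (q : ∀ k, P.obj (Block f k)) (k : ℕ)
    (hk : k ≤ r) : (L.obj (Stage f k)).τ (L.partialComposite f x q k hk) =
      L.partialComposite f ((L.obj (Fin r)).τ x) (fun j => (P.obj (Block f j)).τ (q j)) k hk := by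
  induction k with
  | zero => exact ((L.map (stageZero f)).map_τ x).symm
  | succ k ih =>
    rw [partialComposite, ← DGModule.Hom.map_τ, τ_comp, ih]; rfl

theorem δ_partialComposite (x : L.obj (Fin r)) (q : ∀ k, P.obj (Block f k)) (k : ℕ)
    (hk : k ≤ r) : (L.obj (Stage f k)).δ (L.partialComposite f x q k hk) =
      L.partialComposite f ((L.obj (Fin r)).δ x) q k hk +
        ∑ j : Fin k, L.partialComposite f ((L.obj (Fin r)).τ x)
          (OddEnd.leibnizTerm (fun i => (P.obj (Block f i)).oddEnd) q (j.castLE hk)) k hk := by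
  induction k with
  | zero =>
    rw [Fin.sum_univ_zero, add_zero]
    exact ((L.map (stageZero f)).map_δ x).symm
  | succ k ih =>
    have hlast : ∀ j : Fin k, OddEnd.leibnizTerm (fun i => (P.obj (Block f i)).oddEnd) q
        (j.castSucc.castLE hk) ⟨k, hk⟩ = q ⟨k, hk⟩ := fun j => OddEnd.leibnizTerm_of_gt _ _ j.2
    have hself : OddEnd.leibnizTerm (fun i => (P.obj (Block f i)).oddEnd) q ⟨k, hk⟩ ⟨k, hk⟩ =
        (P.obj _).δ (q ⟨k, hk⟩) := OddEnd.leibnizTerm_self _ _ _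
    have hτ : L.partialComposite f ((L.obj (Fin r)).τ x) (OddEnd.leibnizTerm
        (fun i => (P.obj (Block f i)).oddEnd) q ⟨k, hk⟩) k (Nat.le_of_succ_le hk) =
          (L.obj (Stage f k)).τ (L.partialComposite f x q k (Nat.le_of_succ_le hk)) := by
      rw [τ_partialComposite]
      exact partialComposite_congr _ _ _ fun j hj => OddEnd.leibnizTerm_of_lt _ _ hj
    rw [Fin.sum_univ_castSucc]
    simp only [partialComposite, hlast]
    rw [← DGModule.Hom.map_δ, δ_comp_τ, ih]
    simp only [map_add, map_sum, LinearMap.add_apply, LinearMap.sum_apply, add_assoc]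
    rw [← hτ, ← hself]
    rfl

theorem δ_composite (x : L.obj (Fin r)) (q : ∀ k, P.obj (Block f k)) :
    (L.obj I).δ (L.composite f x q) = L.composite f ((L.obj (Fin r)).δ x) q +
      ∑ j, L.composite f ((L.obj (Fin r)).τ x)
        (OddEnd.leibnizTerm (fun i => (P.obj (Block f i)).oddEnd) q j) := by
  rw [composite, ← DGModule.Hom.map_δ, δ_partialComposite, map_add, map_sum]
  rfl

theorem Hom.map_composite {P' : DGOperad.{u, v} K} {ψ : P.Hom P'} {L : RightModule P}
    {L' : RightModule P'} (φ : L.Hom (L'.restrict ψ)) (x : L.obj (Fin r))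
    (q : ∀ k, P.obj (Block f k)) :
    φ.app I (L.composite f x q) =
      L'.composite f (φ.app (Fin r) x) fun k => ψ.app (Block f k) (q k) := by
  have key : ∀ k hk, φ.app (Stage f k) (L.partialComposite f x q k hk) =
      L'.partialComposite f (φ.app (Fin r) x) (fun k => ψ.app (Block f k) (q k)) k hk := by
    intro k hk
    induction k with
    | zero => exact φ.naturality _ _
    | succ k ih =>
      rw [partialComposite, φ.naturality, φ.map_comp, ih]; rfl
  rw [composite, φ.naturality, key]; rfl

end Composite

section Decomposables

variable (L : RightModule P) {A J : Type} [Finite A] [Finite J]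

/-- The span of the decomposable elements, the kernel of the projection onto the indecomposable
quotient. -/
abbrev decSpan (A : Type) [Finite A] : Submodule K (L.obj A) :=
  Submodule.span K (L.decomposables A)

theorem map_mem_decSpan {B : Type} [Finite B] (e : A ≃ B) {z : L.obj A} (hz : z ∈ L.decSpan A) :
    L.map e z ∈ L.decSpan B := by
  have : L.decSpan A ≤ (L.decSpan B).comap (L.map e).toFun :=
    Submodule.span_le.2 (L.map_decomposables e)
  exact this hz

theorem exists_comp_map_one (i : A) (w : Unit ≃ J) :
    ∃ e : A ≃ Graft i J, ∀ z, L.comp i z (P.map w P.one) = L.map e z := by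
  refine ⟨(graftUnit i).symm.trans (graftCongr (Equiv.refl A) w i), fun z => ?_⟩
  have comp_one_eq : L.comp i z P.one = L.map (graftUnit i).symm z := by
    conv_rhs => rw [← L.comp_one i z]
    rw [← L.map_trans, Equiv.self_trans_symm, L.map_refl]
  have naturality := L.comp_map (Equiv.refl A) w i z P.one
  rw [L.map_refl, comp_one_eq] at naturality
  exact naturality.trans (L.map_trans _ _ z).symm

theorem exists_eq_smul_map_one (hP : P.IsConnected) (w : Unit ≃ J) (q : P.obj J) :
    ∃ c : K, q = c • P.map w P.one := by
  obtain ⟨c, hc⟩ := hP.one.2 (P.map w.symm q)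
  refine ⟨c, ?_⟩
  have := congrArg (P.map w).toFun hc
  rw [← P.map_trans, Equiv.symm_trans_self, P.map_refl, map_smul] at this
  exact this.symm

theorem comp_mem_decSpan (hP : P.IsConnected) (i : A) {z : L.obj A} (hz : z ∈ L.decSpan A)
    (q : P.obj J) : L.comp i z q ∈ L.decSpan (Graft i J) := by
  rcases isEmpty_or_nonempty J with h | h
  · have := hP.zero.subsingleton J
    rw [Subsingleton.elim q 0, map_zero]
    exact Submodule.zero_mem _
  rcases subsingleton_or_nontrivial J with h' | h'
  · have : Unique J := (unique_iff_subsingleton_and_nonempty J).2 ⟨h', h⟩ |>.some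
    obtain ⟨c, rfl⟩ := exists_eq_smul_map_one hP (Equiv.ofUnique Unit J) q
    obtain ⟨e, he⟩ := L.exists_comp_map_one i (Equiv.ofUnique Unit J)
    rw [map_smul, he]
    exact Submodule.smul_mem _ _ (L.map_mem_decSpan e hz)
  · rw [← L.map_refl (L.comp i z q)]
    exact L.comp_mem_span_decomposables i _ z q

theorem composite_mem_decSpan (hP : P.IsConnected) {r : ℕ} (f : A → Fin r)
    (hr : r < Nat.card A) (x : L.obj (Fin r)) (q : ∀ k, P.obj (Block f k)) :
    L.composite f x q ∈ L.decSpan A := by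
  have partialComposite_mem : ∀ k hk, (∃ j : Fin r, (j : ℕ) < k ∧ Nontrivial (Block f j)) →
      L.partialComposite f x q k hk ∈ L.decSpan (Stage f k) := by
    intro k hk
    induction k with
    | zero => rintro ⟨j, hj, -⟩; exact (Nat.not_lt_zero _ hj).elim
    | succ k ih =>
      rintro ⟨j, hj, hj'⟩
      rw [partialComposite]
      by_cases h : (j : ℕ) = k
      · obtain rfl : j = ⟨k, hk⟩ := Fin.ext h
        exact L.comp_mem_span_decomposables _ _ _ _
      · exact L.map_mem_decSpan _ (L.comp_mem_decSpan hP _ (ih _ ⟨j, by omega, hj'⟩) _)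
  refine L.map_mem_decSpan _ (partialComposite_mem r le_rfl ?_)
  by_contra! hsub
  have hinj : Function.Injective f := fun a b hab =>
    have := hsub (f b) (f b).2
    congrArg Subtype.val (Subsingleton.elim (⟨a, hab⟩ : Block f (f b)) ⟨b, rfl⟩)
  have := Nat.card_le_card_of_injective f hinj
  rw [Nat.card_fin] at this
  omega

end Decomposables

section Filtration

variable (L : RightModule P) {M : SigmaModule.{u, v} K}
  (ι : ∀ (I : Type) [Finite I], M.obj I →ₗ[K] L.obj I)

/-- The span of the composites `ι(x)(q_1, …, q_r)` with `r < s`: the `s`-th step of the filtration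
of `M ∘ P` by the number of blocks. -/
def blockFiltration (s : ℕ) (A : Type) [Finite A] : Submodule K (L.obj A) :=
  Submodule.span K {z | ∃ r < s, ∃ (f : A → Fin r) (x : M.obj (Fin r))
    (q : ∀ k, P.obj (Block f k)), z = L.composite f (ι (Fin r) x) q}

variable {A : Type} [Finite A] {r s : ℕ}

theorem composite_mem_blockFiltration (h : r < s) (f : A → Fin r)
    (x : M.obj (Fin r)) (q : ∀ k, P.obj (Block f k)) :
    L.composite f (ι (Fin r) x) q ∈ L.blockFiltration ι s A :=
  Submodule.subset_span ⟨r, h, f, x, q, rfl⟩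

variable (A) in
theorem blockFiltration_mono : Monotone fun s => L.blockFiltration ι s A := fun _ _ hst =>
  Submodule.span_mono fun _ ⟨r, hr, h⟩ => ⟨r, hr.trans_le hst, h⟩

variable (A) in
theorem blockFiltration_zero : L.blockFiltration ι 0 A = ⊥ :=
  eq_bot_iff.2 <| Submodule.span_le.2 fun _ ⟨_, hr, _⟩ => (Nat.not_lt_zero _ hr).elim

variable (A) in
theorem blockFiltration_one_eq_bot [Nonempty A] : L.blockFiltration ι 1 A = ⊥ := by
  refine eq_bot_iff.2 (Submodule.span_le.2 ?_)
  rintro _ ⟨r, hr, f, x, q, rfl⟩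
  obtain rfl : r = 0 := by omega
  exact (f (Classical.arbitrary A)).elim0

theorem map_mem_blockFiltration {B : Type} [Finite B] (e : A ≃ B) {z : L.obj A}
    (hz : z ∈ L.blockFiltration ι s A) : L.map e z ∈ L.blockFiltration ι s B := by
  have : L.blockFiltration ι s A ≤ (L.blockFiltration ι s B).comap (L.map e).toFun := by
    refine Submodule.span_le.2 ?_
    rintro _ ⟨r, hr, f, x, q, rfl⟩
    obtain ⟨q', hq'⟩ := ((isPartialComposite_composite f q).map e (fun b => f (e.symm b))
      fun a => by rw [e.symm_apply_apply]).exists_eq_composite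
    change L.map e _ ∈ L.blockFiltration ι s B
    rw [hq']
    exact L.composite_mem_blockFiltration ι hr _ x q'
  exact this hz

theorem comp_mem_blockFiltration {J : Type} [Finite J] (i : A) {z : L.obj A}
    (hz : z ∈ L.blockFiltration ι s A) (q : P.obj J) :
    L.comp i z q ∈ L.blockFiltration ι s (Graft i J) := by
  have : L.blockFiltration ι s A ≤
      (L.blockFiltration ι s (Graft i J)).comap ((L.comp i).flip q) := by
    refine Submodule.span_le.2 ?_
    rintro _ ⟨r, hr, f, x, q', rfl⟩
    change L.comp i _ q ∈ L.blockFiltration ι s (Graft i J)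
    refine Submodule.span_le.2 (fun S hS => ?_)
      ((isPartialComposite_composite f q').comp_mem_span i (f i).2 q)
    obtain ⟨q'', rfl⟩ := IsPartialComposite.exists_eq_composite hS
    exact L.composite_mem_blockFiltration ι hr _ x q''
  exact this hz

theorem composite_mem_blockFiltration_of_mem (f : A → Fin r) {z : L.obj (Fin r)}
    (hz : z ∈ L.blockFiltration ι s (Fin r)) (q : ∀ k, P.obj (Block f k)) :
    L.composite f z q ∈ L.blockFiltration ι s A := by
  have partialComposite_mem : ∀ k hk,
      L.partialComposite f z q k hk ∈ L.blockFiltration ι s (Stage f k) := by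
    intro k hk
    induction k with
    | zero => exact L.map_mem_blockFiltration ι _ hz
    | succ k ih =>
      exact L.map_mem_blockFiltration ι _ (L.comp_mem_blockFiltration ι _ (ih _) _)
  exact L.map_mem_blockFiltration ι _ (partialComposite_mem r le_rfl)

end Filtration

end RightModule

theorem blockTensor_induction {K : Type u} [CommRing K] {M N : SigmaModule.{u, v} K} {I : Type}
    [Finite I] {r : ℕ} {f : I → Fin r} {X : Type*} [AddCommGroup X] [Module K X]
    (α : BlockTensor M N f →ₗ[K] X) (S : Submodule K X)
    (h : ∀ x y, α (x ⊗ₜ PiTensorProduct.tprod K y) ∈ S) (t : BlockTensor M N f) : α t ∈ S := by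
  have : S.mkQ ∘ₗ α = 0 := blockTensor_ext fun x d y _ =>
    (Submodule.Quotient.mk_eq_zero S).2 (h x y)
  exact (Submodule.Quotient.mk_eq_zero S).1 (LinearMap.congr_fun this t)

/-- The canonical differential of the composition product, on the summand of `f`. -/
def blockDiff {K : Type u} [CommRing K] (M N : SigmaModule.{u, v} K) {I : Type} [Finite I] {r : ℕ}
    (f : I → Fin r) : OddEnd K (BlockTensor M N f) :=
  (M.obj (Fin r)).oddEnd.tensor (OddEnd.piTensor fun k => (N.obj (Block f k)).oddEnd)

theorem blockDiff_tmul {K : Type u} [CommRing K] (M N : SigmaModule.{u, v} K) {I : Type}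
    [Finite I] {r : ℕ} (f : I → Fin r) (x : M.obj (Fin r)) (y : ∀ k, N.obj (Block f k)) :
    (blockDiff M N f).δ (x ⊗ₜ PiTensorProduct.tprod K y) =
      (M.obj (Fin r)).δ x ⊗ₜ PiTensorProduct.tprod K y +
        ∑ j, (M.obj (Fin r)).τ x ⊗ₜ PiTensorProduct.tprod K
          (OddEnd.leibnizTerm (fun i => (N.obj (Block f i)).oddEnd) y j) := by
  rw [← TensorProduct.tmul_sum, ← OddEnd.piTensor_δ_tprod]
  rfl

namespace RightModule.IsQuasiFreeOn

/-! ## The decomposition of a quasi-free module -/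

variable {K : Type u} [CommRing K] {P : DGOperad.{u, v} K} {L : RightModule P}
  {M : SigmaModule.{u, v} K} {ι : ∀ (I : Type) [Finite I], M.obj I →ₗ[K] L.obj I}
  {I : Type} [Finite I] {r s : ℕ}

variable (I) in
/-- The isomorphism `M ∘ P ≃ L` of the free module structure. -/
def equiv (h : L.IsQuasiFreeOn M ι) : Composite M P.toSigmaModule I ≃ₗ[K] L.obj I :=
  (h.free I).choose

/-- The map `x ⊗ q_1 ⊗ ⋯ ⊗ q_r ↦ ι(x)(q_1, …, q_r)`. -/
def summand (h : L.IsQuasiFreeOn M ι) (f : I → Fin r) :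
    BlockTensor M P.toSigmaModule f →ₗ[K] L.obj I :=
  (h.equiv I).toLinearMap ∘ₗ toComposite M P.toSigmaModule f

theorem summand_tmul (h : L.IsQuasiFreeOn M ι) (f : I → Fin r) (x : M.obj (Fin r))
    (q : ∀ k, P.obj (Block f k)) :
    h.summand f (x ⊗ₜ PiTensorProduct.tprod K q) = L.composite f (ι (Fin r) x) q :=
  (h.free I).choose_spec r f x q

theorem summand_mem_blockFiltration (h : L.IsQuasiFreeOn M ι) (hr : r < s) (f : I → Fin r)
    (t : BlockTensor M P.toSigmaModule f) : h.summand f t ∈ L.blockFiltration ι s I :=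
  blockTensor_induction _ _ (fun x y => by
    rw [summand_tmul]
    exact L.composite_mem_blockFiltration ι hr f x y) t

/-- The projection onto the summand of a surjection. -/
def proj (h : L.IsQuasiFreeOn M ι) (g : I → Fin r) (hg : Function.Surjective g) :
    L.obj I →ₗ[K] BlockTensor M P.toSigmaModule g :=
  projection M P.toSigmaModule g hg ∘ₗ (h.equiv I).symm.toLinearMap

theorem proj_summand (h : L.IsQuasiFreeOn M ι) {g : I → Fin r} (hg : Function.Surjective g)
    (t : BlockTensor M P.toSigmaModule g) : h.proj g hg (h.summand g t) = t := by
  simp [proj, summand, projection_toComposite]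

theorem proj_summand_of_not (h : L.IsQuasiFreeOn M ι) {f : I → Fin r} {g : I → Fin s}
    (hg : Function.Surjective g) (hfg : ¬ ∃ v : Fin s ≃ Fin r, ∀ a, f a = v (g a))
    (t : BlockTensor M P.toSigmaModule f) : h.proj g hg (h.summand f t) = 0 := by
  simp [proj, summand, projection_toComposite_of_not _ _ hg hfg]

/-- The projection onto the summand of a partition. -/
def partProj (h : L.IsQuasiFreeOn M ι) (π : Setoid I) :
    L.obj I →ₗ[K] BlockTensor M P.toSigmaModule (blockMap π) :=
  h.proj (blockMap π) (blockMap_surjective π)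

theorem partProj_summand_of_ne (h : L.IsQuasiFreeOn M ι) {π π' : Setoid I} (hπ : π ≠ π')
    (t : BlockTensor M P.toSigmaModule (blockMap π')) :
    h.partProj π (h.summand (blockMap π') t) = 0 := by
  refine h.proj_summand_of_not _ ?_ t
  rintro ⟨v, hv⟩
  refine hπ ((eq_ker_of_equiv v hv).trans ?_)
  ext a b
  exact blockMap_eq_iff π' a b

theorem partProj_summand_of_blockCount_ne (h : L.IsQuasiFreeOn M ι) {π : Setoid I}
    (hr : r ≠ blockCount π) (f : I → Fin r) (t : BlockTensor M P.toSigmaModule f) :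
    h.partProj π (h.summand f t) = 0 := by
  refine h.proj_summand_of_not _ ?_ t
  rintro ⟨v, -⟩
  exact hr (by simpa using (Fintype.card_congr v).symm)

theorem sum_summand_partProj (h : L.IsQuasiFreeOn M ι) (hP : P.IsConnected) (z : L.obj I) :
    ∑ π : Setoid I, h.summand (blockMap π) (h.partProj π z) = z := by
  let S : Submodule K (Composite M P.toSigmaModule I) :=
    LinearMap.ker ((∑ π : Setoid I, h.summand (blockMap π) ∘ₗ h.partProj π - LinearMap.id) ∘ₗ
      (h.equiv I).toLinearMap)
  have hS : ∀ z, z ∈ S := composite_induction M P.toSigmaModule fun r f t => by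
    by_cases hf : Function.Surjective f
    · obtain ⟨v, hv⟩ := exists_equiv_blockMap hf
      rw [← toComposite_permuteSummand M P.toSigmaModule v hv t]
      generalize permuteSummand M P.toSigmaModule v hv t = t'
      rw [LinearMap.mem_ker, LinearMap.comp_apply, LinearMap.sub_apply, LinearMap.sum_apply,
        sub_eq_zero, Finset.sum_eq_single (Setoid.ker f)]
      · exact congrArg (h.summand _) (h.proj_summand _ t')
      · intro π _ hπ
        exact (congrArg (h.summand _) (h.partProj_summand_of_ne hπ t')).trans (map_zero _)
      · simp
    · rw [blockTensor_eq_zero M P.toSigmaModule hP.zero hf t, map_zero]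
      exact S.zero_mem
  have hz := hS ((h.equiv I).symm z)
  rw [LinearMap.mem_ker, LinearMap.comp_apply, LinearEquiv.coe_coe, LinearEquiv.apply_symm_apply,
    LinearMap.sub_apply, LinearMap.sum_apply, sub_eq_zero] at hz
  exact hz

theorem mem_blockFiltration_iff (h : L.IsQuasiFreeOn M ι) (hP : P.IsConnected) {z : L.obj I} :
    z ∈ L.blockFiltration ι s I ↔ ∀ π : Setoid I, s ≤ blockCount π → h.partProj π z = 0 := by
  constructor
  · intro hz π hπ
    have : L.blockFiltration ι s I ≤ LinearMap.ker (h.partProj π) := by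
      refine Submodule.span_le.2 ?_
      rintro _ ⟨r, hr, f, x, q, rfl⟩
      refine LinearMap.mem_ker.2 ?_
      rw [← h.summand_tmul]
      exact h.partProj_summand_of_blockCount_ne (by omega) _ _
    exact this hz
  · intro hz
    rw [← h.sum_summand_partProj hP z]
    refine Submodule.sum_mem _ fun π _ => ?_
    by_cases hπ : s ≤ blockCount π
    · rw [hz π hπ, map_zero]; exact Submodule.zero_mem _
    · exact h.summand_mem_blockFiltration (not_le.1 hπ) _ _

theorem exists_mem_blockFiltration_partProj_eq (h : L.IsQuasiFreeOn M ι) (s : ℕ)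
    (y : ∀ π : Setoid I, BlockTensor M P.toSigmaModule (blockMap π)) :
    ∃ z ∈ L.blockFiltration ι (s + 1) I, ∀ π, blockCount π = s → h.partProj π z = y π := by
  refine ⟨∑ π with blockCount π = s, h.summand (blockMap π) (y π),
    Submodule.sum_mem _ fun π hπ => h.summand_mem_blockFiltration
      (Nat.lt_succ_of_le (Finset.mem_filter.1 hπ).2.le) _ _, fun π hπ => ?_⟩
  rw [map_sum, Finset.sum_eq_single π]
  · exact h.proj_summand _ _
  · exact fun π' _ hπ' => h.partProj_summand_of_ne hπ'.symm _
  · simp [hπ]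

theorem blockFiltration_eq_top (h : L.IsQuasiFreeOn M ι) (hP : P.IsConnected)
    (hs : Nat.card I < s) : L.blockFiltration ι s I = ⊤ :=
  eq_top_iff.2 fun _ _ => (h.mem_blockFiltration_iff hP).2 fun π hπ =>
    absurd (blockCount_le π) (by omega)

variable (I) in
theorem decSpan_eq (h : L.IsQuasiFreeOn M ι) (hP : P.IsConnected) :
    L.decSpan I = L.blockFiltration ι (Nat.card I) I := by
  apply le_antisymm
  · refine Submodule.span_le.2 ?_
    rintro _ ⟨A, J, _, _, hJ, i, e, a, b, x, q, -, -, rfl⟩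
    refine L.map_mem_blockFiltration ι e (L.comp_mem_blockFiltration ι i ?_ q)
    have hcard : Nat.card A < Nat.card I := by
      have hA : Nat.card {x : A // x ≠ i} + 1 = Nat.card A := by
        classical
        rw [← Nat.card_congr (Equiv.optionSubtypeNe i), Finite.card_option]
      have hJ : 1 < Nat.card J := Finite.one_lt_card
      rw [← Nat.card_congr e, Nat.card_sum]
      omega
    have htop : L.blockFiltration ι (Nat.card I) A = ⊤ := h.blockFiltration_eq_top hP hcard
    exact htop ▸ Submodule.mem_top
  · refine Submodule.span_le.2 ?_
    rintro _ ⟨r, hr, f, x, q, rfl⟩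
    exact L.composite_mem_decSpan hP f hr _ q

theorem τ_ι (h : L.IsQuasiFreeOn M ι) (x : M.obj I) :
    (L.obj I).τ (ι I x) = ι I ((M.obj I).τ x) := by
  have : (L.obj I).τ ∘ₗ ι I = ι I ∘ₗ (M.obj I).τ := by
    refine (M.obj I).hom_ext fun d x hx => ?_
    rw [LinearMap.comp_apply, LinearMap.comp_apply, DGModule.τ_of_mem _ hx,
      DGModule.τ_of_mem _ (h.map_gr _ d x hx), map_smul]
  exact LinearMap.congr_fun this x

theorem δ_ι_sub_mem (h : L.IsQuasiFreeOn M ι) (hP : P.IsConnected) (x : M.obj I) :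
    (L.obj I).δ (ι I x) - ι I ((M.obj I).δ x) ∈ L.blockFiltration ι (Nat.card I) I :=
  h.decSpan_eq I hP ▸ h.twist I x

theorem δ_summand_sub_mem (h : L.IsQuasiFreeOn M ι) (hP : P.IsConnected) (f : I → Fin r)
    (t : BlockTensor M P.toSigmaModule f) :
    (L.obj I).δ (h.summand f t) - h.summand f ((blockDiff M P.toSigmaModule f).δ t) ∈
      L.blockFiltration ι r I := by
  refine blockTensor_induction ((L.obj I).δ ∘ₗ h.summand f -
    h.summand f ∘ₗ (blockDiff M P.toSigmaModule f).δ) _ (fun x q => ?_) t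
  have htwist := h.δ_ι_sub_mem hP x
  rw [Nat.card_fin] at htwist
  rw [LinearMap.sub_apply, LinearMap.comp_apply, LinearMap.comp_apply, summand_tmul,
    blockDiff_tmul, map_add, map_sum, summand_tmul, δ_composite, h.τ_ι]
  simp only [summand_tmul]
  rw [add_sub_add_right_eq_sub, ← compositeLinear_apply, ← compositeLinear_apply, ← map_sub]
  exact L.composite_mem_blockFiltration_of_mem ι f htwist q

theorem δ_mem_blockFiltration (h : L.IsQuasiFreeOn M ι) (hP : P.IsConnected) {z : L.obj I}
    (hz : z ∈ L.blockFiltration ι s I) : (L.obj I).δ z ∈ L.blockFiltration ι s I := by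
  have : L.blockFiltration ι s I ≤ (L.blockFiltration ι s I).comap (L.obj I).δ := by
    refine Submodule.span_le.2 ?_
    rintro _ ⟨r, hr, f, x, q, rfl⟩
    rw [← h.summand_tmul]
    exact (Submodule.sub_mem_iff_left _ (h.summand_mem_blockFiltration hr f _)).1
      (L.blockFiltration_mono ι I hr.le (h.δ_summand_sub_mem hP f _))
  exact this hz

theorem partProj_δ (h : L.IsQuasiFreeOn M ι) (hP : P.IsConnected) {z : L.obj I} {π : Setoid I}
    (hz : z ∈ L.blockFiltration ι (blockCount π + 1) I) :
    h.partProj π ((L.obj I).δ z) =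
      (blockDiff M P.toSigmaModule (blockMap π)).δ (h.partProj π z) := by
  have partProj_δ_summand : ∀ (π' : Setoid I) (t : BlockTensor M P.toSigmaModule (blockMap π')),
      blockCount π' ≤ blockCount π → h.partProj π ((L.obj I).δ (h.summand (blockMap π') t)) =
        h.partProj π
          (h.summand (blockMap π') ((blockDiff M P.toSigmaModule (blockMap π')).δ t)) := by
    intro π' t hπ'
    rw [← sub_eq_zero, ← map_sub]
    exact (h.mem_blockFiltration_iff hP).1
      (L.blockFiltration_mono ι I hπ' (h.δ_summand_sub_mem hP _ t)) π le_rfl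
  conv_lhs => rw [← h.sum_summand_partProj hP z]
  rw [map_sum, map_sum, Finset.sum_eq_single π]
  · rw [partProj_δ_summand π _ le_rfl]
    exact h.proj_summand _ _
  · intro π' _ hπ'
    by_cases hc : blockCount π' ≤ blockCount π
    · rw [partProj_δ_summand π' _ hc, h.partProj_summand_of_ne hπ'.symm]
    · rw [(h.mem_blockFiltration_iff hP).1 hz π' (by omega), map_zero, map_zero, map_zero]
  · simp

end RightModule.IsQuasiFreeOn

theorem eq_zero_of_tmul_tprod_eq_zero {K : Type u} [CommRing K] {κ X : Type*} [Finite κ]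
    [AddCommGroup X] [Module K X] {V : κ → Type*} [∀ i, AddCommGroup (V i)]
    [∀ i, Module K (V i)] {x : X} {y : ∀ i, V i} (c : ∀ i, V i →ₗ[K] K)
    (hc : ∀ i, c i (y i) = 1) (h : x ⊗ₜ[K] PiTensorProduct.tprod K y = 0) : x = 0 := by
  have := Fintype.ofFinite κ
  have := congrArg ((TensorProduct.rid K X).toLinearMap ∘ₗ TensorProduct.map LinearMap.id
    (PiTensorProduct.lift ((MultilinearMap.mkPiAlgebra K κ K).compLinearMap c))) h
  simpa [hc] using this

theorem apply_eq_zero_of_tmul_tprod_eq_zero {K : Type u} [CommRing K] {κ X : Type*} [Subsingleton κ]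
    [AddCommGroup X] [Module K X] {V : κ → Type*} [∀ i, AddCommGroup (V i)]
    [∀ i, Module K (V i)] {x : X} {y : ∀ i, V i} (c : X →ₗ[K] K) (hc : c x = 1)
    (h : x ⊗ₜ[K] PiTensorProduct.tprod K y = 0) (i : κ) : y i = 0 := by
  have := congrArg ((TensorProduct.lid K _).toLinearMap ∘ₗ
    TensorProduct.map c (PiTensorProduct.subsingletonEquiv (s := V) i).toLinearMap) h
  simpa [hc] using this

namespace DGModule

variable {K : Type u} [CommRing K] {V W : DGModule.{u, v} K}

theorem Hom.map_component (f : Hom V W) (d : ℕ) (x : V) :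
    f (V.component d x) = W.component d (f x) := by
  have : f.toFun ∘ₗ V.component d = W.component d ∘ₗ f.toFun := by
    refine V.hom_ext fun e x hx => ?_
    simp only [LinearMap.comp_apply]
    by_cases h : e = d
    · subst h
      rw [V.component_same e x hx, W.component_same e _ (f.map_gr e x hx)]
    · rw [V.component_ne d e h x hx, W.component_ne d e h _ (f.map_gr e x hx), map_zero]
  exact LinearMap.congr_fun this x

theorem Hom.mem_gr_of_injective {f : Hom V W} (hf : Function.Injective f.toFun) {d : ℕ} {x : V}
    (hx : f x ∈ W.gr d) : x ∈ V.gr d := by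
  have : V.component d x = x := hf ((f.map_component d x).trans (W.component_same d _ hx))
  exact this ▸ V.component_mem d x

theorem IsGroundRing.of_bijective (hW : W.IsGroundRing) {f : Hom V W}
    (hf : Function.Bijective f.toFun) : V.IsGroundRing := by
  obtain ⟨u, hu, hb⟩ := hW
  obtain ⟨m, rfl⟩ := hf.2 u
  refine ⟨m, Hom.mem_gr_of_injective hf.1 hu, (Function.Bijective.of_comp_iff' hf _).1 ?_⟩
  simpa only [Function.comp_def, map_smul] using hb

end DGModule

theorem nonempty_unit_equiv_block_bot {A : Type} [Finite A] (k : Fin (blockCount (⊥ : Setoid A))) :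
    Nonempty (Unit ≃ Block (blockMap (⊥ : Setoid A)) k) := by
  obtain ⟨a, ha⟩ := blockMap_surjective (⊥ : Setoid A) k
  have : Unique (Block (blockMap (⊥ : Setoid A)) k) :=
    ⟨⟨⟨a, ha⟩⟩, fun b => Subtype.ext ((blockMap_eq_iff ⊥ _ _).1 (b.2.trans ha.symm))⟩
  exact ⟨Equiv.ofUnique _ _⟩

namespace RightModule

variable {K : Type u} [CommRing K] {P : DGOperad.{u, v} K}

/-! ## Generators and indecomposables -/

theorem exists_composite_map_one (L : RightModule P) {I : Type} [Finite I] {r : ℕ} (f : I → Fin r)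
    (w : ∀ k, Unit ≃ Block f k) : ∃ e : Fin r ≃ I, ∀ y,
      L.composite f y (fun k => P.map (w k) P.one) = L.map e y := by
  have exists_partialComposite : ∀ k hk, ∃ e : Fin r ≃ Stage f k, ∀ y,
      L.partialComposite f y (fun k => P.map (w k) P.one) k hk = L.map e y := by
    intro k hk
    induction k with
    | zero => exact ⟨stageZero f, fun y => rfl⟩
    | succ k ih =>
      obtain ⟨e, he⟩ := ih (Nat.le_of_succ_le hk)
      obtain ⟨e', he'⟩ := L.exists_comp_map_one
        (Sum.inr ⟨⟨k, hk⟩, le_rfl⟩ : Stage f k) (w ⟨k, hk⟩)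
      refine ⟨(e.trans e').trans (stageSucc f k hk), fun y => ?_⟩
      rw [partialComposite, he, he', L.map_trans, L.map_trans]
  obtain ⟨e, he⟩ := exists_partialComposite r le_rfl
  exact ⟨e.trans (stageEnd f), fun y => by rw [composite, he, L.map_trans]⟩

namespace IsQuasiFreeOn

variable {L : RightModule P} {M : SigmaModule.{u, v} K}
  {ι : ∀ (I : Type) [Finite I], M.obj I →ₗ[K] L.obj I} {A : Type} [Finite A]

theorem summand_bot_mem_range (h : L.IsQuasiFreeOn M ι) (hP : P.IsConnected)
    (t : BlockTensor M P.toSigmaModule (blockMap (⊥ : Setoid A))) :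
    h.summand (blockMap ⊥) t ∈ LinearMap.range (ι A) := by
  let w := fun k : Fin (blockCount (⊥ : Setoid A)) => (nonempty_unit_equiv_block_bot k).some
  obtain ⟨e, he⟩ := L.exists_composite_map_one (blockMap ⊥) w
  refine blockTensor_induction _ _ (fun x q => ?_) t
  choose c hc using fun k => exists_eq_smul_map_one hP (w k) (q k)
  rw [show q = fun k => c k • P.map (w k) P.one from funext hc, MultilinearMap.map_smul_univ,
    TensorProduct.tmul_smul, map_smul, summand_tmul, he, ← h.naturality]
  exact Submodule.smul_mem _ _ ⟨_, rfl⟩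

theorem eq_zero_of_partProj_bot_eq_zero (h : L.IsQuasiFreeOn M ι) (hP : P.IsConnected)
    {x : M.obj A} (hx : h.partProj ⊥ (ι A x) = 0) : x = 0 := by
  let w := fun k : Fin (blockCount (⊥ : Setoid A)) => (nonempty_unit_equiv_block_bot k).some
  obtain ⟨e, he⟩ := L.exists_composite_map_one (blockMap ⊥) w
  let c : K ≃ₗ[K] P.obj Unit :=
    LinearEquiv.ofBijective (LinearMap.toSpanSingleton K _ P.one) hP.one
  have c_symm_one : c.symm P.one = 1 := c.symm_apply_eq.2 (one_smul K _).symm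
  have ι_eq_summand : ι A x = h.summand (blockMap ⊥)
      (M.map e.symm x ⊗ₜ PiTensorProduct.tprod K fun k => P.map (w k) P.one) := by
    rw [summand_tmul, he, ← h.naturality, ← M.map_trans, Equiv.symm_trans_self, M.map_refl]
  rw [ι_eq_summand, partProj, proj_summand] at hx
  have map_x_eq_zero := eq_zero_of_tmul_tprod_eq_zero
    (fun k => c.symm.toLinearMap ∘ₗ (P.map (w k).symm).toFun) (fun k => by
      rw [LinearMap.comp_apply, ← P.map_trans, Equiv.self_trans_symm, P.map_refl]
      exact c_symm_one) hx
  rw [← M.map_refl x, ← Equiv.symm_trans_self e, M.map_trans, map_x_eq_zero]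
  exact map_zero _

theorem sub_summand_partProj_bot_mem (h : L.IsQuasiFreeOn M ι) (hP : P.IsConnected)
    (z : L.obj A) : z - h.summand (blockMap ⊥) (h.partProj ⊥ z) ∈ L.decSpan A := by
  classical
  have hsum := h.sum_summand_partProj hP z
  rw [← Finset.add_sum_erase _ _ (Finset.mem_univ (⊥ : Setoid A))] at hsum
  rw [sub_eq_of_eq_add' hsum.symm, h.decSpan_eq A hP]
  refine Submodule.sum_mem _ fun π hπ => h.summand_mem_blockFiltration ?_ _ _
  exact (blockCount_le π).lt_of_ne fun hc =>
    Finset.ne_of_mem_erase hπ ((blockCount_eq_card_iff π).1 hc)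

variable (A) in
/-- The morphism from the generators to the indecomposable quotient. -/
def toIndecomposables (h : L.IsQuasiFreeOn M ι) : (M.obj A).Hom (L.indecomposables.obj A) where
  toFun := (L.decSpan A).mkQ ∘ₗ ι A
  map_gr d x hx := ⟨ι A x, h.map_gr A d x hx, rfl⟩
  map_δ x := ((Submodule.Quotient.eq (L.decSpan A)).2 (h.twist A x)).symm

variable (A) in
theorem bijective_toIndecomposables (h : L.IsQuasiFreeOn M ι) (hP : P.IsConnected) :
    Function.Bijective (h.toIndecomposables A).toFun := by
  constructor
  · rw [injective_iff_map_eq_zero]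
    intro x hx
    have ι_mem : ι A x ∈ L.decSpan A := (Submodule.Quotient.mk_eq_zero _).1 hx
    rw [h.decSpan_eq A hP, h.mem_blockFiltration_iff hP] at ι_mem
    exact h.eq_zero_of_partProj_bot_eq_zero hP
      (ι_mem ⊥ ((blockCount_eq_card_iff (⊥ : Setoid A)).2 rfl).ge)
  · intro z
    obtain ⟨z, rfl⟩ := Submodule.Quotient.mk_surjective _ z
    obtain ⟨x, hx⟩ := h.summand_bot_mem_range hP (h.partProj ⊥ z)
    refine ⟨x, ((Submodule.Quotient.eq (L.decSpan A)).2 ?_).symm⟩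
    rw [hx]
    exact h.sub_summand_partProj_bot_mem hP z

variable (A) in
/-- The isomorphism `M ≃ L̄` from the generators to the indecomposable quotient. -/
def indecomposablesEquiv (h : L.IsQuasiFreeOn M ι) (hP : P.IsConnected) :
    M.obj A ≃ₗ[K] L.indecomposables.obj A :=
  LinearEquiv.ofBijective _ (h.bijective_toIndecomposables A hP)

theorem isHom_indecomposablesEquiv (h : L.IsQuasiFreeOn M ι) (hP : P.IsConnected) :
    (M.obj A).oddEnd.IsHom (L.indecomposables.obj A).oddEnd (h.indecomposablesEquiv A hP) :=
  (h.toIndecomposables A).isHom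

theorem groundRingInArityOne (h : L.IsQuasiFreeOn M ι) (hP : P.IsConnected)
    (hL : L.indecomposables.GroundRingInArityOne) : M.GroundRingInArityOne :=
  DGModule.IsGroundRing.of_bijective hL (h.bijective_toIndecomposables Unit hP)

end IsQuasiFreeOn

/-! ## The operad in the second stage of the filtration -/

section UnaryComp

variable {L : RightModule P} {A : Type} [Finite A]

/-- The only block of a decomposition with one block. -/
def blockConst (A : Type) (k : Fin 1) : A ≃ Block (fun _ : A => (0 : Fin 1)) k :=
  (Equiv.subtypeUnivEquiv fun _ => Subsingleton.elim _ _).symm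

variable (L A) in
/-- The map `p ↦ x(p)` defined by an element `x` of arity one. -/
def unaryComp (x : L.obj Unit) : P.obj A →ₗ[K] L.obj A :=
  (L.map (unitGraft A)).toFun ∘ₗ L.comp () x

theorem unaryComp_eq_composite (x : L.obj Unit) (p : P.obj A) :
    L.unaryComp A x p = L.composite (fun _ => (0 : Fin 1))
      (L.map (Equiv.ofUnique Unit (Fin 1)) x) fun k => P.map (blockConst A k) p := by
  let f : A → Fin 1 := fun _ => 0
  let i : Stage f 0 := Sum.inr ⟨⟨0, Nat.one_pos⟩, le_rfl⟩
  let U : Unit ≃ Stage f 0 := (Equiv.ofUnique Unit (Fin 1)).trans (stageZero f)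
  let e : Graft () A ≃ Graft i (Block f ⟨0, Nat.one_pos⟩) := graftCongr U (blockConst A _) ()
  have comp_eq : L.comp i (L.map (stageZero f) (L.map (Equiv.ofUnique Unit (Fin 1)) x))
      (P.map (blockConst A _) p) = L.map e (L.comp () x p) := by
    rw [← L.map_trans]
    refine (L.map_comp_of_map_eq U (blockConst A _) rfl e ?_ x p).symm
    rintro (a | a)
    · exact (a.2 rfl).elim
    · rfl
  rw [composite, partialComposite, partialComposite, comp_eq, ← L.map_trans, ← L.map_trans]
  refine congrArg (fun e => L.map e (L.comp () x p)) (Equiv.ext ?_)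
  rintro (a | a)
  · exact (a.2 rfl).elim
  · rfl

theorem δ_unaryComp {x : L.obj Unit} (hx : x ∈ (L.obj Unit).gr 0) (p : P.obj A) :
    (L.obj A).δ (L.unaryComp A x p) = L.unaryComp A x ((P.obj A).δ p) := by
  refine ((L.map (unitGraft A)).map_δ _).symm.trans (congrArg (L.map (unitGraft A)).toFun ?_)
  rw [L.δ_comp () 0 _ p hx, DGModule.δ_zero _ _ hx]
  simp

namespace IsQuasiFreeOn

variable {M : SigmaModule.{u, v} K} {ι : ∀ (I : Type) [Finite I], M.obj I →ₗ[K] L.obj I}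

theorem unaryComp_ι (h : L.IsQuasiFreeOn M ι) (m : M.obj Unit) (p : P.obj A) :
    L.unaryComp A (ι Unit m) p = L.composite (fun _ => (0 : Fin 1))
      (ι (Fin 1) (M.map (Equiv.ofUnique Unit (Fin 1)) m)) fun k => P.map (blockConst A k) p := by
  rw [unaryComp_eq_composite, h.naturality]

theorem injective_unaryComp (h : L.IsQuasiFreeOn M ι) {m : M.obj Unit}
    (hm : Function.Bijective fun k : K => k • m) [Nonempty A] :
    Function.Injective (L.unaryComp A (ι Unit m)) := by
  rw [injective_iff_map_eq_zero]
  intro p hp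
  have hsurj : Function.Surjective fun _ : A => (0 : Fin 1) :=
    fun k => ⟨Classical.arbitrary A, Subsingleton.elim _ _⟩
  let c : K ≃ₗ[K] M.obj Unit := LinearEquiv.ofBijective (LinearMap.toSpanSingleton K _ m) hm
  have c_symm_m : c.symm m = 1 := c.symm_apply_eq.2 (one_smul K _).symm
  have tmul_eq_zero := congrArg (h.proj _ hsurj) hp
  rw [map_zero, h.unaryComp_ι, ← h.summand_tmul, h.proj_summand] at tmul_eq_zero
  have map_p_eq_zero : P.map (blockConst A 0) p = 0 := apply_eq_zero_of_tmul_tprod_eq_zero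
    (c.symm.toLinearMap ∘ₗ (M.map (Equiv.ofUnique (Fin 1) Unit)).toFun)
    (by
      rw [LinearMap.comp_apply, ← M.map_trans]
      exact (congrArg c.symm (M.map_refl m)).trans c_symm_m) tmul_eq_zero 0
  rw [← P.map_refl p, ← Equiv.self_trans_symm (blockConst A 0), P.map_trans, map_p_eq_zero]
  exact map_zero _

theorem blockFiltration_two_eq_range (h : L.IsQuasiFreeOn M ι) {m : M.obj Unit}
    (hm : Function.Surjective fun k : K => k • m) [Nonempty A] :
    L.blockFiltration ι 2 A = LinearMap.range (L.unaryComp A (ι Unit m)) := by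
  refine le_antisymm (Submodule.span_le.2 ?_) ?_
  · rintro _ ⟨r, hr, f, x, q, rfl⟩
    obtain rfl | rfl : r = 0 ∨ r = 1 := by omega
    · exact (f (Classical.arbitrary A)).elim0
    obtain rfl : f = fun _ => 0 := Subsingleton.elim _ _
    obtain ⟨c, hc⟩ := hm (M.map (Equiv.ofUnique (Fin 1) Unit) x)
    have hx : x = c • M.map (Equiv.ofUnique Unit (Fin 1)) m := by
      rw [← map_smul, show c • m = _ from hc, ← M.map_trans]
      exact (M.map_refl x).symm.trans
        (congrArg (fun e => M.map e x) (Equiv.ext fun _ => Subsingleton.elim _ _))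
    have hq : q = fun k => P.map (blockConst A k) (P.map (blockConst A 0).symm (q 0)) := by
      funext k
      obtain rfl : k = 0 := Subsingleton.elim _ _
      rw [← P.map_trans, Equiv.symm_trans_self, P.map_refl]
    refine ⟨c • P.map (blockConst A 0).symm (q 0), ?_⟩
    rw [map_smul, h.unaryComp_ι, ← hq, hx, map_smul, ← compositeLinear_apply,
      ← compositeLinear_apply, map_smul]
  · rintro _ ⟨p, rfl⟩
    rw [h.unaryComp_ι]
    exact L.composite_mem_blockFiltration ι one_lt_two _ _ _

end IsQuasiFreeOn

end UnaryComp

end RightModule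

namespace RightModule

variable {K : Type u} [CommRing K] {P P' : DGOperad.{u, v} K} {ψ : P.Hom P'}
  {L : RightModule P} {L' : RightModule P'}

/-! ## Morphisms of quasi-free modules -/

section

variable (φ : L.Hom (L'.restrict ψ)) (A : Type) [Finite A]

/-- The linear map underlying a morphism of right modules over a morphism of operads, with values
in `L'` itself and not in its restriction of structure. -/
def Hom.linear : L.obj A →ₗ[K] L'.obj A := (φ.app A).toFun

theorem Hom.linear_δ (x : L.obj A) : φ.linear A ((L.obj A).δ x) = (L'.obj A).δ (φ.linear A x) :=
  (φ.app A).map_δ x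

/-- The differential of the mapping cone of a morphism of right modules. -/
abbrev Hom.coneδ : Module.End K (L'.obj A × L.obj A) :=
  coneDiff (L.obj A).δ (L'.obj A).δ (φ.linear A)

theorem Hom.coneδ_coneδ (x : L'.obj A × L.obj A) : φ.coneδ A (φ.coneδ A x) = 0 :=
  coneDiff_coneDiff (L.obj A).δ_δ (L'.obj A).δ_δ (φ.linear_δ A) x

theorem Hom.quasiIso_iff : (φ.app A).QuasiIso ↔ RelAcyclic (φ.coneδ A) ⊥ ⊤ :=
  (φ.app A).quasiIso_iff

theorem Hom.quasiIso_indecomposables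
    (h : RelAcyclic (φ.coneδ A) ((L'.decSpan A).prod (L.decSpan A)) ⊤) :
    (φ.indecomposables.app A).QuasiIso := by
  rw [DGModule.Hom.quasiIso_iff, coneAcyclic_iff]
  rintro ⟨w, v⟩ hwv
  obtain ⟨w, rfl⟩ := Submodule.Quotient.mk_surjective _ w
  obtain ⟨v, rfl⟩ := Submodule.Quotient.mk_surjective _ v
  obtain ⟨hw, hv⟩ := Prod.ext_iff.1 hwv
  obtain ⟨⟨y, z⟩, -, hy, hz⟩ := h (w, v) trivial
    ⟨(Submodule.Quotient.mk_eq_zero _).1 hw, (Submodule.Quotient.mk_eq_zero (L.decSpan A)).1 hv⟩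
  exact ⟨(Submodule.Quotient.mk y, Submodule.Quotient.mk z),
    Prod.ext ((Submodule.Quotient.eq (L'.decSpan A)).2 hy).symm
      ((Submodule.Quotient.eq (L.decSpan A)).2 hz).symm⟩

theorem Hom.linear_unaryComp (x : L.obj Unit) (p : P.obj A) :
    φ.linear A (L.unaryComp A x p) = L'.unaryComp A (φ.linear Unit x) (ψ.app A p) :=
  (φ.naturality _ _).trans (congrArg (L'.map (unitGraft A)).toFun (φ.map_comp _ _ _))

end

namespace IsQuasiFreeOn

variable {M M' : SigmaModule.{u, v} K} {ι : ∀ (I : Type) [Finite I], M.obj I →ₗ[K] L.obj I}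
  {ι' : ∀ (I : Type) [Finite I], M'.obj I →ₗ[K] L'.obj I} {A : Type} [Finite A] {r s : ℕ}

variable (A) in
/-- The map `M → M'` between the generators which corresponds to `φ̄ : L̄ → L̄'`. -/
def genMap (h : L.IsQuasiFreeOn M ι) (h' : L'.IsQuasiFreeOn M' ι') (hP' : P'.IsConnected)
    (φ : L.Hom (L'.restrict ψ)) : M.obj A →ₗ[K] M'.obj A :=
  (h'.indecomposablesEquiv A hP').symm.toLinearMap ∘ₗ (φ.indecomposables.app A).toFun ∘ₗ
    (h.toIndecomposables A).toFun

theorem toIndecomposables_genMap (h : L.IsQuasiFreeOn M ι) (h' : L'.IsQuasiFreeOn M' ι')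
    (hP' : P'.IsConnected) (φ : L.Hom (L'.restrict ψ)) (x : M.obj A) :
    h'.toIndecomposables A (h.genMap A h' hP' φ x) =
      φ.indecomposables.app A (h.toIndecomposables A x) :=
  (h'.indecomposablesEquiv A hP').apply_symm_apply _

theorem genMap_mem_gr (h : L.IsQuasiFreeOn M ι) (h' : L'.IsQuasiFreeOn M' ι')
    (hP' : P'.IsConnected) (φ : L.Hom (L'.restrict ψ)) {d : ℕ} {x : M.obj A}
    (hx : x ∈ (M.obj A).gr d) : h.genMap A h' hP' φ x ∈ (M'.obj A).gr d :=
  DGModule.Hom.mem_gr_of_injective (h'.bijective_toIndecomposables A hP').1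
    (h.toIndecomposables_genMap h' hP' φ x ▸
      (φ.indecomposables.app A).map_gr d _ ((h.toIndecomposables A).map_gr d x hx))

theorem linear_sub_genMap_mem (h : L.IsQuasiFreeOn M ι) (h' : L'.IsQuasiFreeOn M' ι')
    (hP' : P'.IsConnected) (φ : L.Hom (L'.restrict ψ)) (x : M.obj A) :
    φ.linear A (ι A x) - ι' A (h.genMap A h' hP' φ x) ∈
      L'.blockFiltration ι' (Nat.card A) A :=
  h'.decSpan_eq A hP' ▸ (Submodule.Quotient.eq (L'.decSpan A)).1
    (h.toIndecomposables_genMap h' hP' φ x).symm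

/-- The map `M(r) ⊗ P(J_1) ⊗ ⋯ ⊗ P(J_r) → M'(r) ⊗ P'(J_1) ⊗ ⋯ ⊗ P'(J_r)` induced by `φ̄` and
`ψ`. -/
def blockTensorMap (h : L.IsQuasiFreeOn M ι) (h' : L'.IsQuasiFreeOn M' ι') (hP' : P'.IsConnected)
    (φ : L.Hom (L'.restrict ψ)) (f : A → Fin r) :
    BlockTensor M P.toSigmaModule f →ₗ[K] BlockTensor M' P'.toSigmaModule f :=
  TensorProduct.map (h.genMap (Fin r) h' hP' φ)
    (PiTensorProduct.map fun k => (ψ.app (Block f k)).toFun)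

theorem linear_summand_sub_mem (h : L.IsQuasiFreeOn M ι) (h' : L'.IsQuasiFreeOn M' ι')
    (hP' : P'.IsConnected) (φ : L.Hom (L'.restrict ψ)) (f : A → Fin r)
    (t : BlockTensor M P.toSigmaModule f) :
    φ.linear A (h.summand f t) - h'.summand f (h.blockTensorMap h' hP' φ f t) ∈
      L'.blockFiltration ι' r A := by
  refine blockTensor_induction (φ.linear A ∘ₗ h.summand f -
    h'.summand f ∘ₗ h.blockTensorMap h' hP' φ f) _ (fun x q => ?_) t
  have hx := h.linear_sub_genMap_mem h' hP' φ x
  rw [Nat.card_fin] at hx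
  have linear_composite : φ.linear A (L.composite f (ι (Fin r) x) q) =
      L'.composite f (φ.linear (Fin r) (ι (Fin r) x)) fun k => ψ.app (Block f k) (q k) :=
    φ.map_composite f _ q
  rw [LinearMap.sub_apply, LinearMap.comp_apply, LinearMap.comp_apply, summand_tmul,
    blockTensorMap, TensorProduct.map_tmul, PiTensorProduct.map_tprod, summand_tmul,
    linear_composite, ← compositeLinear_apply, ← compositeLinear_apply, ← map_sub]
  exact L'.composite_mem_blockFiltration_of_mem ι' f hx _

theorem linear_mem_blockFiltration (h : L.IsQuasiFreeOn M ι) (h' : L'.IsQuasiFreeOn M' ι')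
    (hP' : P'.IsConnected) (φ : L.Hom (L'.restrict ψ)) {z : L.obj A}
    (hz : z ∈ L.blockFiltration ι s A) : φ.linear A z ∈ L'.blockFiltration ι' s A := by
  have : L.blockFiltration ι s A ≤ (L'.blockFiltration ι' s A).comap (φ.linear A) := by
    refine Submodule.span_le.2 ?_
    rintro _ ⟨r, hr, f, x, q, rfl⟩
    rw [← h.summand_tmul]
    exact (Submodule.sub_mem_iff_left _ (h'.summand_mem_blockFiltration hr f _)).1
      (L'.blockFiltration_mono ι' A hr.le (h.linear_summand_sub_mem h' hP' φ f _))
  exact this hz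

theorem partProj_linear (h : L.IsQuasiFreeOn M ι) (h' : L'.IsQuasiFreeOn M' ι')
    (hP : P.IsConnected) (hP' : P'.IsConnected) (φ : L.Hom (L'.restrict ψ)) {z : L.obj A}
    {π : Setoid A} (hz : z ∈ L.blockFiltration ι (blockCount π + 1) A) :
    h'.partProj π (φ.linear A z) = h.blockTensorMap h' hP' φ (blockMap π) (h.partProj π z) := by
  have partProj_linear_summand :
      ∀ (π' : Setoid A) (t : BlockTensor M P.toSigmaModule (blockMap π')),
        blockCount π' ≤ blockCount π →
        h'.partProj π (φ.linear A (h.summand (blockMap π') t)) =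
          h'.partProj π (h'.summand (blockMap π') (h.blockTensorMap h' hP' φ (blockMap π') t)) := by
    intro π' t hπ'
    rw [← sub_eq_zero, ← map_sub]
    exact (h'.mem_blockFiltration_iff hP').1
      (L'.blockFiltration_mono ι' A hπ' (h.linear_summand_sub_mem h' hP' φ _ t)) π le_rfl
  conv_lhs => rw [← h.sum_summand_partProj hP z]
  rw [map_sum, map_sum, Finset.sum_eq_single π]
  · rw [partProj_linear_summand π _ le_rfl]
    exact h'.proj_summand _ _
  · intro π' _ hπ'
    by_cases hc : blockCount π' ≤ blockCount π
    · rw [partProj_linear_summand π' _ hc, h'.partProj_summand_of_ne hπ'.symm]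
    · rw [(h.mem_blockFiltration_iff hP).1 hz π' (by omega), map_zero, map_zero, map_zero]
  · simp

end IsQuasiFreeOn

/-! ## The filtration of the mapping cone -/

section ConeFiltration

variable {M M' : SigmaModule.{u, v} K} (ι : ∀ (I : Type) [Finite I], M.obj I →ₗ[K] L.obj I)
  (ι' : ∀ (I : Type) [Finite I], M'.obj I →ₗ[K] L'.obj I) (A : Type) [Finite A]

/-- The filtration of the mapping cone of a morphism `L → L'` by the number of blocks. -/
def coneFiltration (s : ℕ) : Submodule K (L'.obj A × L.obj A) :=
  (L'.blockFiltration ι' s A).prod (L.blockFiltration ι s A)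

theorem coneFiltration_mono : Monotone (coneFiltration ι ι' A) := fun _ _ hst =>
  Submodule.prod_mono (L'.blockFiltration_mono ι' A hst) (L.blockFiltration_mono ι A hst)

theorem coneFiltration_zero : coneFiltration ι ι' A 0 = ⊥ := by
  rw [coneFiltration, blockFiltration_zero, blockFiltration_zero, Submodule.prod_bot]

end ConeFiltration

namespace IsQuasiFreeOn

variable {M M' : SigmaModule.{u, v} K} {ι : ∀ (I : Type) [Finite I], M.obj I →ₗ[K] L.obj I}
  {ι' : ∀ (I : Type) [Finite I], M'.obj I →ₗ[K] L'.obj I} {A : Type} [Finite A] {s : ℕ}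

variable (A) in
theorem coneFiltration_eq_top (h : L.IsQuasiFreeOn M ι) (h' : L'.IsQuasiFreeOn M' ι')
    (hP : P.IsConnected) (hP' : P'.IsConnected) :
    coneFiltration ι ι' A (Nat.card A + 1) = ⊤ := by
  rw [coneFiltration, h.blockFiltration_eq_top hP (Nat.lt_succ_self _),
    h'.blockFiltration_eq_top hP' (Nat.lt_succ_self _), Submodule.prod_top]

variable (A) in
theorem coneFiltration_card_eq (h : L.IsQuasiFreeOn M ι) (h' : L'.IsQuasiFreeOn M' ι')
    (hP : P.IsConnected) (hP' : P'.IsConnected) :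
    coneFiltration ι ι' A (Nat.card A) = (L'.decSpan A).prod (L.decSpan A) := by
  rw [coneFiltration, h.decSpan_eq A hP, h'.decSpan_eq A hP']

/-- The projection of the mapping cone onto the mapping cone of the summands of a partition. -/
def conePartProj (h : L.IsQuasiFreeOn M ι) (h' : L'.IsQuasiFreeOn M' ι') (π : Setoid A) :
    L'.obj A × L.obj A →ₗ[K] BlockTensor M' P'.toSigmaModule (blockMap π) ×
      BlockTensor M P.toSigmaModule (blockMap π) :=
  (h'.partProj π).prodMap (h.partProj π)

theorem mem_coneFiltration_iff (h : L.IsQuasiFreeOn M ι) (h' : L'.IsQuasiFreeOn M' ι')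
    (hP : P.IsConnected) (hP' : P'.IsConnected) {x : L'.obj A × L.obj A} :
    x ∈ coneFiltration ι ι' A s ↔ ∀ π, s ≤ blockCount π → h.conePartProj h' π x = 0 := by
  simp only [coneFiltration, Submodule.mem_prod, h.mem_blockFiltration_iff hP,
    h'.mem_blockFiltration_iff hP', ← forall_and, conePartProj, LinearMap.prodMap_apply,
    Prod.mk_eq_zero]

theorem coneδ_mem_coneFiltration (h : L.IsQuasiFreeOn M ι) (h' : L'.IsQuasiFreeOn M' ι')
    (hP : P.IsConnected) (hP' : P'.IsConnected) (φ : L.Hom (L'.restrict ψ))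
    {x : L'.obj A × L.obj A} (hx : x ∈ coneFiltration ι ι' A s) :
    φ.coneδ A x ∈ coneFiltration ι ι' A s :=
  ⟨Submodule.add_mem _ (h'.δ_mem_blockFiltration hP' hx.1)
    (h.linear_mem_blockFiltration h' hP' φ hx.2),
    Submodule.neg_mem _ (h.δ_mem_blockFiltration hP hx.2)⟩

theorem conePartProj_coneδ (h : L.IsQuasiFreeOn M ι) (h' : L'.IsQuasiFreeOn M' ι')
    (hP : P.IsConnected) (hP' : P'.IsConnected) (φ : L.Hom (L'.restrict ψ)) {π : Setoid A}
    {x : L'.obj A × L.obj A} (hx : x ∈ coneFiltration ι ι' A (blockCount π + 1)) :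
    h.conePartProj h' π (φ.coneδ A x) =
      coneDiff (blockDiff M P.toSigmaModule (blockMap π)).δ
        (blockDiff M' P'.toSigmaModule (blockMap π)).δ (h.blockTensorMap h' hP' φ (blockMap π))
        (h.conePartProj h' π x) := by
  simp only [conePartProj, coneDiff_apply, LinearMap.prodMap_apply, map_add, map_neg,
    h'.partProj_δ hP' hx.1, h.partProj_δ hP hx.2, h.partProj_linear h' hP hP' φ hx.2]

theorem exists_mem_coneFiltration_conePartProj_eq (h : L.IsQuasiFreeOn M ι)
    (h' : L'.IsQuasiFreeOn M' ι') (s : ℕ)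
    (y : ∀ π : Setoid A, BlockTensor M' P'.toSigmaModule (blockMap π) ×
      BlockTensor M P.toSigmaModule (blockMap π)) :
    ∃ x ∈ coneFiltration ι ι' A (s + 1), ∀ π, blockCount π = s → h.conePartProj h' π x = y π := by
  obtain ⟨w, hw, hwy⟩ := h'.exists_mem_blockFiltration_partProj_eq s fun π => (y π).1
  obtain ⟨v, hv, hvy⟩ := h.exists_mem_blockFiltration_partProj_eq s fun π => (y π).2
  exact ⟨(w, v), ⟨hw, hv⟩, fun π hπ => Prod.ext (hwy π hπ) (hvy π hπ)⟩

theorem relAcyclic_coneFiltration (h : L.IsQuasiFreeOn M ι) (h' : L'.IsQuasiFreeOn M' ι')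
    (hP : P.IsConnected) (hP' : P'.IsConnected) (φ : L.Hom (L'.restrict ψ))
    (hs : ∀ π : Setoid A, blockCount π = s →
      ConeAcyclic (blockDiff M P.toSigmaModule (blockMap π)).δ
        (blockDiff M' P'.toSigmaModule (blockMap π)).δ (h.blockTensorMap h' hP' φ (blockMap π))) :
    RelAcyclic (φ.coneδ A) (coneFiltration ι ι' A s) (coneFiltration ι ι' A (s + 1)) := by
  intro x hx hδx
  have exists_primitive : ∀ π : Setoid A, ∃ y, blockCount π = s →
      coneDiff (blockDiff M P.toSigmaModule (blockMap π)).δ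
        (blockDiff M' P'.toSigmaModule (blockMap π)).δ (h.blockTensorMap h' hP' φ (blockMap π)) y =
      h.conePartProj h' π x := by
    intro π
    by_cases hπ : blockCount π = s
    · obtain ⟨y, hy⟩ := coneAcyclic_iff.1 (hs π hπ) (h.conePartProj h' π x) (by
        rw [← h.conePartProj_coneδ h' hP hP' φ (by rwa [hπ])]
        exact (h.mem_coneFiltration_iff h' hP hP').1 hδx π hπ.ge)
      exact ⟨y, fun _ => hy⟩
    · exact ⟨0, fun hc => (hπ hc).elim⟩
  choose y hy using exists_primitive
  obtain ⟨z, hz, hzy⟩ := h.exists_mem_coneFiltration_conePartProj_eq h' s y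
  refine ⟨z, hz, (h.mem_coneFiltration_iff h' hP hP').2 fun π hπ => ?_⟩
  obtain hπ | hπ := hπ.eq_or_lt
  · rw [map_sub, h.conePartProj_coneδ h' hP hP' φ (by rwa [← hπ]), hzy π hπ.symm, hy π hπ.symm,
      sub_self]
  · exact (h.mem_coneFiltration_iff h' hP hP').1
      (Submodule.sub_mem _ hx (h.coneδ_mem_coneFiltration h' hP hP' φ hz)) π hπ

theorem coneAcyclic_blockTensorMap (h : L.IsQuasiFreeOn M ι) (h' : L'.IsQuasiFreeOn M' ι')
    (hP : P.IsConnected) (hP' : P'.IsConnected) (φ : L.Hom (L'.restrict ψ))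
    (projP : P.IsKProjective) (projP' : P'.IsKProjective)
    (projL : L.indecomposables.IsKProjective) (projL' : L'.indecomposables.IsKProjective)
    {r : ℕ} (f : A → Fin r) (hφ : (φ.indecomposables.app (Fin r)).QuasiIso)
    (hψ : ∀ k, (ψ.app (Block f k)).QuasiIso) :
    ConeAcyclic (blockDiff M P.toSigmaModule f).δ (blockDiff M' P'.toSigmaModule f).δ
      (h.blockTensorMap h' hP' φ f) := by
  have := projL (Fin r)
  have := projL' (Fin r)
  have genMap_homotopyEquiv : (M.obj (Fin r)).oddEnd.IsHomotopyEquiv (M'.obj (Fin r)).oddEnd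
      (h.genMap (Fin r) h' hP' φ) :=
    (h'.isHom_indecomposablesEquiv hP').symm.isHomotopyEquiv.comp
      (hφ.isHomotopyEquiv.comp (h.isHom_indecomposablesEquiv hP).isHomotopyEquiv)
  have ψ_homotopyEquiv (k : Fin r) : (P.obj (Block f k)).oddEnd.IsHomotopyEquiv
      (P'.obj (Block f k)).oddEnd (ψ.app (Block f k)).toFun :=
    have := projP (Block f k)
    have := projP' (Block f k)
    (hψ k).isHomotopyEquiv
  exact (genMap_homotopyEquiv.tensor (.piTensor ψ_homotopyEquiv)).coneAcyclic

theorem relAcyclic_coneFiltration_of_quasiIso (h : L.IsQuasiFreeOn M ι)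
    (h' : L'.IsQuasiFreeOn M' ι') (hP : P.IsConnected) (hP' : P'.IsConnected)
    (φ : L.Hom (L'.restrict ψ)) (projP : P.IsKProjective) (projP' : P'.IsKProjective)
    (projL : L.indecomposables.IsKProjective) (projL' : L'.indecomposables.IsKProjective)
    (hφ : (φ.indecomposables.app (Fin s)).QuasiIso)
    (hψ : ∀ f : A → Fin s, Function.Surjective f → ∀ k, (ψ.app (Block f k)).QuasiIso) :
    RelAcyclic (φ.coneδ A) (coneFiltration ι ι' A s) (coneFiltration ι ι' A (s + 1)) := by
  refine h.relAcyclic_coneFiltration h' hP hP' φ ?_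
  rintro π rfl
  exact h.coneAcyclic_blockTensorMap h' hP hP' φ projP projP' projL projL' _ hφ
    (hψ _ (blockMap_surjective π))

end IsQuasiFreeOn

end RightModule

namespace DGModule

variable {K : Type u} [CommRing K] {V W : DGModule.{u, v} K}

theorem IsGroundRing.δ_eq_zero (hV : V.IsGroundRing) (x : V) : V.δ x = 0 := by
  obtain ⟨u, hu, hb⟩ := hV
  obtain ⟨k, rfl⟩ := hb.2 x
  exact (map_smul _ _ _).trans (by rw [V.δ_zero u hu, smul_zero])

theorem Hom.QuasiIso.bijective_of_isGroundRing {f : Hom V W} (hf : f.QuasiIso)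
    (hV : V.IsGroundRing) (hW : W.IsGroundRing) : Function.Bijective f.toFun := by
  rw [quasiIso_iff, coneAcyclic_iff_injective_and_surjective f.map_δ] at hf
  obtain ⟨hinj, hsurj⟩ := hf
  refine ⟨(injective_iff_map_eq_zero _).2 fun v hv => ?_, fun w => ?_⟩
  · obtain ⟨u, rfl⟩ := hinj v (hV.δ_eq_zero v) ⟨0, by rw [map_zero, hv]⟩
    exact hV.δ_eq_zero u
  · obtain ⟨v, -, y, hy⟩ := hsurj w (hW.δ_eq_zero w)
    rw [hW.δ_eq_zero, eq_comm, sub_eq_zero] at hy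
    exact ⟨v, hy⟩

theorem Hom.quasiIso_of_subsingleton [Subsingleton V] [Subsingleton W] (f : Hom V W) :
    f.QuasiIso := by
  rw [quasiIso_iff, coneAcyclic_iff]
  exact fun _ _ => ⟨0, Subsingleton.elim _ _⟩

end DGModule

theorem card_block_lt {A : Type} [Finite A] {r : ℕ} {f : A → Fin r} (hf : Function.Surjective f)
    (hr : 2 ≤ r) (k : Fin r) : Nat.card (Block f k) < Nat.card A := by
  have : Nontrivial (Fin r) := Fin.nontrivial_iff_two_le.2 hr
  obtain ⟨l, hl⟩ := exists_ne k
  obtain ⟨a, rfl⟩ := hf l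
  exact Finite.card_subtype_lt (x := a) hl

namespace RightModule.IsQuasiFreeOn

variable {K : Type u} [CommRing K] {P P' : DGOperad.{u, v} K} {ψ : P.Hom P'}
  {L : RightModule P} {L' : RightModule P'} {M M' : SigmaModule.{u, v} K}
  {ι : ∀ (I : Type) [Finite I], M.obj I →ₗ[K] L.obj I}
  {ι' : ∀ (I : Type) [Finite I], M'.obj I →ₗ[K] L'.obj I}

/-! ## The comparison -/

theorem quasiIso (h : L.IsQuasiFreeOn M ι) (h' : L'.IsQuasiFreeOn M' ι')
    (hP : P.IsConnected) (hP' : P'.IsConnected) (φ : L.Hom (L'.restrict ψ))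
    (projP : P.IsKProjective) (projP' : P'.IsKProjective)
    (projL : L.indecomposables.IsKProjective) (projL' : L'.indecomposables.IsKProjective)
    (hψ : ψ.QuasiIso) (hφ : φ.indecomposables.QuasiIso) : φ.QuasiIso := by
  intro A _
  rw [Hom.quasiIso_iff, ← coneFiltration_zero ι ι' A, ← h.coneFiltration_eq_top A h' hP hP']
  exact .of_steps (φ.coneδ_coneδ A) (coneFiltration_mono ι ι' A) (Nat.zero_le _) fun s _ _ =>
    h.relAcyclic_coneFiltration_of_quasiIso h' hP hP' φ projP projP' projL projL' (hφ _)
      fun f _ k => hψ _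

theorem quasiIso_indecomposables (h : L.IsQuasiFreeOn M ι) (h' : L'.IsQuasiFreeOn M' ι')
    (hP : P.IsConnected) (hP' : P'.IsConnected) (φ : L.Hom (L'.restrict ψ))
    (projP : P.IsKProjective) (projP' : P'.IsKProjective)
    (projL : L.indecomposables.IsKProjective) (projL' : L'.indecomposables.IsKProjective)
    (hψ : ψ.QuasiIso) (hφ : φ.QuasiIso) : φ.indecomposables.QuasiIso := by
  intro A _
  induction hn : Nat.card A using Nat.strong_induction_on generalizing A with
  | _ n ih =>
    subst hn
    have lower : RelAcyclic (φ.coneδ A) ⊥ (coneFiltration ι ι' A (Nat.card A)) := by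
      rw [← coneFiltration_zero ι ι' A]
      exact .of_steps (φ.coneδ_coneδ A) (coneFiltration_mono ι ι' A) (Nat.zero_le _)
        fun s _ hs => h.relAcyclic_coneFiltration_of_quasiIso h' hP hP' φ projP projP' projL projL'
          (ih s hs (Fin s) (Nat.card_fin s)) fun f _ k => hψ _
    refine φ.quasiIso_indecomposables A (h.coneFiltration_card_eq A h' hP hP' ▸ ?_)
    exact .upper (φ.coneδ_coneδ A) bot_le le_top lower ((φ.quasiIso_iff A).1 (hφ A))

theorem quasiIso_operad_of_relAcyclic (h : L.IsQuasiFreeOn M ι) (h' : L'.IsQuasiFreeOn M' ι')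
    (hP : P.IsConnected) (hP' : P'.IsConnected) (φ : L.Hom (L'.restrict ψ))
    (hL : L.indecomposables.GroundRingInArityOne) (hL' : L'.indecomposables.GroundRingInArityOne)
    (hφ : (φ.indecomposables.app Unit).QuasiIso) (A : Type) [Finite A] [Nonempty A]
    (hA : RelAcyclic (φ.coneδ A) ⊥ (coneFiltration ι ι' A 2)) : (ψ.app A).QuasiIso := by
  obtain ⟨m, hm, hbm⟩ := h.groundRingInArityOne hP hL
  let m' := h.genMap Unit h' hP' φ m
  have hm' : m' ∈ (M'.obj Unit).gr 0 := h.genMap_mem_gr h' hP' φ hm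
  have hbm' : Function.Bijective fun k : K => k • m' := by
    have bijective_genMap : Function.Bijective (h.genMap Unit h' hP' φ) :=
      (h'.indecomposablesEquiv Unit hP').symm.bijective.comp
        ((hφ.bijective_of_isGroundRing hL hL').comp (h.bijective_toIndecomposables Unit hP))
    simpa only [Function.comp_def, map_smul] using bijective_genMap.comp hbm
  have linear_ι : φ.linear Unit (ι Unit m) = ι' Unit m' := by
    have := h.linear_sub_genMap_mem h' hP' φ m
    rwa [Nat.card_unique, blockFiltration_one_eq_bot, Submodule.mem_bot, sub_eq_zero] at this
  let j := (L'.unaryComp A (ι' Unit m')).prodMap (L.unaryComp A (ι Unit m))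
  have injective_j : Function.Injective j :=
    (h'.injective_unaryComp hbm').prodMap (h.injective_unaryComp hbm)
  have range_j : coneFiltration ι ι' A 2 = LinearMap.range j := by
    rw [coneFiltration, h'.blockFiltration_two_eq_range hbm'.2,
      h.blockFiltration_two_eq_range hbm.2, LinearMap.range_prodMap]
  rw [DGModule.Hom.quasiIso_iff]
  refine .of_injective injective_j (fun x => ?_) range_j hA
  simp only [j, coneDiff_apply, LinearMap.prodMap_apply, map_add, map_neg,
    δ_unaryComp (h'.map_gr Unit 0 m' hm'), δ_unaryComp (h.map_gr Unit 0 m hm),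
    φ.linear_unaryComp, linear_ι]

theorem quasiIso_operad (h : L.IsQuasiFreeOn M ι) (h' : L'.IsQuasiFreeOn M' ι')
    (hP : P.IsConnected) (hP' : P'.IsConnected) (φ : L.Hom (L'.restrict ψ))
    (projP : P.IsKProjective) (projP' : P'.IsKProjective)
    (projL : L.indecomposables.IsKProjective) (projL' : L'.indecomposables.IsKProjective)
    (hL : L.indecomposables.GroundRingInArityOne) (hL' : L'.indecomposables.GroundRingInArityOne)
    (hφ : φ.QuasiIso) (hφ' : φ.indecomposables.QuasiIso) : ψ.QuasiIso := by
  intro A _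
  induction hn : Nat.card A using Nat.strong_induction_on generalizing A with
  | _ n ih =>
    subst hn
    rcases isEmpty_or_nonempty A with hA | hA
    · have := hP.zero.subsingleton A
      have := hP'.zero.subsingleton A
      exact DGModule.Hom.quasiIso_of_subsingleton _
    have upper : RelAcyclic (φ.coneδ A) (coneFiltration ι ι' A 2) ⊤ := by
      rw [← h.coneFiltration_eq_top A h' hP hP']
      exact .of_steps (φ.coneδ_coneδ A) (coneFiltration_mono ι ι' A)
        (Nat.succ_le_succ Nat.card_pos) fun s hs _ =>
          h.relAcyclic_coneFiltration_of_quasiIso h' hP hP' φ projP projP' projL projL' (hφ' _)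
            fun f hf k => ih _ (card_block_lt hf hs k) _ rfl
    exact h.quasiIso_operad_of_relAcyclic h' hP hP' φ hL hL' (hφ' Unit) A
      (.lower (φ.coneδ_coneδ A) bot_le le_top upper ((φ.quasiIso_iff A).1 (hφ A)))

end RightModule.IsQuasiFreeOn

theorem SigmaModule.IsKProjective.of_isField {K : Type u} [CommRing K] (hK : IsField K)
    (M : SigmaModule.{u, v} K) : M.IsKProjective :=
  fun _ _ =>
    letI := hK.toField
    Module.Projective.of_free

theorem mainTheorem6_general {K : Type u} [CommRing K]
    (P P' : DGOperad.{u, v} K) (hP : P.IsConnected) (hP' : P'.IsConnected)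
    (ψ : P.Hom P')
    (L : RightModule P) (L' : RightModule P')
    (hL : L.IsQuasiFree) (hL' : L'.IsQuasiFree)
    (φ : L.Hom (L'.restrict ψ))
    (hproj : ¬ IsField K →
      P.IsKProjective ∧ P'.IsKProjective ∧
        L.indecomposables.IsKProjective ∧ L'.indecomposables.IsKProjective) :
    (ψ.QuasiIso → φ.indecomposables.QuasiIso → φ.QuasiIso) ∧
    (ψ.QuasiIso → φ.QuasiIso → φ.indecomposables.QuasiIso) ∧
    (L.indecomposables.GroundRingInArityOne → L'.indecomposables.GroundRingInArityOne →
      φ.QuasiIso → φ.indecomposables.QuasiIso → ψ.QuasiIso) := by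
  obtain ⟨M, ι, h⟩ := hL
  obtain ⟨M', ι', h'⟩ := hL'
  obtain ⟨projP, projP', projL, projL'⟩ : P.IsKProjective ∧ P'.IsKProjective ∧
      L.indecomposables.IsKProjective ∧ L'.indecomposables.IsKProjective := by
    by_cases hK : IsField K
    · exact ⟨.of_isField hK _, .of_isField hK _, .of_isField hK _, .of_isField hK _⟩
    · exact hproj hK
  exact ⟨h.quasiIso h' hP hP' φ projP projP' projL projL',
    h.quasiIso_indecomposables h' hP hP' φ projP projP' projL projL',
    h.quasiIso_operad h' hP hP' φ projP projP' projL projL'⟩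

end OperadComparison

end

open OperadComparison in
theorem mainTheorem6 {K : Type u} [CommRing K]
    (P P' : DGOperad.{u, v} K) (hP : P.IsConnected) (hP' : P'.IsConnected)
    (ψ : P.Hom P')
    (L : RightModule P) (L' : RightModule P')
    (hL : L.IsQuasiFree) (hL' : L'.IsQuasiFree)
    (φ : L.Hom (L'.restrict ψ))
    (hproj : ¬ IsField K →
      P.IsKProjective ∧ P'.IsKProjective ∧
        L.indecomposables.IsKProjective ∧ L'.indecomposables.IsKProjective) :
    (ψ.QuasiIso → φ.indecomposables.QuasiIso → φ.QuasiIso) ∧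
    (ψ.QuasiIso → φ.QuasiIso → φ.indecomposables.QuasiIso) ∧
    (L.indecomposables.ZeroInArityZero → L'.indecomposables.ZeroInArityZero →
      L.indecomposables.GroundRingInArityOne → L'.indecomposables.GroundRingInArityOne →
      φ.QuasiIso → φ.indecomposables.QuasiIso → ψ.QuasiIso) := by
  obtain ⟨partA, partB, partC⟩ := mainTheorem6_general P P' hP hP' ψ L L' hL hL' φ hproj
  exact ⟨partA, partB, fun _ _ => partC⟩
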